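/- Let $(X,\mathcal F,\mu)$ be a $\sigma$-finite measure space; all functions are complex valued, $L_p=L_p(X,\mathcal F,\mu)$, and $Y^c=X\setminus Y$. Let $T\in DS^+$, i.e. $T:L_1+L_\infty\to L_1+L_\infty$ is linear, $\|Tf\|_1\le\|f\|_1$ for $f\in L_1$, $\|Tf\|_\infty\le\|f\|_\infty$ for $f\in L_\infty$, and $Tf\ge 0$ whenever $f\ge 0$ (then $T$ maps each $L_p$, $1\le p\le\infty$, into itself contractively). **Weights.** For $\alpha=\{\alpha_k\}_{k\ge0}\subset\mathbb C$ put $\|\alpha\|_{W_r}=\bigl(\limsup_{n}\frac1n\sum_{k=0}^{n-1}|\alpha_k|^r\bigr)^{1/r}$ if $1\le r<\infty$ and $\|\alpha\|_{W_\infty}=\sup_k|\alpha_k|$. Let $W_r$ be the set of $\alpha$ with $\|\alpha\|_{W_r}<\infty$, and let $W_{1^+}$ be the closure of $\bigcup_{1<r\le\infty}W_r$ in $W_1$ for the seminorm $\|\cdot\|_{W_1}$. Let $H$ be the set of $\alpha\in W_1$ such that $\lim_n\frac1n\sum_{k=0}^{n-1}\alpha_k\lambda^k$ exists for every $\lambda\in\mathbb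 C$ with $|\lambda|=1$ (the Hartman sequences in $W_1$). **Conditions on $T$.** For $1<q<\infty$ let $\mathcal V_q(T)$ be the set of flight vectors: those $f\in L_q$ such that $T^{n_j}f\to0$ weakly in $L_q$ for some $n_0<n_1<n_2<\cdots$. We say that $f_n\to f$ almost uniformly (a.u.) if for every $\epsilon>0$ there is $Y\in\mathcal F$ with $\mu(Y^c)\le\epsilon$ and $\|(f_n-f)\chi_Y\|_\infty\to0$. The iterates $\{T^n\}_{n\ge0}$ are uniformly equicontinuous in measure (u.e.m.) at zero on $L_q$ if for all $\epsilon,\delta>0$ there is $\gamma>0$ such that for every $f\in L_q$ with $\|f\|_q<\gamma$ there is $Y\in\mathcal F$ with $\mu(Y^c)\le\epsilon$ and $\sup_{n\ge0}\|(T^nf)\chi_Y\|_\infty\le\delta$. **Statement.** Fix $1<q<\infty$ and assume that $T^nf\to0$ a.u. for every $f\in\mathcal V_q(T)$. 1. For every $1\le p<\infty$, $f\in L_p$ and $\epsilon>0$ there is $Y\in\mathcal F$ with $\mu(Y^c)<\epsilon$ such that, for every $\alpha\in W_\infty\cap H$, the averages $\frac1n\sum_{k=0}^{n-1}\alpha_kT^kf$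 are bounded on $Y$ and converge uniformly on $Y$ as $n\to\infty$. 2. If moreover $\{T^n\}_{n\ge0}$ is u.e.m. at zero on $L_q$, then for every $f\in L_q$ and $\epsilon>0$ there is $Y\in\mathcal F$ with $\mu(Y^c)<\epsilon$ such that, for every $\alpha\in W_{1^+}\cap H$, the averages $\frac1n\sum_{k=0}^{n-1}\alpha_kT^kf$ are bounded on $Y$ and converge uniformly on $Y$ as $n\to\infty$. (Here a representative of each $T^kf$, $k\ge0$, is fixed before $Y$ is chosen; $Y$ does not depend on $\alpha$.) -/

import Mathlib

open MeasureTheory Filter Topology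
open scoped ENNReal

noncomputable section

/-! ### Weights -/

/-- The seminorm of a complex sequence `α` on the class `W_r`:
`(limsup_n (1/n) ∑_{k<n} |α_k|^r)^{1/r}` for `r < ∞`, and `sup_k |α_k|` for `r = ∞`
(with values in `[0, ∞]`). -/
def weightSeminorm (r : ℝ≥0∞) (α : ℕ → ℂ) : ℝ≥0∞ :=
  if r = ∞ then ⨆ k, ‖α k‖ₑ
  else (limsup (fun n : ℕ => (n : ℝ≥0∞)⁻¹ * ∑ k ∈ Finset.range n, ‖α k‖ₑ ^ r.toReal) atTop)
    ^ (1 / r.toReal)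

/-- The class `W_r` of weights, `1 ≤ r ≤ ∞`. -/
def weightClass (r : ℝ≥0∞) : Set (ℕ → ℂ) := {α | weightSeminorm r α < ∞}

/-- The class `W_{1+}`: the closure of `⋃_{r > 1} W_r` in `W_1` for the `W_1`-seminorm. -/
def weightClassOnePlus : Set (ℕ → ℂ) :=
  {α | α ∈ weightClass 1 ∧
    ∀ δ : ℝ≥0∞, 0 < δ → ∃ r : ℝ≥0∞, 1 < r ∧ ∃ β ∈ weightClass r, weightSeminorm 1 (α - β) < δ}

/-- The set `H` of Hartman sequences in `W_1`: all the limits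
`lim_n (1/n) ∑_{k<n} α_k z^k`, `|z| = 1`, exist. -/
def hartmanSequences : Set (ℕ → ℂ) :=
  {α | α ∈ weightClass 1 ∧ ∀ z : ℂ, ‖z‖ = 1 →
    ∃ c : ℂ, Tendsto (fun n : ℕ => (n : ℂ)⁻¹ * ∑ k ∈ Finset.range n, α k * z ^ k) atTop (𝓝 c)}

/-! ### Dunford-Schwartz operators -/

section Operators

variable {X : Type*} [MeasurableSpace X]

/-- The space `L_1 + L_∞` of (classes of) complex functions. -/
def L1AddLinf (μ : Measure X) : Submodule ℂ (X →ₘ[μ] ℂ) :=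
  Lp.LpSubmodule ℂ ℂ 1 μ ⊔ Lp.LpSubmodule ℂ ℂ ∞ μ

/-- `L_p ⊆ L_1 + L_∞` for `1 ≤ p ≤ ∞`. -/
theorem lpSubmodule_le_L1AddLinf (μ : Measure X) (p : ℝ≥0∞) (hp : 1 ≤ p) :
    Lp.LpSubmodule ℂ ℂ p μ ≤ L1AddLinf μ := by
  intro f hf
  have hf' : MemLp f p μ := Lp.mem_Lp_iff_memLp.1 hf
  rcases eq_or_ne p ∞ with rfl | hp'
  · exact Submodule.mem_sup_right hf
  have hmeas : MeasurableSet {x | 1 ≤ ‖f x‖} :=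
    measurableSet_le measurable_const f.stronglyMeasurable.norm.measurable
  have h1 : MemLp ({x | 1 ≤ ‖f x‖}.indicator f) 1 μ := by
    refine (hf'.norm_rpow (by positivity) hp').mono
      (f.stronglyMeasurable.indicator hmeas).aestronglyMeasurable (ae_of_all _ fun x => ?_)
    by_cases hx : x ∈ {x | 1 ≤ ‖f x‖}
    · rw [Set.indicator_of_mem hx, Real.norm_of_nonneg (by positivity)]
      refine Real.self_le_rpow_of_one_le hx ?_
      simpa using ENNReal.toReal_mono hp' hp
    · rw [Set.indicator_of_notMem hx, norm_zero]
      positivity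
  have h2 : MemLp ({x | 1 ≤ ‖f x‖}ᶜ.indicator f) ∞ μ := by
    refine memLp_top_of_bound (f.stronglyMeasurable.indicator hmeas.compl).aestronglyMeasurable 1
      (ae_of_all _ fun x => ?_)
    by_cases hx : x ∈ {x | 1 ≤ ‖f x‖}ᶜ
    · rw [Set.indicator_of_mem hx]
      exact (not_le.1 (show ¬ 1 ≤ ‖f x‖ from hx)).le
    · rw [Set.indicator_of_notMem hx, norm_zero]
      exact zero_le_one
  have hsum : f = (h1.toLp _ : X →ₘ[μ] ℂ) + (h2.toLp _ : X →ₘ[μ] ℂ) := by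
    refine AEEqFun.ext ?_
    filter_upwards [AEEqFun.coeFn_add (h1.toLp _ : X →ₘ[μ] ℂ) (h2.toLp _ : X →ₘ[μ] ℂ),
      h1.coeFn_toLp, h2.coeFn_toLp] with x h3 h4 h5
    rw [h3, Pi.add_apply, h4, h5, Set.indicator_self_add_compl_apply]
  rw [hsum]
  exact Submodule.add_mem_sup (h1.toLp _).2 (h2.toLp _).2

/-- The inclusion of `L_p` into `L_1 + L_∞`, `1 ≤ p ≤ ∞`. -/
def lpInclusion (μ : Measure X) (p : ℝ≥0∞) [hp : Fact (1 ≤ p)] :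
    Lp ℂ p μ →ₗ[ℂ] L1AddLinf μ where
  toFun f := ⟨f, lpSubmodule_le_L1AddLinf μ p hp.out f.2⟩
  map_add' _ _ := rfl
  map_smul' _ _ := rfl

open scoped ComplexOrder in
/-- `T ∈ DS⁺`: a linear operator on `L_1 + L_∞` that contracts the `L_1`-norm and the `L_∞`-norm
and preserves non-negativity (`0 ≤ z` for complex `z` means that `z` is real and non-negative). The
norms are extended-valued, so each bound says something only on `L_1`, respectively `L_∞`. -/
structure IsPositiveDunfordSchwartz {μ : Measure X} (T : Module.End ℂ (L1AddLinf μ)) : Prop where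
  norm_one_le : ∀ f : L1AddLinf μ,
    eLpNorm (T f : X →ₘ[μ] ℂ) 1 μ ≤ eLpNorm (f : X →ₘ[μ] ℂ) 1 μ
  norm_top_le : ∀ f : L1AddLinf μ,
    eLpNorm (T f : X →ₘ[μ] ℂ) ∞ μ ≤ eLpNorm (f : X →ₘ[μ] ℂ) ∞ μ
  nonneg : ∀ f : L1AddLinf μ, (∀ᵐ x ∂μ, 0 ≤ (f : X →ₘ[μ] ℂ) x) →
    ∀ᵐ x ∂μ, 0 ≤ (T f : X →ₘ[μ] ℂ) x

/-- The iterate `T^n f` of `f ∈ L_p`, as a class of functions. -/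
def lpIterate {μ : Measure X} (T : Module.End ℂ (L1AddLinf μ)) {p : ℝ≥0∞} [Fact (1 ≤ p)]
    (n : ℕ) (f : Lp ℂ p μ) : X →ₘ[μ] ℂ :=
  ((T ^ n) (lpInclusion μ p f) : L1AddLinf μ)

/-- The set `𝒱_q(T)` of flight vectors of `T` in `L_q`: those `f ∈ L_q` for which some subsequence
of the iterates `T^n f` converges to `0` weakly in `L_q`. Here `g j` is `T^{n_j} f` seen as an
element of `L_q`. -/
def flightVectors {μ : Measure X} (T : Module.End ℂ (L1AddLinf μ)) (q : ℝ≥0∞) [Fact (1 ≤ q)] :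
    Set (Lp ℂ q μ) :=
  {f | ∃ n : ℕ → ℕ, StrictMono n ∧ ∃ g : ℕ → Lp ℂ q μ,
    (∀ j, (g j : X →ₘ[μ] ℂ) = lpIterate T (n j) f) ∧
    ∀ φ : StrongDual ℂ (Lp ℂ q μ), Tendsto (fun j => φ (g j)) atTop (𝓝 0)}

/-- Almost uniform convergence: off sets of arbitrarily small measure, `f n → g` in the norm of
`L_∞`. -/
def TendstoAlmostUniformly (μ : Measure X) (f : ℕ → X →ₘ[μ] ℂ) (g : X →ₘ[μ] ℂ) : Prop :=
  ∀ ε : ℝ≥0∞, 0 < ε → ∃ Y : Set X, MeasurableSet Y ∧ μ Yᶜ ≤ ε ∧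
    Tendsto (fun n => eLpNorm (Y.indicator (f n - g : X →ₘ[μ] ℂ)) ∞ μ) atTop (𝓝 0)

/-- The iterates `T^n`, `n ≥ 0`, are uniformly equicontinuous in measure at zero on `L_q`. -/
def IteratesUEM {μ : Measure X} (T : Module.End ℂ (L1AddLinf μ)) (q : ℝ≥0∞) [Fact (1 ≤ q)] :
    Prop :=
  ∀ ε δ : ℝ≥0∞, 0 < ε → 0 < δ → ∃ γ : ℝ, 0 < γ ∧ ∀ f : Lp ℂ q μ, ‖f‖ < γ →
    ∃ Y : Set X, MeasurableSet Y ∧ μ Yᶜ ≤ ε ∧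
      ∀ n : ℕ, eLpNorm (Y.indicator (lpIterate T n f)) ∞ μ ≤ δ

/-- The weighted average `(1/n) ∑_{k<n} α_k T^k f` as a function on `X`. One representative of each
class `T^k f` is used, for all weights and all `n`. -/
def weightedAverage {μ : Measure X} (T : Module.End ℂ (L1AddLinf μ)) {p : ℝ≥0∞} [Fact (1 ≤ p)]
    (α : ℕ → ℂ) (n : ℕ) (f : Lp ℂ p μ) (x : X) : ℂ :=
  (n : ℂ)⁻¹ * ∑ k ∈ Finset.range n, α k * lpIterate T k f x

/-- The functions `F n` are bounded on `Y` and converge uniformly on `Y`. -/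
def ConvergesUniformlyOn (F : ℕ → X → ℂ) (Y : Set X) : Prop :=
  (∀ n, ∃ C : ℝ, ∀ x ∈ Y, ‖F n x‖ ≤ C) ∧ ∃ g : X → ℂ, TendstoUniformlyOn F g atTop Y

end Operators

end

/-!
The theorem rests on a splitting of `L_1 ∩ L_∞` under `T` into a flight part and a part spanned by
eigenvectors with unimodular eigenvalue, and on the Banach principle.

*Splitting.* `T` is a contraction `V` of the Hilbert space `L_2`
(`IsPositiveDunfordSchwartz.toL2`, by Jensen's inequality `|T f|² ≤ T |f|²`). If `f` is orthogonal
to all eigenvectors of `V` with unimodular eigenvalue, then along suitable times its orbit is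
nearly orthogonal to any finitely many given vectors (`exists_inner_iterate_lt`): an ultralimit of
the averages of the rank one operators `⟪·, Vⁿ f⟫ Vⁿ f` is a positive operator of finite trace,
invariant under `A ↦ V A V†`, and if it were not zero, its top eigenspace would contain an
eigenvector of `V` that is not orthogonal to `f`. So some subsequence of the orbit is nearly
orthogonal. If `f` is also bounded in `L_1` and in `L_∞`, averages over many terms of this
subsequence are small in `L_2`, hence small in `L_q`, `1 < q < ∞`, and it follows that the
subsequence converges weakly to `0` in `L_q`, that is, `f` is a flight vector
(`mem_flightVectors_of_orthogonal`). The projection of `f` to the closed span of the unimodular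
eigenvectors is approximated in `L_2` by Bochner–Fejér means of the orbit of `f`
(`exists_kernelAverage_near_eigenProjection`). These are finite sums of eigenvectors, and they are
limits of averages of the orbit with non-negative weights, so they inherit the bounds of `f` in
`L_1` and `L_∞`; therefore the approximation takes place in `L_q` too. In this way a function in
`L_1 ∩ L_∞` is, up to a small error in `L_q`, the sum of a flight vector and of finitely many
eigenvectors (`exists_flight_add_eigen_add_small`).

*Convergence.* The property `WienerWintner T W f` says that off small sets, independent of the
weight `α ∈ W`, the averages are uniformly Cauchy. It holds for eigenvectors with unimodular
eigenvalue, as the averages are multiples of the eigenvector by the Hartman means of `α`, and for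
flight vectors, where by hypothesis `T^n f → 0` almost uniformly. It passes to limits
(`WienerWintner.of_approx`) as soon as errors that are small in norm have uniformly small averages
off small sets. For bounded weights and `L_p`, `p < ∞`, this is the maximal inequality
`exists_forall_sum_norm_iterate_le`, which follows from Hopf's maximal lemma. For weights in `W_1`
and `L_q` it follows from equicontinuity in measure: all `|T^k r|` are small simultaneously. Since
`L_1 ∩ L_∞` is dense in `L_p` and in `L_q`, both parts of the theorem follow.
-/

/-! ### Positive operators and rank one averages on a Hilbert space -/

section Hilbert

variable {H : Type*} [NormedAddCommGroup H] [InnerProductSpace ℂ H]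

/-- This is `0 ≤ ⟪A w, w⟫` for `w = y - ‖A‖⁻¹ A y`. -/
theorem ContinuousLinearMap.IsPositive.norm_apply_sq_le {A : H →L[ℂ] H} (hA : A.IsPositive)
    (y : H) : ‖A y‖ ^ 2 ≤ ‖A‖ * (inner ℂ (A y) y).re := by
  rcases eq_or_ne ‖A‖ 0 with h0 | h0
  · have : A y = 0 := by simp [norm_eq_zero.1 h0]
    simp [this]
  have hpos : 0 < ‖A‖ := lt_of_le_of_ne (norm_nonneg _) (Ne.symm h0)
  set t : ℝ := ‖A‖⁻¹
  have h1 := hA.re_inner_nonneg_left (y - (t : ℂ) • A y)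
  have h2 : (inner ℂ (A (A y)) (A y)).re ≤ ‖A‖ * ‖A y‖ ^ 2 := by
    calc (inner ℂ (A (A y)) (A y)).re ≤ ‖A (A y)‖ * ‖A y‖ := re_inner_le_norm (𝕜 := ℂ) _ _
      _ ≤ (‖A‖ * ‖A y‖) * ‖A y‖ := by gcongr; exact A.le_opNorm _
      _ = _ := by ring
  have h3 : inner ℂ (A (A y)) y = inner ℂ (A y) (A y) := hA.inner_left_eq_inner_right _ _
  have h4 : (inner ℂ (A y) (A y)).re = ‖A y‖ ^ 2 := inner_self_eq_norm_sq (𝕜 := ℂ) _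
  simp only [map_sub, map_smul, inner_sub_left, inner_sub_right, inner_smul_left, inner_smul_right,
    h3, Complex.conj_ofReal, RCLike.re_to_complex, Complex.sub_re, Complex.re_ofReal_mul, h4] at h1
  have h5 : t * ‖A‖ = 1 := inv_mul_cancel₀ h0
  have ht : 0 < t := inv_pos.2 hpos
  have h6 : t * (t * (inner ℂ (A (A y)) (A y)).re) ≤ t * ‖A y‖ ^ 2 := by
    calc t * (t * (inner ℂ (A (A y)) (A y)).re) ≤ t * (t * (‖A‖ * ‖A y‖ ^ 2)) := by gcongr
      _ = t * ((t * ‖A‖) * ‖A y‖ ^ 2) := by ring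
      _ = _ := by rw [h5, one_mul]
  have h7 : t * ‖A y‖ ^ 2 ≤ (inner ℂ (A y) y).re := by linarith
  calc ‖A y‖ ^ 2 = ‖A‖ * (t * ‖A y‖ ^ 2) := by rw [← mul_assoc, mul_comm ‖A‖ t, h5, one_mul]
    _ ≤ _ := by gcongr

variable [CompleteSpace H]

/-- A positive operator with finite trace is compact: off the span of finitely many orthonormal
vectors that nearly exhaust the trace, its quadratic form is small. -/
theorem ContinuousLinearMap.IsPositive.isCompactOperator_of_trace_le {A : H →L[ℂ] H}
    (hA : A.IsPositive) (K : ℝ)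
    (hK : ∀ s : Finset H, Orthonormal ℂ (fun x : s => (x : H)) → ∑ x ∈ s, (inner ℂ (A x) x).re ≤ K) :
    IsCompactOperator A := by
  classical
  set S : Set ℝ := {r | ∃ s : Finset H, Orthonormal ℂ (fun x : s => (x : H)) ∧
    r = ∑ x ∈ s, (inner ℂ (A x) x).re} with hS
  have hne : S.Nonempty := ⟨0, ∅, by simp [Orthonormal], by simp⟩
  have hbdd : BddAbove S := ⟨K, by rintro r ⟨s, hs, rfl⟩; exact hK s hs⟩
  have hclosed : IsClosed {f : H →L[ℂ] H | IsCompactOperator f} := isClosed_setOfPred_isCompactOperator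
  change A ∈ {f : H →L[ℂ] H | IsCompactOperator f}
  rw [← hclosed.closure_eq, Metric.mem_closure_iff]
  intro ε hε
  set η : ℝ := (ε / 2) ^ 2 / (‖A‖ + 1) with hη
  have hηpos : 0 < η := by positivity
  obtain ⟨r, ⟨s, hs, rfl⟩, hr⟩ := exists_lt_of_lt_csSup hne (sub_lt_self (sSup S) hηpos)
  -- a unit vector orthogonal to `s` can be added to `s`, and this increases the trace by at most `η`
  have hsmall1 : ∀ u : H, ‖u‖ = 1 → (∀ x ∈ s, inner ℂ x u = 0) → (inner ℂ (A u) u).re ≤ η := by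
    intro u hu hus
    have hun : u ∉ s := fun h => by
      have := hus u h
      rw [inner_self_eq_zero] at this
      simp [this] at hu
    have hon : Orthonormal ℂ (fun x : (insert u s : Finset H) => (x : H)) := by
      have h1 := orthonormal_iff_ite.1 hs
      rw [orthonormal_iff_ite]
      rintro ⟨v, hv⟩ ⟨w, hw⟩
      simp only [Subtype.mk.injEq]
      rcases Finset.mem_insert.1 hv with rfl | hv' <;>
        rcases Finset.mem_insert.1 hw with rfl | hw'
      · rw [inner_self_eq_norm_sq_to_K, hu]; simp
      · rw [← inner_conj_symm, hus w hw', if_neg (by rintro rfl; exact hun hw')]; simp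
      · rw [hus v hv', if_neg (by rintro rfl; exact hun hv')]
      · simpa using h1 ⟨v, hv'⟩ ⟨w, hw'⟩
    have := le_csSup hbdd ⟨insert u s, hon, rfl⟩
    rw [Finset.sum_insert hun] at this
    linarith
  have hsmall : ∀ y : H, (∀ x ∈ s, inner ℂ x y = 0) → (inner ℂ (A y) y).re ≤ η * ‖y‖ ^ 2 := by
    intro y hy
    rcases eq_or_ne y 0 with rfl | hy0
    · simp
    have hn : ‖y‖ ≠ 0 := norm_ne_zero_iff.2 hy0
    have h1 := hsmall1 ((‖y‖⁻¹ : ℂ) • y) (by simp [norm_smul, hn])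
      (fun x hx => by rw [inner_smul_right, hy x hx, mul_zero])
    have h2 : (inner ℂ (A ((‖y‖⁻¹ : ℂ) • y)) ((‖y‖⁻¹ : ℂ) • y)).re
        = ‖y‖⁻¹ * (‖y‖⁻¹ * (inner ℂ (A y) y).re) := by
      rw [map_smul, inner_smul_left, inner_smul_right, ← Complex.ofReal_inv, Complex.conj_ofReal,
        Complex.re_ofReal_mul, Complex.re_ofReal_mul]
    rw [h2] at h1
    have hp : 0 < ‖y‖ := norm_pos_iff.2 hy0
    calc (inner ℂ (A y) y).re = (‖y‖⁻¹ * (‖y‖⁻¹ * (inner ℂ (A y) y).re)) * ‖y‖ ^ 2 := by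
          field_simp
      _ ≤ _ := by gcongr
  set E : Submodule ℂ H := Submodule.span ℂ (s : Set H)
  have : FiniteDimensional ℂ E := FiniteDimensional.span_finset ℂ s
  -- `A` is close to the finite rank operator `A ∘ P`, `P` the projection to the span of `s`
  refine ⟨A ∘L E.starProjection, ?_, ?_⟩
  · have : IsCompactOperator (E.subtypeL ∘L E.orthogonalProjectionOnto) := by
      have h := isCompactOperator_of_locallyCompactSpace_dom (M₁ := H) E.orthogonalProjectionOnto
      exact h.clm_comp E.subtypeL
    exact this.clm_comp A
  rw [dist_eq_norm]
  refine lt_of_le_of_lt (ContinuousLinearMap.opNorm_le_bound _ (half_pos hε).le fun v => ?_)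
    (half_lt_self hε)
  set y := v - E.starProjection v with hy
  have hy1 : ∀ x ∈ s, inner ℂ x y = 0 := by
    intro x hx
    have : y ∈ Eᗮ := by
      rw [hy]; exact Submodule.sub_starProjection_mem_orthogonal v
    exact this x (Submodule.subset_span hx)
  have hyn : ‖y‖ ≤ ‖v‖ := by
    have h := Submodule.norm_sq_eq_add_norm_sq_projection v E
    have h2 : y = Eᗮ.starProjection v := by
      rw [hy, Submodule.starProjection_orthogonal]; simp
    rw [h2]
    exact Submodule.norm_starProjection_apply_le _ _
  have h1 : (A - A ∘L E.starProjection) v = A y := by simp [hy]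
  rw [h1]
  have h2 := hA.norm_apply_sq_le y
  have h3 := hsmall y hy1
  have h4 : ‖A y‖ ^ 2 ≤ (ε / 2 * ‖v‖) ^ 2 := by
    calc ‖A y‖ ^ 2 ≤ ‖A‖ * (η * ‖y‖ ^ 2) := h2.trans (by gcongr)
      _ ≤ (‖A‖ + 1) * (η * ‖v‖ ^ 2) := by gcongr; linarith
      _ = _ := by rw [hη]; field_simp
  exact le_of_sq_le_sq h4 (by positivity)

/-- The averages of the rank one forms of a bounded sequence `x` have, along any ultrafilter, a limit
in the weak operator topology. -/
theorem exists_ultrafilter_limit_rank_one (U : Ultrafilter ℕ) {x : ℕ → H} {C : ℝ}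
    (hx : ∀ n, ‖x n‖ ≤ C) :
    ∃ A : H →L[ℂ] H, ∀ u v : H, Tendsto (fun N : ℕ => (N : ℂ)⁻¹ * ∑ n ∈ Finset.range N,
      inner ℂ u (x n) * inner ℂ (x n) v) U (𝓝 (inner ℂ (A u) v)) := by
  have hC : 0 ≤ C := (norm_nonneg _).trans (hx 0)
  set b : H → H → ℕ → ℂ := fun u v N => ((N : ℕ) : ℂ)⁻¹ * ∑ n ∈ Finset.range N,
      inner ℂ u (x n) * inner ℂ (x n) v with hb
  have hbound : ∀ (u v : H) (N : ℕ), ‖b u v N‖ ≤ C ^ 2 * ‖u‖ * ‖v‖ := by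
    intro u v N
    rcases Nat.eq_zero_or_pos N with rfl | hN
    · simp only [hb]; simp; positivity
    have h1 : ‖∑ n ∈ Finset.range N, inner ℂ u (x n) * inner ℂ (x n) v‖
        ≤ N * (C ^ 2 * ‖u‖ * ‖v‖) := by
      refine (norm_sum_le_of_le _ (f := fun n => inner ℂ u (x n) * inner ℂ (x n) v)
        (n := fun _ => C ^ 2 * ‖u‖ * ‖v‖) fun n _ => ?_).trans (by simp)
      rw [norm_mul]
      calc ‖inner ℂ u (x n)‖ * ‖inner ℂ (x n) v‖ ≤ (‖u‖ * ‖x n‖) * (‖x n‖ * ‖v‖) := by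
            gcongr <;> exact norm_inner_le_norm _ _
        _ ≤ (‖u‖ * C) * (C * ‖v‖) := by gcongr <;> exact hx n
        _ = _ := by ring
    have hN' : (0 : ℝ) < N := by exact_mod_cast hN
    rw [hb]
    simp only [norm_mul, norm_inv, RCLike.norm_natCast]
    rw [inv_mul_le_iff₀ hN']
    exact h1
  have hlim : ∀ u v, ∃ z, Tendsto (b u v) U (𝓝 z) := by
    intro u v
    obtain ⟨z, -, hz⟩ := (isCompact_closedBall (0 : ℂ) (C ^ 2 * ‖u‖ * ‖v‖)).ultrafilter_le_nhds
      (U.map (b u v)) (by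
        rw [le_principal_iff]
        exact Filter.mem_map.2 (Filter.univ_mem' fun N => by simpa using hbound u v N))
    exact ⟨z, hz⟩
  choose L hL using hlim
  have hadd1 : ∀ u u' v, L (u + u') v = L u v + L u' v := fun u u' v => by
    refine tendsto_nhds_unique (hL (u + u') v) (((hL u v).add (hL u' v)).congr fun N => ?_)
    simp only [hb, inner_add_left, add_mul, Finset.sum_add_distrib, mul_add]
  have hadd2 : ∀ u v v', L u (v + v') = L u v + L u v' := fun u v v' => by
    refine tendsto_nhds_unique (hL u (v + v')) (((hL u v).add (hL u v')).congr fun N => ?_)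
    simp only [hb, inner_add_right, mul_add, Finset.sum_add_distrib]
  have hsm1 : ∀ (c : ℂ) u v, L (c • u) v = (starRingEnd ℂ) c * L u v := fun c u v => by
    refine tendsto_nhds_unique (hL (c • u) v) (((hL u v).const_mul (starRingEnd ℂ c)).congr
      fun N => ?_)
    simp only [hb, inner_smul_left, Finset.mul_sum]
    exact Finset.sum_congr rfl fun n _ => by ring
  have hsm2 : ∀ (c : ℂ) u v, L u (c • v) = c * L u v := fun c u v => by
    refine tendsto_nhds_unique (hL u (c • v)) (((hL u v).const_mul c).congr
      fun N => ?_)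
    simp only [hb, inner_smul_right, Finset.mul_sum]
    exact Finset.sum_congr rfl fun n _ => by ring
  have hLb : ∀ u v, ‖L u v‖ ≤ C ^ 2 * ‖u‖ * ‖v‖ := fun u v =>
    le_of_tendsto (hL u v).norm (Eventually.of_forall (hbound u v))
  set B : H →ₗ⋆[ℂ] H →ₗ[ℂ] ℂ := LinearMap.mk₂'ₛₗ (starRingEnd ℂ) (RingHom.id ℂ) L hadd1 hsm1 hadd2 hsm2
  set B' : H →L⋆[ℂ] H →L[ℂ] ℂ := B.mkContinuous₂ (C ^ 2) hLb
  refine ⟨InnerProductSpace.continuousLinearMapOfBilin B', fun u v => ?_⟩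
  rw [InnerProductSpace.continuousLinearMapOfBilin_apply]
  exact hL u v

/-- For a contraction, an eigenvector with unimodular eigenvalue is an eigenvector of the adjoint. -/
theorem ContinuousLinearMap.adjoint_apply_eq_of_apply_eq {V : H →L[ℂ] H} (hV : ‖V‖ ≤ 1) {u : H}
    {z : ℂ} (hz : ‖z‖ = 1) (hu : V u = z • u) : V.adjoint u = (starRingEnd ℂ) z • u := by
  refine eq_of_norm_le_re_inner_eq_norm_sq (𝕜 := ℂ) ?_ ?_
  · rw [norm_smul, RCLike.norm_conj, hz, one_mul]
    simpa using V.adjoint.le_of_opNorm_le (c := 1) (by rwa [LinearIsometryEquiv.norm_map]) u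
  · rw [ContinuousLinearMap.adjoint_inner_left, map_smul, hu, smul_smul]
    have : (starRingEnd ℂ) z * z = 1 := by
      rw [← Complex.normSq_eq_conj_mul_self, Complex.normSq_eq_norm_sq, hz]; simp
    rw [this, one_smul, norm_smul, RCLike.norm_conj, hz, one_mul]
    exact inner_self_eq_norm_sq _

end Hilbert

/-! ### Orbits orthogonal to the unimodular eigenvectors -/

section Flight

variable {H : Type*} [NormedAddCommGroup H] [InnerProductSpace ℂ H]

/-- An operator on a nontrivial finite-dimensional space that preserves norms has an eigenvector,
and the eigenvalue is unimodular. -/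
theorem exists_unimodular_eigenvector {E : Submodule ℂ H} [FiniteDimensional ℂ E] (hE : E ≠ ⊥)
    (S : H →L[ℂ] H) (hS : ∀ u ∈ E, S u ∈ E) (hn : ∀ u ∈ E, ‖S u‖ = ‖u‖) :
    ∃ u ∈ E, u ≠ 0 ∧ ∃ z : ℂ, ‖z‖ = 1 ∧ S u = z • u := by
  have : Nontrivial E := (Submodule.nontrivial_iff_ne_bot).2 hE
  obtain ⟨z, hz⟩ := Module.End.exists_eigenvalue ((S : H →ₗ[ℂ] H).restrict hS)
  obtain ⟨v, hv⟩ := hz.exists_hasEigenvector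
  have h1 : S v = z • (v : H) := congrArg Subtype.val hv.apply_eq_smul
  have hv0 : (v : H) ≠ 0 := fun h => hv.2 (Subtype.ext h)
  refine ⟨v, v.2, hv0, z, ?_, h1⟩
  have h2 := hn v v.2
  rw [h1, norm_smul] at h2
  exact (mul_eq_right₀ (norm_ne_zero_iff.2 hv0)).1 h2

theorem norm_pow_apply_le {V : H →L[ℂ] H} (hV : ‖V‖ ≤ 1) (n : ℕ) (f : H) : ‖(V ^ n) f‖ ≤ ‖f‖ := by
  induction n with
  | zero => simp
  | succ n ih =>
    rw [pow_succ']
    exact ((V.le_of_opNorm_le hV ((V ^ n) f)).trans (one_mul _).le).trans ih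

theorem pow_apply_eq_of_apply_eq {V : H →L[ℂ] H} {u : H} {z : ℂ} (hu : V u = z • u) (n : ℕ) :
    (V ^ n) u = z ^ n • u := by
  induction n with
  | zero => simp
  | succ n ih =>
    rw [pow_succ', mul_apply_eq_comp, ih, map_smul, hu, smul_smul, pow_succ]

/-- For nearly orthogonal vectors the average of `m` of them, with unimodular coefficients, has norm
of order `m ^ (-1/2)`. -/
theorem norm_sum_smul_sq_le {x : ℕ → H} {C : ℝ} (hx : ∀ j, ‖x j‖ ≤ C)
    (hort : ∀ i j, i < j → ‖inner ℂ (x i) (x j)‖ ≤ 1 / (j + 1)) (c : ℕ → ℂ) (hc : ∀ j, ‖c j‖ ≤ 1)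
    (J : Finset ℕ) : ‖∑ j ∈ J, c j • x j‖ ^ 2 ≤ (C ^ 2 + 2) * J.card := by
  classical
  induction J using Finset.induction_on_max with
  | empty => simp
  | insert a s ha ih =>
    have hna : a ∉ s := fun h => lt_irrefl _ (ha a h)
    rw [Finset.sum_insert hna, Finset.card_insert_of_notMem hna, add_comm (c a • x a),
      @norm_add_sq ℂ]
    have h1 : ‖c a • x a‖ ^ 2 ≤ C ^ 2 := by
      rw [norm_smul]
      gcongr
      calc ‖c a‖ * ‖x a‖ ≤ 1 * C := by gcongr; exacts [hc a, hx a]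
        _ = C := one_mul C
    have h2 : RCLike.re (inner ℂ (∑ j ∈ s, c j • x j) (c a • x a)) ≤ 1 := by
      refine (RCLike.re_le_norm _).trans ?_
      rw [sum_inner]
      calc ‖∑ j ∈ s, inner ℂ (c j • x j) (c a • x a)‖ ≤ ∑ j ∈ s, (1 / (a + 1) : ℝ) := by
            refine norm_sum_le_of_le _ fun j hj => ?_
            rw [inner_smul_left, inner_smul_right, norm_mul, norm_mul, RCLike.norm_conj]
            calc ‖c j‖ * (‖c a‖ * ‖inner ℂ (x j) (x a)‖) ≤ 1 * (1 * (1 / (a + 1))) := by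
                  gcongr
                  exacts [hc j, hc a, hort j a (ha j hj)]
              _ = _ := by ring
        _ = s.card * (1 / (a + 1) : ℝ) := by simp
        _ ≤ (a + 1) * (1 / (a + 1) : ℝ) := by
            gcongr
            have : s.card ≤ a := by
              simpa using Finset.card_le_card (show s ⊆ Finset.range a from
                fun j hj => Finset.mem_range.2 (ha j hj))
            have : (s.card : ℝ) ≤ a := by exact_mod_cast this
            linarith
        _ = 1 := by field_simp
    push_cast
    linarith

variable [CompleteSpace H]

open scoped ComplexOrder in
/-- A nonzero compact positive operator attains its norm as an eigenvalue. -/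
theorem ContinuousLinearMap.IsPositive.hasEigenvalue_norm {A : H →L[ℂ] H} (hA : A.IsPositive)
    (hc : IsCompactOperator A) (h0 : A ≠ 0) :
    Module.End.HasEigenvalue (A : Module.End ℂ H) (‖A‖ : ℂ) := by
  have hnt : Nontrivial H := by
    by_contra h
    rw [not_nontrivial_iff_subsingleton] at h
    exact h0 (ContinuousLinearMap.ext fun x => Subsingleton.elim _ _)
  obtain ⟨z, hz, hzn⟩ := spectrum.exists_nnnorm_eq_spectralRadius (A := H →L[ℂ] H) A
  rw [ContinuousLinearMap.spectralRadius_eq_nnnorm A hA.isSelfAdjoint] at hzn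
  have hzn' : ‖z‖ = ‖A‖ := by exact_mod_cast congrArg ENNReal.toReal hzn
  have hz0 : z ≠ 0 := by
    rintro rfl
    rw [norm_zero, eq_comm, norm_eq_zero] at hzn'
    exact h0 hzn'
  have hev := (hc.hasEigenvalue_iff_mem_spectrum hz0).2 hz
  obtain ⟨v, hv⟩ := hev.exists_hasEigenvector
  have hv1 : A v = z • v := hv.apply_eq_smul
  have h2 := hA.inner_nonneg_right v
  rw [hv1, inner_smul_right, inner_self_eq_norm_sq_to_K] at h2
  have hvn : 0 < ‖v‖ := norm_pos_iff.2 hv.2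
  have hz1 : 0 ≤ z := by
    have h3 : (0 : ℂ) ≤ ((‖v‖ ^ 2)⁻¹ : ℝ) := by
      rw [Complex.zero_le_real]; positivity
    have h4 := mul_nonneg h2 h3
    have h5 : z * (‖v‖ : ℂ) ^ 2 * ((‖v‖ ^ 2)⁻¹ : ℝ) = z := by
      have : (‖v‖ : ℂ) ≠ 0 := by exact_mod_cast hvn.ne'
      push_cast
      field_simp
    exact h5 ▸ h4
  have : z = (‖A‖ : ℂ) := by
    rw [← hzn', Complex.norm_of_nonneg' hz1]
  rwa [← this]

/-- Wiener-type lemma: the orbit of a vector orthogonal to all eigenvectors with unimodular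
eigenvalue of a contraction is, along suitable large times, nearly orthogonal to finitely many given
vectors. Otherwise an ultralimit `A` of the operators `(1/N) ∑ₙ ⟪·, Vⁿf⟫ Vⁿf` would be a nonzero
positive operator of finite trace with `V A V† = A`, and its top eigenspace would contain an
eigenvector of `V` that is not orthogonal to `f`. -/
theorem exists_inner_iterate_lt {V : H →L[ℂ] H} (hV : ‖V‖ ≤ 1) {f : H}
    (hf : ∀ (z : ℂ) (u : H), ‖z‖ = 1 → V u = z • u → inner ℂ u f = 0)
    (G : Finset H) {η : ℝ} (hη : 0 < η) (N₀ : ℕ) :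
    ∃ n, N₀ ≤ n ∧ ∀ g ∈ G, ‖inner ℂ g ((V ^ n) f)‖ < η := by
  by_contra hcon
  push Not at hcon
  have hVn := fun n => norm_pow_apply_le hV n f
  obtain ⟨A, hA⟩ := exists_ultrafilter_limit_rank_one (hyperfilter ℕ) hVn
  set U := hyperfilter ℕ
  have hU : (U : Filter ℕ) ≤ atTop := Nat.hyperfilter_le_atTop
  set r : H → ℕ → ℝ := fun u N => (N : ℝ)⁻¹ * ∑ n ∈ Finset.range N, ‖inner ℂ u ((V ^ n) f)‖ ^ 2
    with hr
  have hAr' : ∀ u, Tendsto (fun N => ((r u N : ℝ) : ℂ)) U (𝓝 (inner ℂ (A u) u)) := by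
    intro u
    refine (hA u u).congr fun N => ?_
    simp only [hr, Complex.ofReal_mul, Complex.ofReal_inv, Complex.ofReal_natCast,
      Complex.ofReal_sum, Complex.ofReal_pow]
    congr 1
    refine Finset.sum_congr rfl fun n _ => ?_
    rw [← inner_conj_symm ((V ^ n) f) u, Complex.mul_conj, Complex.normSq_eq_norm_sq,
      Complex.ofReal_pow]
  have hAr : ∀ u, Tendsto (r u) U (𝓝 (inner ℂ (A u) u).re) := fun u =>
    ((Complex.continuous_re.tendsto _).comp (hAr' u)).congr fun N => by simp
  have hr0 : ∀ u N, 0 ≤ r u N := fun u N => by simp only [hr]; positivity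
  have hre0 : ∀ u, 0 ≤ (inner ℂ (A u) u).re := fun u =>
    ge_of_tendsto (hAr u) (Eventually.of_forall (hr0 u))
  have hreal : ∀ u, (((inner ℂ (A u) u).re : ℝ) : ℂ) = inner ℂ (A u) u := fun u =>
    tendsto_nhds_unique ((Complex.continuous_ofReal.tendsto _).comp (hAr u)) (hAr' u)
  have hpos : A.IsPositive := by
    rw [ContinuousLinearMap.isPositive_iff_complex]
    exact fun u => ⟨hreal u, hre0 u⟩
  -- the trace is at most `‖f‖²`, by Bessel's inequality for each `Vⁿ f`
  have hcomp : IsCompactOperator A := by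
    refine hpos.isCompactOperator_of_trace_le (‖f‖ ^ 2) fun s hs => ?_
    refine le_of_tendsto (tendsto_finsetSum s fun u _ => hAr u) (Eventually.of_forall fun N => ?_)
    simp only [hr]
    rw [← Finset.mul_sum, Finset.sum_comm]
    rcases Nat.eq_zero_or_pos N with rfl | hN
    · simp
    have hN' : (0 : ℝ) < N := by exact_mod_cast hN
    rw [inv_mul_le_iff₀ hN']
    refine (Finset.sum_le_sum (g := fun _ => ‖f‖ ^ 2) fun n _ => ?_).trans (by simp)
    have hb := hs.sum_inner_products_le (s := Finset.univ) ((V ^ n) f)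
    rw [Finset.sum_coe_sort s (fun x => ‖inner ℂ x ((V ^ n) f)‖ ^ 2)] at hb
    exact hb.trans (by gcongr; exact hVn n)
  -- `V A V† = A`, as the averages of the shifted sequence differ by a telescoping sum
  have hinv : ∀ u, (inner ℂ (A (V.adjoint u)) (V.adjoint u)).re = (inner ℂ (A u) u).re := by
    intro u
    have h1 : Tendsto (fun N => r (V.adjoint u) N - r u N) U (𝓝 0) := by
      have hz : Tendsto (fun N : ℕ => (N : ℝ)⁻¹ * (2 * (‖u‖ * ‖f‖) ^ 2)) U (𝓝 0) := by
        have := (tendsto_inv_atTop_nhds_zero_nat (𝕜 := ℝ)).mul_const (2 * (‖u‖ * ‖f‖) ^ 2)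
        rw [zero_mul] at this
        exact this.mono_left hU
      refine squeeze_zero_norm (fun N => ?_) hz
      have h2 : ∀ n, ‖inner ℂ u ((V ^ n) f)‖ ^ 2 ≤ (‖u‖ * ‖f‖) ^ 2 := fun n => by
        gcongr
        exact (norm_inner_le_norm _ _).trans (by gcongr; exact hVn n)
      have h3 : r (V.adjoint u) N - r u N
          = (N : ℝ)⁻¹ * (‖inner ℂ u ((V ^ N) f)‖ ^ 2 - ‖inner ℂ u ((V ^ 0) f)‖ ^ 2) := by
        simp only [hr]
        rw [← mul_sub, ← Finset.sum_sub_distrib,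
          ← Finset.sum_range_sub (fun n => ‖inner ℂ u ((V ^ n) f)‖ ^ 2)]
        congr 1
        refine Finset.sum_congr rfl fun n _ => ?_
        rw [ContinuousLinearMap.adjoint_inner_left, pow_succ' V n, mul_apply_eq_comp]
      rw [h3, norm_mul, norm_inv, RCLike.norm_natCast]
      gcongr
      rw [Real.norm_eq_abs, abs_le]
      constructor <;> nlinarith [h2 N, h2 0, sq_nonneg ‖inner ℂ u ((V ^ N) f)‖,
        sq_nonneg ‖inner ℂ u ((V ^ 0) f)‖]
    exact sub_eq_zero.1 (tendsto_nhds_unique ((hAr (V.adjoint u)).sub (hAr u)) h1)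
  -- each time `n ≥ N₀` contributes at least `η²` to the sum of the quadratic forms over `G`
  have hA0 : A ≠ 0 := by
    intro h0
    have h1 : Tendsto (fun N => ∑ g ∈ G, r g N) U (𝓝 (∑ g ∈ G, (inner ℂ (A g) g).re)) :=
      tendsto_finsetSum G fun u _ => hAr u
    have h2 : ∀ᶠ N : ℕ in U, η ^ 2 / 2 ≤ ∑ g ∈ G, r g N := by
      refine Filter.Eventually.filter_mono hU ?_
      filter_upwards [eventually_ge_atTop (2 * N₀ + 1)] with N hN
      simp only [hr]
      rw [← Finset.mul_sum, Finset.sum_comm]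
      have hN' : (0 : ℝ) < N := by exact_mod_cast (by omega : 0 < N)
      rw [le_inv_mul_iff₀ hN']
      calc (N : ℝ) * (η ^ 2 / 2) ≤ ((N - N₀ : ℕ) : ℝ) * η ^ 2 := by
            have : (2 * N₀ + 1 : ℝ) ≤ N := by exact_mod_cast hN
            rw [Nat.cast_sub (by omega)]
            nlinarith [sq_nonneg η]
        _ = ∑ n ∈ Finset.Ico N₀ N, η ^ 2 := by simp
        _ ≤ ∑ n ∈ Finset.Ico N₀ N, ∑ g ∈ G, ‖inner ℂ g ((V ^ n) f)‖ ^ 2 := by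
            refine Finset.sum_le_sum fun n hn => ?_
            obtain ⟨g, hg, hgn⟩ := hcon n (Finset.mem_Ico.1 hn).1
            refine le_trans ?_ (Finset.single_le_sum
              (f := fun g => ‖inner ℂ g ((V ^ n) f)‖ ^ 2) (fun _ _ => by positivity) hg)
            gcongr
        _ ≤ _ := Finset.sum_le_sum_of_subset_of_nonneg
            (fun n hn => Finset.mem_range.2 (Finset.mem_Ico.1 hn).2) fun _ _ _ => by positivity
    have h3 := ge_of_tendsto h1 h2
    simp only [h0, zero_apply, inner_zero_left, Complex.zero_re,
      Finset.sum_const_zero] at h3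
    nlinarith [pow_pos hη 2]
  have hAn : 0 < ‖A‖ := norm_pos_iff.2 hA0
  have hev := hpos.hasEigenvalue_norm hcomp hA0
  set E := Module.End.eigenspace (A : Module.End ℂ H) (‖A‖ : ℂ) with hEdef
  have hfin : FiniteDimensional ℂ E :=
    ContinuousLinearMap.finite_dimensional_eigenspace hcomp _ (by exact_mod_cast hAn.ne')
  have hEmem : ∀ u, u ∈ E ↔ A u = (‖A‖ : ℂ) • u := fun u => Module.End.mem_eigenspace_iff
  have hquad : ∀ u ∈ E, (inner ℂ (A u) u).re = ‖A‖ * ‖u‖ ^ 2 := fun u hu => by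
    rw [(hEmem u).1 hu, inner_smul_left, Complex.conj_ofReal, Complex.re_ofReal_mul]
    congr 1
    exact inner_self_eq_norm_sq (𝕜 := ℂ) u
  have hadj : ∀ u, ‖V.adjoint u‖ ≤ ‖u‖ := fun u => by
    simpa using V.adjoint.le_of_opNorm_le (c := 1) (by rwa [LinearIsometryEquiv.norm_map]) u
  have hmax : ∀ u, (inner ℂ (A u) u).re ≤ ‖A‖ * ‖u‖ ^ 2 := fun u => by
    calc (inner ℂ (A u) u).re ≤ ‖A u‖ * ‖u‖ := re_inner_le_norm (𝕜 := ℂ) _ _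
      _ ≤ (‖A‖ * ‖u‖) * ‖u‖ := by gcongr; exact A.le_opNorm u
      _ = _ := by ring
  -- `V†` acts isometrically on the top eigenspace `E` of `A`, and maps it into itself
  have hisom : ∀ u ∈ E, ‖V.adjoint u‖ = ‖u‖ := fun u hu => by
    refine le_antisymm (hadj u) ?_
    have h1 := hmax (V.adjoint u)
    rw [hinv u, hquad u hu] at h1
    exact le_of_sq_le_sq (le_of_mul_le_mul_left h1 hAn) (norm_nonneg _)
  have hinvE : ∀ u ∈ E, V.adjoint u ∈ E := fun u hu => by
    rw [hEmem]
    -- equality in the Cauchy–Schwarz inequality `re ⟪A w, w⟫ ≤ ‖A‖ ‖w‖²` at `w = V† u`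
    set w := V.adjoint u with hw
    have h1 : (inner ℂ (A w) w).re = ‖A‖ * ‖w‖ ^ 2 := by
      rw [hw, hinv u, hquad u hu, hisom u hu]
    have h2 : ‖A w - (‖A‖ : ℂ) • w‖ ^ 2 ≤ 0 := by
      rw [@norm_sub_sq ℂ, inner_smul_right, norm_smul]
      simp only [RCLike.re_to_complex, Complex.re_ofReal_mul, Complex.norm_real, norm_norm, h1]
      have h3 := A.le_opNorm w
      nlinarith [norm_nonneg (A w), norm_nonneg w, norm_nonneg A]
    have h3 : ‖A w - (‖A‖ : ℂ) • w‖ = 0 := by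
      have := sq_nonneg ‖A w - (‖A‖ : ℂ) • w‖
      exact pow_eq_zero_iff (two_ne_zero) |>.1 (le_antisymm h2 this)
    exact sub_eq_zero.1 (norm_eq_zero.1 h3)
  obtain ⟨u, huE, hu0, z, hz, hzu⟩ := exists_unimodular_eigenvector hev V.adjoint hinvE hisom
  have hVu : V u = (starRingEnd ℂ) z • u := by
    have := ContinuousLinearMap.adjoint_apply_eq_of_apply_eq (V := V.adjoint)
      (by rwa [LinearIsometryEquiv.norm_map]) hz hzu
    rwa [ContinuousLinearMap.adjoint_adjoint] at this
  have hort := hf _ u (by rwa [RCLike.norm_conj]) hVu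
  -- the whole orbit of `f` is orthogonal to `u`, so that `⟪A u, u⟫ = 0`, although `u ∈ E`
  have hinner : ∀ n, inner ℂ u ((V ^ n) f) = 0 := by
    intro n
    induction n with
    | zero => simpa using hort
    | succ n ih =>
      rw [pow_succ' V n, mul_apply_eq_comp, ← ContinuousLinearMap.adjoint_inner_left, hzu,
        inner_smul_left, ih, mul_zero]
  have h1 : (inner ℂ (A u) u).re = 0 :=
    tendsto_nhds_unique (hAr u) (tendsto_const_nhds.congr fun N => by simp only [hr, hinner]; simp)
  rw [hquad u huE] at h1
  have : 0 < ‖A‖ * ‖u‖ ^ 2 := by have := norm_pos_iff.2 hu0; positivity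
  exact this.ne' h1

/-- Along a sequence of times, the orbit of a vector orthogonal to all eigenvectors with unimodular
eigenvalue is nearly orthogonal. -/
theorem exists_strictMono_inner_iterate_le {V : H →L[ℂ] H} (hV : ‖V‖ ≤ 1) {f : H}
    (hf : ∀ (z : ℂ) (u : H), ‖z‖ = 1 → V u = z • u → inner ℂ u f = 0) :
    ∃ n : ℕ → ℕ, StrictMono n ∧ ∀ i j, i < j →
      ‖inner ℂ ((V ^ n i) f) ((V ^ n j) f)‖ ≤ 1 / (j + 1) := by
  classical
  have key : ∀ N : ℕ, ∃ n, N < n ∧ ∀ m ∈ Finset.range (N + 1),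
      ‖inner ℂ ((V ^ m) f) ((V ^ n) f)‖ < 1 / (N + 1) := by
    intro N
    obtain ⟨n, hn, h⟩ := exists_inner_iterate_lt hV hf
      ((Finset.range (N + 1)).image fun m => (V ^ m) f) (η := 1 / (N + 1)) (by positivity) (N + 1)
    exact ⟨n, hn, fun m hm => h _ (Finset.mem_image_of_mem _ hm)⟩
  choose φ hφ1 hφ2 using key
  set n : ℕ → ℕ := fun j => φ^[j] 1 with hn
  have hsucc : ∀ j, n (j + 1) = φ (n j) := fun j => Function.iterate_succ_apply' φ j 1
  have hmono : StrictMono n := strictMono_nat_of_lt_succ fun j => by rw [hsucc]; exact hφ1 _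
  have hge : ∀ j, j + 1 ≤ n j := fun j => by
    induction j with
    | zero => simp [hn]
    | succ j ih => have := hφ1 (n j); rw [hsucc]; omega
  refine ⟨n, hmono, fun i j hij => ?_⟩
  obtain ⟨j, rfl⟩ : ∃ k, j = k + 1 := ⟨j - 1, by omega⟩
  have h1 : n i ≤ n j := hmono.monotone (by omega)
  have h2 := hφ2 (n j) (n i) (Finset.mem_range.2 (by omega))
  rw [hsucc]
  refine h2.le.trans ?_
  have h3 : ((j : ℝ) + 1) ≤ n j := by exact_mod_cast hge j
  push_cast
  gcongr

end Flight

/-! ### Bochner–Fejér kernels -/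

section Fejer

/-- The characters `n ↦ zⁿ`, `|z| = 1`, of `ℕ`. -/
def unimodularCharacters : Submonoid (ℕ → ℂ) where
  carrier := {a | ∃ z : ℂ, ‖z‖ = 1 ∧ a = fun n => z ^ n}
  mul_mem' := by
    rintro _ _ ⟨z, hz, rfl⟩ ⟨w, hw, rfl⟩
    exact ⟨z * w, by rw [norm_mul, hz, hw, one_mul], by ext n; simp [mul_pow]⟩
  one_mem' := ⟨1, by simp, by ext n; simp⟩

/-- The semiring of trigonometric polynomials on `ℕ` that are sums of characters, so that all their
coefficients are natural numbers. -/
def positiveTrigPolynomials : Subsemiring (ℕ → ℂ) := unimodularCharacters.subsemiringClosure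

theorem character_mem {z : ℂ} (hz : ‖z‖ = 1) : (fun n => z ^ n) ∈ positiveTrigPolynomials := by
  have h : (fun n => z ^ n) ∈ unimodularCharacters := ⟨z, hz, rfl⟩
  rw [positiveTrigPolynomials, Submonoid.subsemiringClosure_eq_closure]
  exact Subsemiring.subset_closure h

theorem positiveTrigPolynomials_induction {p : (ℕ → ℂ) → Prop}
    (hchar : ∀ z : ℂ, ‖z‖ = 1 → p (fun n => z ^ n)) (hzero : p 0)
    (hadd : ∀ a b, p a → p b → p (a + b)) {a : ℕ → ℂ} (ha : a ∈ positiveTrigPolynomials) : p a := by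
  rw [positiveTrigPolynomials, ← Subsemiring.mem_toAddSubmonoid,
    Submonoid.subsemiringClosure_toAddSubmonoid] at ha
  induction ha using AddSubmonoid.closure_induction with
  | mem x hx =>
    obtain ⟨z, hz, rfl⟩ := hx
    exact hchar z hz
  | zero => exact hzero
  | add x y _ _ hx hy => exact hadd x y hx hy

theorem star_mem_positiveTrigPolynomials {a : ℕ → ℂ} (ha : a ∈ positiveTrigPolynomials) :
    star a ∈ positiveTrigPolynomials := by
  refine positiveTrigPolynomials_induction (p := fun a => star a ∈ positiveTrigPolynomials)
    (fun z hz => ?_) ?_ (fun a b ha hb => ?_) ha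
  · have h : star (fun n => z ^ n) = fun n : ℕ => (star z) ^ n := by ext n; simp
    rw [h]
    exact character_mem (by rwa [norm_star])
  · simp
  · rw [star_add]; exact positiveTrigPolynomials.add_mem ha hb

/-- The span of the eigenvectors with unimodular eigenvalue. -/
def eigenSpan {H : Type*} [NormedAddCommGroup H] [InnerProductSpace ℂ H] (V : H →L[ℂ] H) :
    Submodule ℂ H :=
  Submodule.span ℂ {u | ∃ z : ℂ, ‖z‖ = 1 ∧ V u = z • u}

variable {H : Type*} [NormedAddCommGroup H] [InnerProductSpace ℂ H] [CompleteSpace H]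

/-- The mean ergodic theorem for the contraction `z V`. -/
theorem exists_eigenvector_tendsto_average {V : H →L[ℂ] H} (hV : ‖V‖ ≤ 1) (g : H) {z : ℂ}
    (hz : ‖z‖ = 1) : ∃ u ∈ eigenSpan V, Tendsto (fun N : ℕ => (N : ℂ)⁻¹ •
      ∑ n ∈ Finset.range N, z ^ n • (V ^ n) g) atTop (𝓝 u) := by
  have hf : ‖z • V‖ ≤ 1 := by rw [norm_smul, hz, one_mul]; exact hV
  have h := (z • V).tendsto_birkhoffAverage_orthogonalProjection hf g
  set u := ((z • V).eqLocus (1 : H →L[ℂ] H)).orthogonalProjectionOnto g with hu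
  have hfix : z • V (u : H) = u := u.2
  have hit : ∀ n, (z • V)^[n] g = z ^ n • (V ^ n) g := fun n => by
    have h1 : (z • V)^[n] g = ((z • V) ^ n) g := by simp
    rw [h1, smul_pow]; rfl
  have h' : Tendsto (fun N : ℕ => (N : ℂ)⁻¹ •
      ∑ n ∈ Finset.range N, z ^ n • (V ^ n) g) atTop (𝓝 (u : H)) := by
    refine h.congr fun N => ?_
    simp only [birkhoffAverage, birkhoffSum, hit, id]
  have hzz : (starRingEnd ℂ) z * z = 1 := by
    rw [← Complex.normSq_eq_conj_mul_self, Complex.normSq_eq_norm_sq, hz]; simp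
  refine ⟨u, Submodule.subset_span ⟨(starRingEnd ℂ) z, by rwa [RCLike.norm_conj], ?_⟩, h'⟩
  conv_rhs => rw [← hfix]
  rw [smul_smul, hzz, one_smul]

theorem exists_tendsto_average_smul_iterate {V : H →L[ℂ] H} (hV : ‖V‖ ≤ 1) (g : H) {a : ℕ → ℂ}
    (ha : a ∈ positiveTrigPolynomials) : ∃ w ∈ eigenSpan V,
      Tendsto (fun N : ℕ => (N : ℂ)⁻¹ • ∑ n ∈ Finset.range N, a n • (V ^ n) g) atTop (𝓝 w) := by
  refine positiveTrigPolynomials_induction (p := fun a => ∃ w ∈ eigenSpan V,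
    Tendsto (fun N : ℕ => (N : ℂ)⁻¹ • ∑ n ∈ Finset.range N, a n • (V ^ n) g) atTop (𝓝 w))
    (fun z hz => ?_) ?_ ?_ ha
  · exact exists_eigenvector_tendsto_average hV g hz
  · exact ⟨0, Submodule.zero_mem _, by simp⟩
  · rintro a b ⟨u, hu, h⟩ ⟨v, hv, h'⟩
    refine ⟨u + v, Submodule.add_mem _ hu hv, (h.add h').congr fun N => ?_⟩
    simp only [Pi.add_apply, add_smul, Finset.sum_add_distrib, smul_add]

/-- The sequence `a` has mean value `m`. -/
def HasMean (a : ℕ → ℂ) (m : ℝ) : Prop :=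
  Tendsto (fun N : ℕ => (N : ℂ)⁻¹ * ∑ n ∈ Finset.range N, a n) atTop (𝓝 (m : ℂ))

theorem HasMean.add {a b : ℕ → ℂ} {m m' : ℝ} (h : HasMean a m) (h' : HasMean b m') :
    HasMean (a + b) (m + m') := by
  rw [HasMean, Complex.ofReal_add]
  refine (Tendsto.add h h').congr fun N => ?_
  simp only [Pi.add_apply, Finset.sum_add_distrib, mul_add]

theorem HasMean.const_mul {a : ℕ → ℂ} {m : ℝ} (h : HasMean a m) (c : ℝ) :
    HasMean (fun n => c * a n) (c * m) := by
  rw [HasMean, Complex.ofReal_mul]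
  refine (Tendsto.const_mul (c : ℂ) h).congr fun N => ?_
  simp only [Finset.mul_sum]
  exact Finset.sum_congr rfl fun n _ => by ring

theorem HasMean.tendsto_real {Φ : ℕ → ℝ} {m : ℝ} (h : HasMean (fun n => (Φ n : ℂ)) m) :
    Tendsto (fun N : ℕ => (N : ℝ)⁻¹ * ∑ n ∈ Finset.range N, Φ n) atTop (𝓝 m) := by
  have := (Complex.continuous_re.tendsto _).comp h
  rw [Complex.ofReal_re] at this
  refine this.congr fun N => ?_
  simp only [Function.comp_apply]
  rw [← Complex.ofReal_sum, ← Complex.ofReal_natCast, ← Complex.ofReal_inv,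
    Complex.re_ofReal_mul, Complex.ofReal_re]

theorem HasMean.le {a b : ℕ → ℝ} {m m' : ℝ} (h : HasMean (fun n => (a n : ℂ)) m)
    (h' : HasMean (fun n => (b n : ℂ)) m') (hab : ∀ n, a n ≤ b n) : m ≤ m' := by
  refine le_of_tendsto_of_tendsto' h.tendsto_real h'.tendsto_real fun N => ?_
  gcongr with n
  exact hab n

theorem HasMean.unique {a : ℕ → ℂ} {m m' : ℝ} (h : HasMean a m) (h' : HasMean a m') : m = m' := by
  exact_mod_cast tendsto_nhds_unique h h'

theorem hasMean_one : HasMean 1 1 := by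
  refine tendsto_const_nhds.congr' ?_
  filter_upwards [eventually_gt_atTop 0] with N hN
  have : (N : ℂ) ≠ 0 := by exact_mod_cast hN.ne'
  simp [this]

/-- The mean of a character is `1` or `0`, so a sum of characters has a non-negative mean. -/
theorem exists_hasMean {a : ℕ → ℂ} (ha : a ∈ positiveTrigPolynomials) :
    ∃ m : ℝ, 0 ≤ m ∧ HasMean a m := by
  refine positiveTrigPolynomials_induction (p := fun a => ∃ m : ℝ, 0 ≤ m ∧ HasMean a m)
    (fun z hz => ?_) ?_ ?_ ha
  · rcases eq_or_ne z 1 with rfl | hz1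
    · refine ⟨1, zero_le_one, ?_⟩
      convert hasMean_one
      simp
    · refine ⟨0, le_rfl, ?_⟩
      have h0 : (0 : ℂ) = ((0 : ℝ) : ℂ) := by simp
      rw [HasMean, ← h0]
      have h1 : 0 < ‖z - 1‖ := norm_pos_iff.2 (sub_ne_zero.2 hz1)
      have h2 : Tendsto (fun N : ℕ => (N : ℝ)⁻¹ * (2 / ‖z - 1‖)) atTop (𝓝 0) := by
        have := (tendsto_inv_atTop_nhds_zero_nat (𝕜 := ℝ)).mul_const (2 / ‖z - 1‖)
        rwa [zero_mul] at this
      refine squeeze_zero_norm (fun N => ?_) h2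
      rw [norm_mul, norm_inv, RCLike.norm_natCast, geom_sum_eq hz1, norm_div]
      gcongr
      refine (norm_sub_le _ _).trans ?_
      rw [norm_pow, hz]
      norm_num
  · exact ⟨0, le_rfl, by simp [HasMean]⟩
  · rintro a b ⟨m, hm, h⟩ ⟨m', hm', h'⟩
    exact ⟨m + m', add_nonneg hm hm', h.add h'⟩

theorem ofReal_norm_sq_eq_mul_star (P : ℕ → ℂ) :
    (fun n => ((‖P n‖ ^ 2 : ℝ) : ℂ)) = P * star P := by
  ext n
  simp only [Pi.mul_apply, Pi.star_apply, RCLike.star_def, Complex.mul_conj,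
    Complex.normSq_eq_norm_sq]

theorem norm_sq_mem_positiveTrigPolynomials {P : ℕ → ℂ} (hP : P ∈ positiveTrigPolynomials) :
    (fun n => ((‖P n‖ ^ 2 : ℝ) : ℂ)) ∈ positiveTrigPolynomials := by
  rw [ofReal_norm_sq_eq_mul_star]
  exact positiveTrigPolynomials.mul_mem hP (star_mem_positiveTrigPolynomials hP)

/-- The geometric sum `n ↦ ∑_{k<M} z^{kn}`. -/
def geomKernel (M : ℕ) (z : ℂ) : ℕ → ℂ := fun n => ∑ k ∈ Finset.range M, (z ^ n) ^ k

theorem geomKernel_eq_sum (M : ℕ) (z : ℂ) :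
    geomKernel M z = ∑ k ∈ Finset.range M, fun n => (z ^ k) ^ n := by
  ext n
  simp only [geomKernel, Finset.sum_apply]
  exact Finset.sum_congr rfl fun k _ => by rw [← pow_mul, ← pow_mul, mul_comm]

theorem geomKernel_mem (M : ℕ) {z : ℂ} (hz : ‖z‖ = 1) : geomKernel M z ∈ positiveTrigPolynomials := by
  rw [geomKernel_eq_sum]
  exact sum_mem fun k _ => character_mem (by rw [norm_pow, hz, one_pow])

/-- Since all coefficients are non-negative, multiplying by a geometric sum of `M` terms increases
the mean square at least by the factor `M`. -/
theorem mul_mean_le_mean_geomKernel_mul (M : ℕ) {z : ℂ} (hz : ‖z‖ = 1) {R : ℕ → ℂ}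
    (hR : R ∈ positiveTrigPolynomials) {m m' : ℝ} (hm : HasMean (fun n => ((‖R n‖ ^ 2 : ℝ) : ℂ)) m)
    (hm' : HasMean (fun n => ((‖(geomKernel M z * R) n‖ ^ 2 : ℝ) : ℂ)) m') : M * m ≤ m' := by
  classical
  set χ : ℕ → ℕ → ℂ := fun k n => (z ^ k) ^ n with hχ
  have hχmem : ∀ k, χ k ∈ positiveTrigPolynomials := fun k =>
    character_mem (by rw [norm_pow, hz, one_pow])
  have hχ1 : ∀ k, χ k * star (χ k) = 1 := fun k => by
    rw [← ofReal_norm_sq_eq_mul_star]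
    ext n
    simp [hχ, hz]
  -- the off-diagonal terms of `|∑_k χ_k|²` contribute non-negatively to the mean
  set D : ℕ → ℂ := ∑ j ∈ Finset.range M, ∑ k ∈ (Finset.range M).erase j, χ j * star (χ k) with hD
  have hDmem : D * (R * star R) ∈ positiveTrigPolynomials := by
    refine positiveTrigPolynomials.mul_mem (sum_mem fun j _ => sum_mem fun k _ =>
      positiveTrigPolynomials.mul_mem (hχmem j) (star_mem_positiveTrigPolynomials (hχmem k)))
      (positiveTrigPolynomials.mul_mem hR (star_mem_positiveTrigPolynomials hR))
  obtain ⟨d, hd0, hd⟩ := exists_hasMean hDmem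
  have hsplit : (fun n => ((‖(geomKernel M z * R) n‖ ^ 2 : ℝ) : ℂ))
      = (fun n => ((M : ℝ) : ℂ) * ((‖R n‖ ^ 2 : ℝ) : ℂ)) + D * (R * star R) := by
    have h1 : geomKernel M z * star (geomKernel M z) = (M : ℕ → ℂ) + D := by
      rw [geomKernel_eq_sum, star_sum, Finset.sum_mul_sum]
      have h2 : ∀ j ∈ Finset.range M, ∑ k ∈ Finset.range M, χ j * star (χ k)
          = 1 + ∑ k ∈ (Finset.range M).erase j, χ j * star (χ k) := fun j hj => by
        rw [← Finset.add_sum_erase _ _ hj, hχ1]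
      rw [Finset.sum_congr rfl h2, Finset.sum_add_distrib]
      simp [hD]
    have h3 : (fun n => ((M : ℝ) : ℂ) * ((‖R n‖ ^ 2 : ℝ) : ℂ)) = (M : ℕ → ℂ) * (R * star R) := by
      rw [← ofReal_norm_sq_eq_mul_star]
      ext n
      simp
    rw [ofReal_norm_sq_eq_mul_star, star_mul, h3, ← add_mul, ← h1]
    ring
  rw [hsplit] at hm'
  have := hm'.unique ((hm.const_mul M).add hd)
  linarith

theorem norm_one_sub_mul_geomKernel_le (M : ℕ) {z : ℂ} (hz : ‖z‖ = 1) (n : ℕ) :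
    ‖(1 - z ^ n) * geomKernel M z n‖ ≤ 2 := by
  rw [geomKernel, mul_neg_geom_sum]
  refine (norm_sub_le _ _).trans ?_
  rw [norm_pow, norm_pow, hz]
  norm_num

/-- A Bochner–Fejér kernel: a non-negative trigonometric polynomial of mean one whose coefficients at
given finitely many frequencies are close to one. -/
theorem exists_fejer_kernel (F : Finset ℂ) (hF : ∀ z ∈ F, ‖z‖ = 1) {δ : ℝ} (hδ : 0 < δ) :
    ∃ (Φ : ℕ → ℝ) (a : ℕ → ℂ) (c : ℝ), a ∈ positiveTrigPolynomials ∧ (∀ n, (Φ n : ℂ) = c * a n) ∧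
      (∀ n, 0 ≤ Φ n) ∧ HasMean (fun n => (Φ n : ℂ)) 1 ∧
      ∀ z ∈ F, ∃ m : ℝ, |1 - m| ≤ δ ∧ HasMean (fun n => Φ n * z ^ n) m := by
  classical
  obtain ⟨M, hM⟩ := exists_nat_gt (max 1 (2 / δ))
  have hM1 : (1 : ℝ) < M := (le_max_left _ _).trans_lt hM
  have hM2 : 2 / δ < M := (le_max_right _ _).trans_lt hM
  have hM0 : (0 : ℝ) < M := zero_lt_one.trans hM1
  -- the kernel is `|P|²`, normalized, where `P` is the product over `F` of geometric sums of length `M`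
  have hprod : ∀ G ⊆ F, ∏ z ∈ G, geomKernel M z ∈ positiveTrigPolynomials := fun G hG =>
    prod_mem fun z hz => geomKernel_mem M (hF z (hG hz))
  have hone : ∀ G ⊆ F, ∀ m, HasMean (fun n => ((‖(∏ z ∈ G, geomKernel M z) n‖ ^ 2 : ℝ) : ℂ)) m →
      1 ≤ m := by
    intro G
    induction G using Finset.induction_on with
    | empty =>
      intro _ m hm
      have : HasMean 1 m := by convert hm; simp
      exact (hasMean_one.unique this).le
    | insert z G hz ih =>
      intro hG m hm
      have hG' : G ⊆ F := (Finset.subset_insert z G).trans hG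
      obtain ⟨m', -, hm'⟩ := exists_hasMean (norm_sq_mem_positiveTrigPolynomials (hprod G hG'))
      rw [Finset.prod_insert hz] at hm
      have h1 := mul_mean_le_mean_geomKernel_mul M (hF z (hG (Finset.mem_insert_self z G)))
        (hprod G hG') hm' hm
      have h2 := ih hG' m' hm'
      nlinarith
  set P : ℕ → ℂ := ∏ z ∈ F, geomKernel M z with hP
  have hPmem := hprod F subset_rfl
  have hP2 := norm_sq_mem_positiveTrigPolynomials hPmem
  obtain ⟨m₀, -, hm₀⟩ := exists_hasMean hP2
  have hm1 : 1 ≤ m₀ := hone F subset_rfl m₀ hm₀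
  have hmpos : 0 < m₀ := zero_lt_one.trans_le hm1
  refine ⟨fun n => m₀⁻¹ * ‖P n‖ ^ 2, fun n => ((‖P n‖ ^ 2 : ℝ) : ℂ), m₀⁻¹, hP2,
    fun n => by push_cast; rfl, fun n => by positivity, ?_, fun z hz => ?_⟩
  · have := hm₀.const_mul m₀⁻¹
    rw [inv_mul_cancel₀ hmpos.ne'] at this
    convert this using 2 with n
    push_cast
    rfl
  have hz1 := hF z hz
  set R : ℕ → ℂ := ∏ z ∈ F.erase z, geomKernel M z with hR
  have hPR : P = geomKernel M z * R := (Finset.mul_prod_erase F (geomKernel M) hz).symm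
  have hRmem := hprod _ (Finset.erase_subset z F)
  obtain ⟨r, hr0, hr⟩ := exists_hasMean (norm_sq_mem_positiveTrigPolynomials hRmem)
  have hrm : M * r ≤ m₀ :=
    mul_mean_le_mean_geomKernel_mul M hz1 hRmem hr (by rw [← hPR]; exact hm₀)
  obtain ⟨m, hm0, hm⟩ := exists_hasMean (positiveTrigPolynomials.mul_mem hP2 (character_mem hz1))
  have hmstar : HasMean (star ((fun n => ((‖P n‖ ^ 2 : ℝ) : ℂ)) * fun n => z ^ n)) m := by
    have := (Complex.continuous_conj.tendsto _).comp hm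
    rw [Complex.conj_ofReal] at this
    refine this.congr fun N => ?_
    simp [hP]
  -- `|1 - zⁿ|² |P|²` has mean `2 (m₀ - m)`; it is at most `4 |R|²`, and the mean of `|R|²` is at most
  -- `m₀ / M`
  have hdiff : HasMean (fun n => ((‖(1 - z ^ n) * P n‖ ^ 2 : ℝ) : ℂ)) (2 * m₀ + (-1) * (m + m)) := by
    convert (hm₀.const_mul 2).add ((hm.add hmstar).const_mul (-1)) using 1
    ext n
    have hzn : z ^ n * (starRingEnd ℂ) z ^ n = 1 := by
      rw [← map_pow, Complex.mul_conj, Complex.normSq_eq_norm_sq, norm_pow, hz1]; simp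
    have h1 : ((‖(1 - z ^ n) * P n‖ ^ 2 : ℝ) : ℂ)
        = (1 - z ^ n) * (1 - (starRingEnd ℂ) z ^ n) * ((‖P n‖ ^ 2 : ℝ) : ℂ) := by
      rw [norm_mul, mul_pow, Complex.ofReal_mul, ← Complex.normSq_eq_norm_sq (1 - z ^ n),
        ← Complex.mul_conj]
      simp
    rw [h1]
    simp only [Pi.add_apply, Pi.mul_apply, Pi.star_apply, star_mul', RCLike.star_def,
      Complex.conj_ofReal, map_pow]
    push_cast
    linear_combination ((‖P n‖ : ℂ) ^ 2) * hzn
  have hle : 2 * m₀ + (-1) * (m + m) ≤ 4 * r := by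
    refine hdiff.le (b := fun n => 4 * ‖R n‖ ^ 2) ?_ fun n => ?_
    · convert hr.const_mul 4 using 2 with n
      push_cast
      rfl
    · have h1 := norm_one_sub_mul_geomKernel_le M hz1 n
      have h2 : (1 - z ^ n) * P n = ((1 - z ^ n) * geomKernel M z n) * R n := by
        rw [hPR, Pi.mul_apply, mul_assoc]
      rw [h2, norm_mul, mul_pow]
      have h3 : ‖(1 - z ^ n) * geomKernel M z n‖ ^ 2 ≤ 2 ^ 2 := by gcongr
      nlinarith [sq_nonneg ‖R n‖]
  have hge : 0 ≤ 2 * m₀ + (-1) * (m + m) := by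
    have h0 : HasMean (fun _ => ((0 : ℝ) : ℂ)) 0 := by simp [HasMean]
    exact h0.le hdiff fun n => by positivity
  refine ⟨m₀⁻¹ * m, ?_, ?_⟩
  · have h1 : 1 - m₀⁻¹ * m = m₀⁻¹ * (m₀ - m) := by field_simp
    have h2 : 0 ≤ m₀ - m := by linarith
    rw [h1, abs_of_nonneg (by positivity), inv_mul_le_iff₀ hmpos]
    have h3 : 2 < M * δ := (div_lt_iff₀ hδ).1 hM2
    have h4 : M * (m₀ - m) ≤ M * (m₀ * δ) := by
      calc M * (m₀ - m) ≤ M * (2 * r) := by gcongr; linarith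
        _ ≤ 2 * m₀ := by linarith
        _ ≤ (M * δ) * m₀ := by gcongr
        _ = _ := by ring
    exact le_of_mul_le_mul_left h4 hM0
  · convert hm.const_mul m₀⁻¹ using 2 with n
    simp only [Pi.mul_apply]
    push_cast
    ring

end Fejer

/-! ### Approximation of the projection to the unimodular eigenvectors -/

section FejerApproximation

variable {H : Type*} [NormedAddCommGroup H] [InnerProductSpace ℂ H]

/-- The weighted ergodic average `(1/N) ∑_{n<N} Φₙ Vⁿ g`. -/
noncomputable def kernelAverage (V : H →L[ℂ] H) (Φ : ℕ → ℝ) (N : ℕ) (g : H) : H :=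
  (N : ℂ)⁻¹ • ∑ n ∈ Finset.range N, (Φ n : ℂ) • (V ^ n) g

theorem kernelAverage_add (V : H →L[ℂ] H) (Φ : ℕ → ℝ) (N : ℕ) (g h : H) :
    kernelAverage V Φ N (g + h) = kernelAverage V Φ N g + kernelAverage V Φ N h := by
  simp only [kernelAverage, map_add, smul_add, Finset.sum_add_distrib]

theorem kernelAverage_smul (V : H →L[ℂ] H) (Φ : ℕ → ℝ) (N : ℕ) (c : ℂ) (g : H) :
    kernelAverage V Φ N (c • g) = c • kernelAverage V Φ N g := by
  simp only [kernelAverage, map_smul]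
  rw [smul_comm c, Finset.smul_sum (r := c)]
  congr 1
  exact Finset.sum_congr rfl fun n _ => smul_comm (Φ n : ℂ) c ((V ^ n) g)

theorem norm_kernelAverage_le {V : H →L[ℂ] H} (hV : ‖V‖ ≤ 1) {Φ : ℕ → ℝ} (hΦ : ∀ n, 0 ≤ Φ n)
    (N : ℕ) (g : H) :
    ‖kernelAverage V Φ N g‖ ≤ ((N : ℝ)⁻¹ * ∑ n ∈ Finset.range N, Φ n) * ‖g‖ := by
  rw [kernelAverage, norm_smul, norm_inv, RCLike.norm_natCast, mul_assoc, Finset.sum_mul]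
  gcongr
  refine norm_sum_le_of_le _ fun n _ => ?_
  rw [norm_smul, Complex.norm_real, Real.norm_of_nonneg (hΦ n)]
  gcongr
  · exact hΦ n
  · exact norm_pow_apply_le hV n g

/-- Averages with respect to a kernel whose coefficients are close to one at suitable frequencies
nearly fix a given sum of eigenvectors. -/
theorem exists_frequencies_of_mem_eigenSpan {V : H →L[ℂ] H} {v : H} (hv : v ∈ eigenSpan V) :
    ∃ (F : Finset ℂ) (C : ℝ), (∀ z ∈ F, ‖z‖ = 1) ∧ 0 ≤ C ∧ ∀ (Φ : ℕ → ℝ) (δ : ℝ), 0 ≤ δ →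
      (∀ z ∈ F, ∃ m : ℝ, |1 - m| ≤ δ ∧ HasMean (fun n => Φ n * z ^ n) m) →
      ∃ w, Tendsto (fun N => kernelAverage V Φ N v) atTop (𝓝 w) ∧ ‖w - v‖ ≤ C * δ := by
  classical
  induction hv using Submodule.span_induction with
  | mem u hu =>
    obtain ⟨z, hz, hzu⟩ := hu
    refine ⟨{z}, ‖u‖, by simpa using hz, norm_nonneg _, fun Φ δ _ h => ?_⟩
    obtain ⟨m, hm, hmean⟩ := h z (Finset.mem_singleton_self z)
    refine ⟨(m : ℂ) • u, (hmean.smul_const u).congr fun N => ?_, ?_⟩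
    · rw [kernelAverage, mul_smul, Finset.sum_smul]
      congr 1
      refine Finset.sum_congr rfl fun n _ => ?_
      rw [pow_apply_eq_of_apply_eq hzu, mul_smul]
    · have : (m : ℂ) • u - u = (((m - 1 : ℝ)) : ℂ) • u := by
        push_cast; rw [sub_smul, one_smul]
      rw [this, norm_smul, Complex.norm_real, Real.norm_eq_abs, abs_sub_comm, mul_comm]
      gcongr
  | zero =>
    refine ⟨∅, 0, by simp, le_rfl, fun Φ δ _ _ => ⟨0, ?_, by simp⟩⟩
    simp [kernelAverage]
  | add x y _ _ hx hy =>
    obtain ⟨F, C, hF, hC, h⟩ := hx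
    obtain ⟨F', C', hF', hC', h'⟩ := hy
    refine ⟨F ∪ F', C + C', fun z hz => (Finset.mem_union.1 hz).elim (hF z) (hF' z),
      add_nonneg hC hC', fun Φ δ hδ hΦ => ?_⟩
    obtain ⟨w, hw, hwn⟩ := h Φ δ hδ fun z hz => hΦ z (Finset.mem_union_left _ hz)
    obtain ⟨w', hw', hwn'⟩ := h' Φ δ hδ fun z hz => hΦ z (Finset.mem_union_right _ hz)
    refine ⟨w + w', (hw.add hw').congr fun N => (kernelAverage_add V Φ N x y).symm, ?_⟩
    rw [add_sub_add_comm, add_mul]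
    exact (norm_add_le _ _).trans (add_le_add hwn hwn')
  | smul c x _ hx =>
    obtain ⟨F, C, hF, hC, h⟩ := hx
    refine ⟨F, ‖c‖ * C, hF, by positivity, fun Φ δ hδ hΦ => ?_⟩
    obtain ⟨w, hw, hwn⟩ := h Φ δ hδ hΦ
    refine ⟨c • w, (hw.const_smul c).congr fun N => (kernelAverage_smul V Φ N c x).symm, ?_⟩
    rw [← smul_sub, norm_smul, mul_assoc]
    gcongr

variable [CompleteSpace H]

/-- The orthogonal projection onto the closed span of the unimodular eigenvectors. -/
noncomputable def eigenProjection (V : H →L[ℂ] H) : H →L[ℂ] H :=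
  (eigenSpan V).topologicalClosure.starProjection

theorem inner_sub_eigenProjection (V : H →L[ℂ] H) (g : H) {z : ℂ} {u : H} (hz : ‖z‖ = 1)
    (hu : V u = z • u) : inner ℂ u (g - eigenProjection V g) = 0 := by
  have h : g - eigenProjection V g ∈ (eigenSpan V).topologicalClosureᗮ :=
    Submodule.sub_starProjection_mem_orthogonal g
  exact h u (Submodule.le_topologicalClosure _ (Submodule.subset_span ⟨z, hz, hu⟩))

/-- The projection of `g` to the closed span of the unimodular eigenvectors is a limit of
Bochner–Fejér means of the orbit of `g`; these are averages with non-negative weights, and they are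
finite sums of eigenvectors. -/
theorem exists_kernelAverage_near_eigenProjection {V : H →L[ℂ] H} (hV : ‖V‖ ≤ 1) (g : H) {δ : ℝ}
    (hδ : 0 < δ) : ∃ (Φ : ℕ → ℝ) (w : H), (∀ n, 0 ≤ Φ n) ∧
      Tendsto (fun N : ℕ => (N : ℝ)⁻¹ * ∑ n ∈ Finset.range N, Φ n) atTop (𝓝 1) ∧
      w ∈ eigenSpan V ∧
      Tendsto (fun N => kernelAverage V Φ N g) atTop (𝓝 w) ∧ ‖w - eigenProjection V g‖ < δ := by
  set Q := eigenProjection V g with hQ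
  have hQmem : Q ∈ (eigenSpan V).topologicalClosure := Submodule.starProjection_apply_mem _ _
  have hQcl : Q ∈ closure (eigenSpan V : Set H) := hQmem
  obtain ⟨v, hv, hvd⟩ := Metric.mem_closure_iff.1 hQcl (δ / 4) (by positivity)
  rw [dist_eq_norm] at hvd
  obtain ⟨F, C, hF, hC, hFC⟩ := exists_frequencies_of_mem_eigenSpan hv
  set δ' : ℝ := δ / 4 / (C + 1) with hδ'
  have hδ'0 : 0 < δ' := by positivity
  obtain ⟨Φ, a, c, ha, hac, hΦ0, hΦ1, hΦF⟩ := exists_fejer_kernel F hF hδ'0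
  have hlim : ∀ x, ∃ w ∈ eigenSpan V,
      Tendsto (fun N => kernelAverage V Φ N x) atTop (𝓝 w) := by
    intro x
    obtain ⟨w, hw, h⟩ := exists_tendsto_average_smul_iterate hV x ha
    refine ⟨(c : ℂ) • w, Submodule.smul_mem _ _ hw, (h.const_smul (c : ℂ)).congr fun N => ?_⟩
    rw [kernelAverage, smul_comm (c : ℂ), Finset.smul_sum]
    congr 1
    exact Finset.sum_congr rfl fun n _ => by rw [hac, mul_smul]
  obtain ⟨w, hw, hwl⟩ := hlim g
  obtain ⟨w', hw'l, hw'n⟩ := hFC Φ δ' hδ'0.le hΦF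
  -- `g = v + (Q - v) + (g - Q)`: the averages nearly fix `v`, and shrink the small vector `Q - v`
  obtain ⟨ws, hws, hwsl⟩ := hlim (g - Q)
  -- the averages of `g - Q` converge to `0`: their limit is a sum of eigenvectors and is orthogonal
  -- to all eigenvectors
  have hws0 : ws = 0 := by
    have hort : ws ∈ (eigenSpan V)ᗮ := by
      have hmem : ∀ N, kernelAverage V Φ N (g - Q) ∈ (eigenSpan V)ᗮ := fun N => by
        refine Submodule.smul_mem _ _ (sum_mem fun n _ => Submodule.smul_mem _ _ ?_)
        rw [Submodule.mem_orthogonal]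
        intro u hu
        induction hu using Submodule.span_induction with
        | mem u hu =>
          obtain ⟨z, hz, hzu⟩ := hu
          have h1 := V.adjoint_apply_eq_of_apply_eq hV hz hzu
          have h2 : ∀ n, inner ℂ u ((V ^ n) (g - Q)) = 0 := fun n => by
            induction n with
            | zero => simpa using inner_sub_eigenProjection V g hz hzu
            | succ n ih =>
              rw [pow_succ' V n, mul_apply_eq_comp, ← ContinuousLinearMap.adjoint_inner_left, h1,
                inner_smul_left, ih, mul_zero]
          exact h2 n
        | zero => simp
        | add x y _ _ hx hy => rw [inner_add_left, hx, hy, add_zero]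
        | smul c x _ hx => rw [inner_smul_left, hx, mul_zero]
      exact (Submodule.isClosed_orthogonal (eigenSpan V)).mem_of_tendsto hwsl
        (Eventually.of_forall hmem)
    have h2 := (Submodule.mem_orthogonal _ _).1 hort ws hws
    exact inner_self_eq_zero.1 h2
  refine ⟨Φ, w, hΦ0, hΦ1.tendsto_real, hw, hwl, ?_⟩
  have h1 : Tendsto (fun N => kernelAverage V Φ N (Q - v)) atTop (𝓝 (w - w')) := by
    have h2 := (hwl.sub hw'l).sub hwsl
    rw [hws0, sub_zero] at h2
    refine h2.congr fun N => ?_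
    have h3 : kernelAverage V Φ N g = kernelAverage V Φ N v + kernelAverage V Φ N (Q - v)
        + kernelAverage V Φ N (g - Q) := by
      rw [← kernelAverage_add, ← kernelAverage_add]
      congr 1
      abel
    rw [h3]
    abel
  have h4 : ‖w - w'‖ ≤ 1 * ‖Q - v‖ :=
    le_of_tendsto_of_tendsto' h1.norm (hΦ1.tendsto_real.mul_const _) fun N =>
      norm_kernelAverage_le hV hΦ0 N _
  have h5 : C * δ' ≤ δ / 4 := by
    rw [hδ', mul_div_assoc', div_le_iff₀ (by positivity)]
    nlinarith
  have h6 : w - Q = (w - w') + (w' - v) + (v - Q) := by abel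
  rw [h6]
  have h7 : ‖v - Q‖ < δ / 4 := by rwa [norm_sub_rev]
  linarith [norm_add₃_le (a := w - w') (b := w' - v) (c := v - Q)]

end FejerApproximation

/-! ### Positive Dunford–Schwartz operators -/

section SumSpace

variable {X : Type*} [MeasurableSpace X] {μ : Measure X}

/-- A class of functions dominated by an integrable function plus a constant is in `L_1 + L_∞`. -/
theorem mem_L1AddLinf_of_norm_le {g : X →ₘ[μ] ℂ} {a : X → ℝ} (ha : Integrable a μ) {M : ℝ}
    (hM : 0 ≤ M) (h : ∀ᵐ x ∂μ, ‖g x‖ ≤ a x + M) : g ∈ L1AddLinf μ := by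
  have hmeas : MeasurableSet {x | 2 * M < ‖g x‖} :=
    measurableSet_lt measurable_const g.stronglyMeasurable.norm.measurable
  have h1 : MemLp ({x | 2 * M < ‖g x‖}.indicator g) 1 μ := by
    have h2 : MemLp (fun x => 2 * a x) 1 μ := memLp_one_iff_integrable.2 (ha.const_mul 2)
    refine h2.mono (g.stronglyMeasurable.indicator hmeas).aestronglyMeasurable ?_
    filter_upwards [h] with x hx
    by_cases hxm : x ∈ {x | 2 * M < ‖g x‖}
    · rw [Set.indicator_of_mem hxm]
      have : 2 * M < ‖g x‖ := hxm
      exact le_trans (by linarith) (le_abs_self (2 * a x))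
    · rw [Set.indicator_of_notMem hxm, norm_zero]
      positivity
  have h2 : MemLp ({x | 2 * M < ‖g x‖}ᶜ.indicator g) ∞ μ := by
    refine memLp_top_of_bound (g.stronglyMeasurable.indicator hmeas.compl).aestronglyMeasurable
      (2 * M) (ae_of_all _ fun x => ?_)
    by_cases hx : x ∈ {x | 2 * M < ‖g x‖}ᶜ
    · rw [Set.indicator_of_mem hx]
      exact not_lt.1 hx
    · rw [Set.indicator_of_notMem hx, norm_zero]
      positivity
  have hsum : g = (h1.toLp _ : X →ₘ[μ] ℂ) + (h2.toLp _ : X →ₘ[μ] ℂ) := by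
    refine AEEqFun.ext ?_
    filter_upwards [AEEqFun.coeFn_add (h1.toLp _ : X →ₘ[μ] ℂ) (h2.toLp _ : X →ₘ[μ] ℂ),
      h1.coeFn_toLp, h2.coeFn_toLp] with x h3 h4 h5
    rw [h3, Pi.add_apply, h4, h5, Set.indicator_self_add_compl_apply]
  rw [hsum]
  exact Submodule.add_mem_sup (h1.toLp _).2 (h2.toLp _).2

theorem exists_norm_le_of_mem_L1AddLinf {f : X →ₘ[μ] ℂ} (hf : f ∈ L1AddLinf μ) :
    ∃ (a : X → ℝ) (M : ℝ), Integrable a μ ∧ (∀ x, 0 ≤ a x) ∧ 0 ≤ M ∧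
      ∀ᵐ x ∂μ, ‖f x‖ ≤ a x + M := by
  obtain ⟨u, hu, v, hv, rfl⟩ := Submodule.mem_sup.1 hf
  have hu' : MemLp u 1 μ := Lp.mem_Lp_iff_memLp.1 hu
  have hv' : MemLp v ∞ μ := Lp.mem_Lp_iff_memLp.1 hv
  refine ⟨fun x => ‖u x‖, (eLpNorm v ∞ μ).toReal, (memLp_one_iff_integrable.1 hu').norm,
    fun x => norm_nonneg _, ENNReal.toReal_nonneg, ?_⟩
  filter_upwards [AEEqFun.coeFn_add u v, ae_le_eLpNormEssSup (f := v) (μ := μ)] with x hx hvx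
  rw [hx, Pi.add_apply]
  refine (norm_add_le _ _).trans ?_
  gcongr
  rw [← toReal_enorm]
  refine ENNReal.toReal_mono hv'.2.ne ?_
  rw [eLpNorm_exponent_top]
  exact hvx

theorem mem_L1AddLinf_of_norm_le_norm {f g : X →ₘ[μ] ℂ} (hf : f ∈ L1AddLinf μ)
    (h : ∀ᵐ x ∂μ, ‖g x‖ ≤ ‖f x‖) : g ∈ L1AddLinf μ := by
  obtain ⟨a, M, ha, -, hM, hfa⟩ := exists_norm_le_of_mem_L1AddLinf hf
  exact mem_L1AddLinf_of_norm_le ha hM (by filter_upwards [h, hfa] with x h1 h2 using h1.trans h2)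

/-- The class of a function in `L_1 + L_∞`. -/
noncomputable def L1AddLinf.mk (u : X → ℂ) (hu : AEStronglyMeasurable u μ)
    (h : AEEqFun.mk u hu ∈ L1AddLinf μ) : L1AddLinf μ := ⟨AEEqFun.mk u hu, h⟩

theorem L1AddLinf.coeFn_mk (u : X → ℂ) (hu : AEStronglyMeasurable u μ)
    (h : AEEqFun.mk u hu ∈ L1AddLinf μ) : (L1AddLinf.mk u hu h : X →ₘ[μ] ℂ) =ᵐ[μ] u :=
  AEEqFun.coeFn_mk u hu

theorem L1AddLinf.coeFn_add (f g : L1AddLinf μ) :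
    ((f + g : L1AddLinf μ) : X →ₘ[μ] ℂ) =ᵐ[μ] fun x => (f : X →ₘ[μ] ℂ) x + (g : X →ₘ[μ] ℂ) x :=
  AEEqFun.coeFn_add _ _

theorem L1AddLinf.coeFn_sub (f g : L1AddLinf μ) :
    ((f - g : L1AddLinf μ) : X →ₘ[μ] ℂ) =ᵐ[μ] fun x => (f : X →ₘ[μ] ℂ) x - (g : X →ₘ[μ] ℂ) x :=
  AEEqFun.coeFn_sub _ _

theorem L1AddLinf.coeFn_smul (c : ℂ) (f : L1AddLinf μ) :
    ((c • f : L1AddLinf μ) : X →ₘ[μ] ℂ) =ᵐ[μ] fun x => c * (f : X →ₘ[μ] ℂ) x :=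
  AEEqFun.coeFn_smul _ _

theorem L1AddLinf.map_sub (T : Module.End ℂ (L1AddLinf μ)) (f g : L1AddLinf μ) :
    T (f - g) = T f - T g :=
  _root_.map_sub T f g

/-- Any function dominated by an element of `L_1 + L_∞` is in `L_1 + L_∞`. -/
theorem exists_L1AddLinf_ae_eq (f : L1AddLinf μ) {u : X → ℂ} (hu : AEStronglyMeasurable u μ)
    (h : ∀ᵐ x ∂μ, ‖u x‖ ≤ ‖(f : X →ₘ[μ] ℂ) x‖) :
    ∃ g : L1AddLinf μ, (g : X →ₘ[μ] ℂ) =ᵐ[μ] u := by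
  refine ⟨L1AddLinf.mk u hu (mem_L1AddLinf_of_norm_le_norm f.2 ?_), L1AddLinf.coeFn_mk _ _ _⟩
  filter_upwards [AEEqFun.coeFn_mk u hu, h] with x h1 h2
  rwa [h1]

theorem exists_L1AddLinf_ae_eq_of_bound {u : X → ℂ} (hu : AEStronglyMeasurable u μ) (M : ℝ)
    (hM : 0 ≤ M) (h : ∀ x, ‖u x‖ ≤ M) :
    ∃ g : L1AddLinf μ, (g : X →ₘ[μ] ℂ) =ᵐ[μ] u := by
  refine ⟨L1AddLinf.mk u hu (mem_L1AddLinf_of_norm_le (integrable_zero X ℝ μ) hM ?_),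
    L1AddLinf.coeFn_mk _ _ _⟩
  filter_upwards [AEEqFun.coeFn_mk u hu] with x h1
  rw [h1]
  simpa using h x

theorem exists_L1AddLinf_ae_eq_of_integrable {u : X → ℂ} (hu : Integrable u μ) :
    ∃ g : L1AddLinf μ, (g : X →ₘ[μ] ℂ) =ᵐ[μ] u := by
  refine ⟨L1AddLinf.mk u hu.1 (mem_L1AddLinf_of_norm_le hu.norm le_rfl ?_),
    L1AddLinf.coeFn_mk _ _ _⟩
  filter_upwards [AEEqFun.coeFn_mk u hu.1] with x h1
  rw [h1, add_zero]

end SumSpace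

namespace IsPositiveDunfordSchwartz

variable {X : Type*} [MeasurableSpace X] {μ : Measure X} {T : Module.End ℂ (L1AddLinf μ)}

theorem pow (hT : IsPositiveDunfordSchwartz T) (n : ℕ) : IsPositiveDunfordSchwartz (T ^ n) := by
  induction n with
  | zero => exact ⟨fun f => le_rfl, fun f => le_rfl, fun f h => h⟩
  | succ n ih =>
    rw [pow_succ']
    exact ⟨fun f => (hT.norm_one_le _).trans (ih.norm_one_le f),
      fun f => (hT.norm_top_le _).trans (ih.norm_top_le f), fun f h => hT.nonneg _ (ih.nonneg f h)⟩

open scoped ComplexOrder in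
theorem re_nonneg (hT : IsPositiveDunfordSchwartz T) {f : L1AddLinf μ}
    (hf : ∀ᵐ x ∂μ, 0 ≤ ((f : X →ₘ[μ] ℂ) x).re) : ∀ᵐ x ∂μ, 0 ≤ ((T f : X →ₘ[μ] ℂ) x).re := by
  have hfm : AEStronglyMeasurable (f : X →ₘ[μ] ℂ) μ := (f : X →ₘ[μ] ℂ).aestronglyMeasurable
  obtain ⟨r, hr⟩ := exists_L1AddLinf_ae_eq f
    (u := fun x => ((((f : X →ₘ[μ] ℂ) x).re : ℝ) : ℂ))
    (Complex.continuous_ofReal.comp_aestronglyMeasurable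
      (Complex.continuous_re.comp_aestronglyMeasurable hfm))
    (ae_of_all _ fun x => by
      rw [Complex.norm_real]; exact Complex.abs_re_le_norm _)
  obtain ⟨s, hs⟩ := exists_L1AddLinf_ae_eq f
    (u := fun x => ((((f : X →ₘ[μ] ℂ) x).im : ℝ) : ℂ))
    (Complex.continuous_ofReal.comp_aestronglyMeasurable
      (Complex.continuous_im.comp_aestronglyMeasurable hfm))
    (ae_of_all _ fun x => by
      rw [Complex.norm_real]; exact Complex.abs_im_le_norm _)
  obtain ⟨t, ht⟩ := exists_L1AddLinf_ae_eq f
    (u := fun x => ((|((f : X →ₘ[μ] ℂ) x).im| : ℝ) : ℂ))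
    (Complex.continuous_ofReal.comp_aestronglyMeasurable
      (continuous_abs.comp_aestronglyMeasurable
        (Complex.continuous_im.comp_aestronglyMeasurable hfm)))
    (ae_of_all _ fun x => by
      rw [Complex.norm_real, Real.norm_eq_abs, abs_abs]; exact Complex.abs_im_le_norm _)
  have hdec : f = r + Complex.I • s := by
    refine Subtype.ext (AEEqFun.ext ?_)
    filter_upwards [L1AddLinf.coeFn_add r (Complex.I • s), L1AddLinf.coeFn_smul Complex.I s, hr, hs]
      with x h1 h2 h3 h4
    rw [h1, h2, h3, h4, mul_comm, Complex.re_add_im]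
  have hTf : T f = T r + Complex.I • T s := by
    conv_lhs => rw [hdec]
    rw [map_add, map_smul]
  -- `T s` is real, because `s` is the difference of the non-negative `t = |s|` and `t - s`
  have hTs : T s = T t - T (t - s) := by rw [L1AddLinf.map_sub]; exact (sub_sub_cancel (T t) (T s)).symm
  have hr0 := hT.nonneg r (by
    filter_upwards [hr, hf] with x h1 h2
    rw [h1]
    exact Complex.zero_le_real.2 h2)
  have ht0 := hT.nonneg t (by
    filter_upwards [ht] with x h1
    rw [h1]
    exact Complex.zero_le_real.2 (abs_nonneg _))
  have hts0 := hT.nonneg (t - s) (by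
    filter_upwards [ht, hs, L1AddLinf.coeFn_sub t s] with x h1 h2 h3
    rw [h3, h1, h2, ← Complex.ofReal_sub]
    exact Complex.zero_le_real.2 (sub_nonneg.2 (le_abs_self _)))
  rw [hTf]
  filter_upwards [L1AddLinf.coeFn_add (T r) (Complex.I • T s), L1AddLinf.coeFn_smul Complex.I (T s),
    hr0, ht0, hts0, L1AddLinf.coeFn_sub (T t) (T (t - s))] with x h1 h2 h3 h4 h5 h6
  rw [← hTs] at h6
  rw [h1, h2, h6]
  have e3 := (Complex.nonneg_iff.1 h3).1
  have e4 := (Complex.nonneg_iff.1 h4).2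
  have e5 := (Complex.nonneg_iff.1 h5).2
  simp only [Complex.add_re, Complex.mul_re, Complex.I_re, Complex.I_im, Complex.sub_im, ← e4, ← e5]
  simpa using e3

/-- `|T f| ≤ T g` if `|f| ≤ g`, since `re (c T f) ≤ |c| T g` for all `c` in a countable dense set. -/
theorem norm_le_re (hT : IsPositiveDunfordSchwartz T) {f g : L1AddLinf μ}
    (hfg : ∀ᵐ x ∂μ, ‖(f : X →ₘ[μ] ℂ) x‖ ≤ ((g : X →ₘ[μ] ℂ) x).re) :
    ∀ᵐ x ∂μ, ‖(T f : X →ₘ[μ] ℂ) x‖ ≤ ((T g : X →ₘ[μ] ℂ) x).re := by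
  have hc : ∀ c : ℂ, ∀ᵐ x ∂μ,
      (c * (T f : X →ₘ[μ] ℂ) x).re ≤ ‖c‖ * ((T g : X →ₘ[μ] ℂ) x).re := by
    intro c
    have h1 := hT.re_nonneg (f := (‖c‖ : ℂ) • g - c • f) (by
      filter_upwards [hfg, L1AddLinf.coeFn_sub ((‖c‖ : ℂ) • g) (c • f),
        L1AddLinf.coeFn_smul (‖c‖ : ℂ) g, L1AddLinf.coeFn_smul c f] with x h1 h2 h3 h4
      rw [h2, h3, h4, Complex.sub_re, Complex.re_ofReal_mul, sub_nonneg]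
      refine (Complex.re_le_norm _).trans ?_
      rw [norm_mul]
      gcongr)
    rw [L1AddLinf.map_sub, map_smul, map_smul] at h1
    filter_upwards [h1, L1AddLinf.coeFn_sub ((‖c‖ : ℂ) • T g) (c • T f),
        L1AddLinf.coeFn_smul (‖c‖ : ℂ) (T g), L1AddLinf.coeFn_smul c (T f)] with x h1 h2 h3 h4
    rwa [h2, h3, h4, Complex.sub_re, Complex.re_ofReal_mul, sub_nonneg] at h1
  have hall : ∀ᵐ x ∂μ, ∀ n : ℕ, (TopologicalSpace.denseSeq ℂ n * (T f : X →ₘ[μ] ℂ) x).re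
      ≤ ‖TopologicalSpace.denseSeq ℂ n‖ * ((T g : X →ₘ[μ] ℂ) x).re :=
    ae_all_iff.2 fun n => hc _
  filter_upwards [hall] with x hx
  have hx' : ∀ c : ℂ, (c * (T f : X →ₘ[μ] ℂ) x).re ≤ ‖c‖ * ((T g : X →ₘ[μ] ℂ) x).re := by
    have hcl : IsClosed {c : ℂ | (c * (T f : X →ₘ[μ] ℂ) x).re
        ≤ ‖c‖ * ((T g : X →ₘ[μ] ℂ) x).re} :=
      isClosed_le (by fun_prop) (by fun_prop)
    intro c
    have := (TopologicalSpace.denseRange_denseSeq ℂ).closure_eq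
    exact hcl.closure_subset_iff.2 (Set.range_subset_iff.2 hx) (this ▸ Set.mem_univ c)
  rcases eq_or_ne ((T f : X →ₘ[μ] ℂ) x) 0 with h0 | h0
  · have := hx' 1
    rw [h0] at this ⊢
    simpa using this
  · have h1 := hx' ((starRingEnd ℂ) ((T f : X →ₘ[μ] ℂ) x))
    rw [← Complex.normSq_eq_conj_mul_self, Complex.ofReal_re, Complex.normSq_eq_norm_sq,
      RCLike.norm_conj, sq] at h1
    exact le_of_mul_le_mul_left h1 (norm_pos_iff.2 h0)

theorem norm_le_of_norm_le (hT : IsPositiveDunfordSchwartz T) {f : L1AddLinf μ} {M : ℝ}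
    (hM : 0 ≤ M) (h : ∀ᵐ x ∂μ, ‖(f : X →ₘ[μ] ℂ) x‖ ≤ M) :
    ∀ᵐ x ∂μ, ‖(T f : X →ₘ[μ] ℂ) x‖ ≤ M := by
  have h1 : eLpNorm (T f : X →ₘ[μ] ℂ) ∞ μ ≤ ENNReal.ofReal M := by
    refine (hT.norm_top_le f).trans ?_
    rw [eLpNorm_exponent_top]
    exact eLpNormEssSup_le_of_ae_bound h
  filter_upwards [ae_le_eLpNormEssSup (f := (T f : X →ₘ[μ] ℂ)) (μ := μ)] with x hx
  rw [eLpNorm_exponent_top] at h1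
  have h2 := hx.trans h1
  rw [← ofReal_norm, ENNReal.ofReal_le_ofReal_iff hM] at h2
  exact h2

/-- Jensen's inequality `|T f|² ≤ T |f|²`, from `0 ≤ T |f - c|²` for all constants `c`. -/
theorem norm_sq_le_re (hT : IsPositiveDunfordSchwartz T) {f g : L1AddLinf μ}
    (hfg : ∀ᵐ x ∂μ, ‖(f : X →ₘ[μ] ℂ) x‖ ^ 2 ≤ ((g : X →ₘ[μ] ℂ) x).re) :
    ∀ᵐ x ∂μ, ‖(T f : X →ₘ[μ] ℂ) x‖ ^ 2 ≤ ((T g : X →ₘ[μ] ℂ) x).re := by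
  obtain ⟨e, he⟩ := exists_L1AddLinf_ae_eq_of_bound (μ := μ) (u := fun _ => (1 : ℂ))
    aestronglyMeasurable_const 1 zero_le_one (by simp)
  have hTe := hT.norm_le_of_norm_le (f := e) (M := 1) zero_le_one (by
    filter_upwards [he] with x hx; rw [hx]; simp)
  have hc : ∀ c : ℂ, ∀ᵐ x ∂μ, 2 * ((starRingEnd ℂ) c * (T f : X →ₘ[μ] ℂ) x).re
      ≤ ((T g : X →ₘ[μ] ℂ) x).re + ‖c‖ ^ 2 := by
    intro c
    have h1 := hT.re_nonneg (f := (g + ((‖c‖ ^ 2 : ℝ) : ℂ) • e) - (2 * (starRingEnd ℂ) c) • f) (by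
      filter_upwards [hfg, he,
        L1AddLinf.coeFn_sub (g + ((‖c‖ ^ 2 : ℝ) : ℂ) • e) ((2 * (starRingEnd ℂ) c) • f),
        L1AddLinf.coeFn_add g (((‖c‖ ^ 2 : ℝ) : ℂ) • e),
        L1AddLinf.coeFn_smul (((‖c‖ ^ 2 : ℝ) : ℂ)) e,
        L1AddLinf.coeFn_smul (2 * (starRingEnd ℂ) c) f] with x h1 h2 h3 h4 h5 h6
      rw [h3, h4, h5, h6, h2, Complex.sub_re, Complex.add_re, mul_one, Complex.ofReal_re]
      have h7 : (2 * (starRingEnd ℂ) c * (f : X →ₘ[μ] ℂ) x).re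
          ≤ 2 * (‖c‖ * ‖(f : X →ₘ[μ] ℂ) x‖) := by
        refine (Complex.re_le_norm _).trans (le_of_eq ?_)
        rw [norm_mul, norm_mul, RCLike.norm_conj, mul_assoc]
        norm_num
      nlinarith [sq_nonneg (‖c‖ - ‖(f : X →ₘ[μ] ℂ) x‖)])
    rw [L1AddLinf.map_sub, map_add, map_smul, map_smul] at h1
    filter_upwards [h1, hTe,
        L1AddLinf.coeFn_sub (T g + ((‖c‖ ^ 2 : ℝ) : ℂ) • T e) ((2 * (starRingEnd ℂ) c) • T f),
        L1AddLinf.coeFn_add (T g) (((‖c‖ ^ 2 : ℝ) : ℂ) • T e),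
        L1AddLinf.coeFn_smul (((‖c‖ ^ 2 : ℝ) : ℂ)) (T e),
        L1AddLinf.coeFn_smul (2 * (starRingEnd ℂ) c) (T f)] with x h1 h2 h3 h4 h5 h6
    rw [h3, h4, h5, h6, Complex.sub_re, Complex.add_re, Complex.re_ofReal_mul, mul_assoc] at h1
    have h7 : (2 * ((starRingEnd ℂ) c * (T f : X →ₘ[μ] ℂ) x)).re
        = 2 * ((starRingEnd ℂ) c * (T f : X →ₘ[μ] ℂ) x).re := by
      simp
    rw [h7] at h1
    have h8 : ‖c‖ ^ 2 * ((T e : X →ₘ[μ] ℂ) x).re ≤ ‖c‖ ^ 2 * 1 := by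
      gcongr
      exact (Complex.re_le_norm _).trans h2
    linarith
  have hall : ∀ᵐ x ∂μ, ∀ n : ℕ,
      2 * ((starRingEnd ℂ) (TopologicalSpace.denseSeq ℂ n) * (T f : X →ₘ[μ] ℂ) x).re
      ≤ ((T g : X →ₘ[μ] ℂ) x).re + ‖TopologicalSpace.denseSeq ℂ n‖ ^ 2 :=
    ae_all_iff.2 fun n => hc _
  filter_upwards [hall] with x hx
  have hx' : ∀ c : ℂ, 2 * ((starRingEnd ℂ) c * (T f : X →ₘ[μ] ℂ) x).re
      ≤ ((T g : X →ₘ[μ] ℂ) x).re + ‖c‖ ^ 2 := by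
    have hcl : IsClosed {c : ℂ | 2 * ((starRingEnd ℂ) c * (T f : X →ₘ[μ] ℂ) x).re
        ≤ ((T g : X →ₘ[μ] ℂ) x).re + ‖c‖ ^ 2} :=
      isClosed_le (continuous_const.mul (Complex.continuous_re.comp
        (Complex.continuous_conj.mul continuous_const))) (by fun_prop)
    intro c
    have := (TopologicalSpace.denseRange_denseSeq ℂ).closure_eq
    exact hcl.closure_subset_iff.2 (Set.range_subset_iff.2 hx) (this ▸ Set.mem_univ c)
  have h1 := hx' ((T f : X →ₘ[μ] ℂ) x)
  rw [← Complex.normSq_eq_conj_mul_self, Complex.ofReal_re, Complex.normSq_eq_norm_sq] at h1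
  linarith

theorem eLpNorm_two_le (hT : IsPositiveDunfordSchwartz T) {f : L1AddLinf μ}
    (hf : MemLp (f : X →ₘ[μ] ℂ) 2 μ) :
    eLpNorm (T f : X →ₘ[μ] ℂ) 2 μ ≤ eLpNorm (f : X →ₘ[μ] ℂ) 2 μ := by
  have hint : Integrable (fun x => ((‖(f : X →ₘ[μ] ℂ) x‖ ^ 2 : ℝ) : ℂ)) μ :=
    (hf.integrable_norm_pow (by norm_num)).ofReal
  obtain ⟨g, hg⟩ := exists_L1AddLinf_ae_eq_of_integrable hint
  have h1 := hT.norm_sq_le_re (f := f) (g := g) (by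
    filter_upwards [hg] with x hx
    rw [hx, Complex.ofReal_re])
  have h2 := hT.norm_one_le g
  rw [eLpNorm_one_eq_lintegral_enorm, eLpNorm_one_eq_lintegral_enorm] at h2
  have h3 : ∫⁻ x, ‖(g : X →ₘ[μ] ℂ) x‖ₑ ∂μ = ∫⁻ x, ‖(f : X →ₘ[μ] ℂ) x‖ₑ ^ (2 : ℝ) ∂μ := by
    refine lintegral_congr_ae ?_
    filter_upwards [hg] with x hx
    rw [hx, ← ofReal_norm, Complex.norm_real, Real.norm_of_nonneg (by positivity), ← ofReal_norm,
      ENNReal.ofReal_pow (norm_nonneg _)]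
    norm_cast
  have h4 : ∫⁻ x, ‖(T f : X →ₘ[μ] ℂ) x‖ₑ ^ (2 : ℝ) ∂μ ≤ ∫⁻ x, ‖(T g : X →ₘ[μ] ℂ) x‖ₑ ∂μ := by
    refine lintegral_mono_ae ?_
    filter_upwards [h1] with x hx
    have : ‖(T f : X →ₘ[μ] ℂ) x‖ₑ ^ (2 : ℝ)
        = ENNReal.ofReal (‖(T f : X →ₘ[μ] ℂ) x‖ ^ 2) := by
      rw [← ofReal_norm, ENNReal.ofReal_pow (norm_nonneg _)]
      norm_cast
    rw [this, ← ofReal_norm]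
    exact ENNReal.ofReal_le_ofReal (hx.trans (Complex.re_le_norm _))
  rw [eLpNorm_eq_lintegral_rpow_enorm_toReal (by norm_num) (by norm_num),
    eLpNorm_eq_lintegral_rpow_enorm_toReal (by norm_num) (by norm_num)]
  simp only [ENNReal.toReal_ofNat]
  exact ENNReal.rpow_le_rpow (h4.trans (h2.trans h3.le)) (by norm_num)

/-- The restriction of a Dunford–Schwartz operator to `L_2`. -/
noncomputable def toL2 (hT : IsPositiveDunfordSchwartz T) : Lp ℂ 2 μ →L[ℂ] Lp ℂ 2 μ :=
  LinearMap.mkContinuous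
    { toFun := fun f => ⟨T (lpInclusion μ 2 f), Lp.mem_Lp_iff_eLpNorm_lt_top.2
        ((hT.eLpNorm_two_le (Lp.memLp f)).trans_lt (Lp.eLpNorm_lt_top f))⟩
      map_add' := fun f g => by
        have h := congrArg (fun u : L1AddLinf μ => (u : X →ₘ[μ] ℂ))
          (map_add (T ∘ₗ lpInclusion μ 2) f g)
        exact Subtype.ext h
      map_smul' := fun c f => by
        have h := congrArg (fun u : L1AddLinf μ => (u : X →ₘ[μ] ℂ))
          (map_smul (T ∘ₗ lpInclusion μ 2) c f)
        exact Subtype.ext h } 1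
    (fun f => by
      rw [one_mul, Lp.norm_def, Lp.norm_def]
      exact ENNReal.toReal_mono (Lp.eLpNorm_ne_top f) (hT.eLpNorm_two_le (Lp.memLp f)))

theorem norm_toL2_le (hT : IsPositiveDunfordSchwartz T) : ‖hT.toL2‖ ≤ 1 :=
  LinearMap.mkContinuous_norm_le _ zero_le_one _

theorem lpInclusion_toL2 (hT : IsPositiveDunfordSchwartz T) (f : Lp ℂ 2 μ) :
    lpInclusion μ 2 (hT.toL2 f) = T (lpInclusion μ 2 f) := rfl

theorem lpInclusion_toL2_pow (hT : IsPositiveDunfordSchwartz T) (n : ℕ) (f : Lp ℂ 2 μ) :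
    lpInclusion μ 2 ((hT.toL2 ^ n) f) = (T ^ n) (lpInclusion μ 2 f) := by
  induction n with
  | zero => rfl
  | succ n ih =>
    rw [pow_succ' hT.toL2 n, pow_succ' T n, mul_apply_eq_comp, lpInclusion_toL2, ih]
    rfl

end IsPositiveDunfordSchwartz

/-! ### The maximal ergodic inequality -/

namespace IsPositiveDunfordSchwartz

variable {X : Type*} [MeasurableSpace X] {μ : Measure X} {T : Module.End ℂ (L1AddLinf μ)}

theorem integrable_apply (hT : IsPositiveDunfordSchwartz T) {f : L1AddLinf μ}
    (hf : Integrable (f : X →ₘ[μ] ℂ) μ) : Integrable (T f : X →ₘ[μ] ℂ) μ := by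
  rw [← memLp_one_iff_integrable] at hf ⊢
  exact ⟨(T f : X →ₘ[μ] ℂ).aestronglyMeasurable, (hT.norm_one_le f).trans_lt hf.2⟩

theorem integral_norm_apply_le (hT : IsPositiveDunfordSchwartz T) {f : L1AddLinf μ}
    (hf : Integrable (f : X →ₘ[μ] ℂ) μ) :
    ∫ x, ‖(T f : X →ₘ[μ] ℂ) x‖ ∂μ ≤ ∫ x, ‖(f : X →ₘ[μ] ℂ) x‖ ∂μ := by
  rw [integral_norm_eq_lintegral_enorm (T f : X →ₘ[μ] ℂ).aestronglyMeasurable,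
    integral_norm_eq_lintegral_enorm (f : X →ₘ[μ] ℂ).aestronglyMeasurable,
    ← eLpNorm_one_eq_lintegral_enorm, ← eLpNorm_one_eq_lintegral_enorm]
  exact ENNReal.toReal_mono (memLp_one_iff_integrable.2 hf).2.ne (hT.norm_one_le f)

end IsPositiveDunfordSchwartz

section Maximal

variable {X : Type*} [MeasurableSpace X] {μ : Measure X}

/-- The real part of `∑_{k<n} T^k f`. -/
noncomputable def reOrbitSum (T : Module.End ℂ (L1AddLinf μ)) (f : L1AddLinf μ) (n : ℕ) (x : X) :
    ℝ :=
  ∑ k ∈ Finset.range n, (((T ^ k) f : L1AddLinf μ) : X →ₘ[μ] ℂ) x |>.re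

theorem measurable_reOrbitSum (T : Module.End ℂ (L1AddLinf μ)) (f : L1AddLinf μ) (n : ℕ) :
    Measurable (reOrbitSum T f n) :=
  Complex.measurable_re.comp (Finset.measurable_fun_sum _ fun _ _ =>
    (AEEqFun.stronglyMeasurable _).measurable)

theorem coeFn_sum_ae (s : Finset ℕ) (F : ℕ → L1AddLinf μ) :
    ((∑ k ∈ s, F k : L1AddLinf μ) : X →ₘ[μ] ℂ) =ᵐ[μ]
      fun x => ∑ k ∈ s, (F k : X →ₘ[μ] ℂ) x := by
  classical
  induction s using Finset.induction_on with
  | empty => simpa using! (AEEqFun.coeFn_zero (μ := μ) (α := X) (β := ℂ))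
  | insert a s ha ih =>
    rw [Finset.sum_insert ha]
    filter_upwards [ih, L1AddLinf.coeFn_add (F a) (∑ k ∈ s, F k)] with x h1 h2
    rw [h2, h1, Finset.sum_insert ha]

variable {T : Module.End ℂ (L1AddLinf μ)}

theorem integrable_reOrbitSum (hT : IsPositiveDunfordSchwartz T) {f : L1AddLinf μ}
    (hf : Integrable (f : X →ₘ[μ] ℂ) μ) (n : ℕ) : Integrable (reOrbitSum T f n) μ :=
  (integrable_finsetSum _ fun k _ => (hT.pow k).integrable_apply hf).re

theorem integrable_partialSups {F : ℕ → X → ℝ} (hF : ∀ n, Integrable (F n) μ) (N : ℕ) :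
    Integrable (partialSups F N) μ := by
  induction N with
  | zero => simpa using hF 0
  | succ N ih => rw [partialSups_add_one]; exact ih.sup (hF _)

theorem measurable_partialSups {F : ℕ → X → ℝ} (hF : ∀ n, Measurable (F n)) (N : ℕ) :
    Measurable (partialSups F N) := by
  induction N with
  | zero => simpa using hF 0
  | succ N ih => rw [partialSups_add_one]; exact ih.sup (hF _)

/-- **Hopf's maximal ergodic lemma**, by Garsia's argument: the maximum `M` of the partial sums
`0, f, f + T f, …` satisfies `M ≤ f + T M` where it is positive. -/
theorem setIntegral_nonneg_of_reOrbitSum_pos (hT : IsPositiveDunfordSchwartz T) {f : L1AddLinf μ}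
    (hf : Integrable (f : X →ₘ[μ] ℂ) μ) (N : ℕ) :
    0 ≤ ∫ x in {x | ∃ n ≤ N, 0 < reOrbitSum T f n x}, ((f : X →ₘ[μ] ℂ) x).re ∂μ := by
  set M : X → ℝ := partialSups (reOrbitSum T f) N with hM
  have hMapply : ∀ x, M x = partialSups (fun n => reOrbitSum T f n x) N := fun x =>
    Pi.partialSups_apply _ _ _
  have hS0 : ∀ x, reOrbitSum T f 0 x = 0 := fun x => by simp [reOrbitSum]
  have hM0 : ∀ x, 0 ≤ M x := fun x => by
    rw [hMapply, ← hS0 x]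
    exact le_partialSups_of_le (fun n => reOrbitSum T f n x) (Nat.zero_le N)
  have hMint : Integrable M μ := integrable_partialSups (integrable_reOrbitSum hT hf) N
  obtain ⟨m, hm⟩ := exists_L1AddLinf_ae_eq_of_integrable (hMint.ofReal (𝕜 := ℂ))
  have hmint : Integrable (m : X →ₘ[μ] ℂ) μ := (hMint.ofReal (𝕜 := ℂ)).congr hm.symm
  have hTm0 := hT.re_nonneg (f := m) (by
    filter_upwards [hm] with x hx
    rw [hx]
    simpa using hM0 x)
  have hTm : ∀ᵐ x ∂μ, ∀ n ≤ N, reOrbitSum T f (n + 1) x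
      ≤ ((f : X →ₘ[μ] ℂ) x).re + ((T m : X →ₘ[μ] ℂ) x).re := by
    rw [ae_all_iff]
    intro n
    by_cases hn : n ≤ N
    swap
    · exact ae_of_all _ fun x h => absurd h hn
    have h1 := hT.re_nonneg (f := m - ∑ k ∈ Finset.range n, (T ^ k) f) (by
      filter_upwards [hm, L1AddLinf.coeFn_sub m (∑ k ∈ Finset.range n, (T ^ k) f),
        coeFn_sum_ae (Finset.range n) fun k => (T ^ k) f] with x h1 h2 h3
      rw [h2, h1, h3, Complex.sub_re, sub_nonneg]
      change reOrbitSum T f n x ≤ M x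
      rw [hMapply]
      exact le_partialSups_of_le (fun n => reOrbitSum T f n x) hn)
    rw [L1AddLinf.map_sub, map_sum] at h1
    filter_upwards [h1, L1AddLinf.coeFn_sub (T m) (∑ k ∈ Finset.range n, T ((T ^ k) f)),
      coeFn_sum_ae (Finset.range n) fun k => T ((T ^ k) f)] with x h1 h2 h3 _
    rw [h2, h3, Complex.sub_re, sub_nonneg] at h1
    rw [reOrbitSum, Finset.sum_range_succ', Complex.add_re, add_comm]
    have h4 : ∀ k, (T ^ (k + 1)) f = T ((T ^ k) f) := fun k => by rw [pow_succ']; rfl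
    simp only [h4]
    exact add_le_add le_rfl h1
  set D : Set X := {x | ∃ n ≤ N, 0 < reOrbitSum T f n x} with hD
  have hDeq : D = {x | 0 < M x} := by
    ext x
    simp only [hD, Set.mem_ofPred_eq, hMapply]
    constructor
    · rintro ⟨n, hn, h⟩
      exact h.trans_le (le_partialSups_of_le (fun n => reOrbitSum T f n x) hn)
    · intro h
      by_contra hcon
      push Not at hcon
      exact absurd (partialSups_le (fun n => reOrbitSum T f n x) N 0 hcon) (not_le.2 h)
  have hMmeas : Measurable M :=
    measurable_partialSups (fun n => measurable_reOrbitSum T f n) N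
  have hDm : MeasurableSet D := by
    rw [hDeq]; exact measurableSet_lt measurable_const hMmeas
  -- where `M` is positive it is one of the sums `f + T (f + ⋯ + T^(n-1) f)`
  have hMD : ∀ᵐ x ∂μ, x ∈ D → M x ≤ ((f : X →ₘ[μ] ℂ) x).re + ((T m : X →ₘ[μ] ℂ) x).re := by
    filter_upwards [hTm, hTm0] with x hx hx0 hxD
    have hxM : 0 < M x := by rw [hDeq] at hxD; exact hxD
    by_contra hcon
    push Not at hcon
    have hlt : ∀ n ≤ N, reOrbitSum T f n x ≤ max 0 (((f : X →ₘ[μ] ℂ) x).re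
        + ((T m : X →ₘ[μ] ℂ) x).re) := by
      intro n hn
      rcases n with _ | n
      · rw [hS0]; exact le_max_left _ _
      · exact (hx n (by omega)).trans (le_max_right _ _)
    have h1 := partialSups_le (fun n => reOrbitSum T f n x) N _ hlt
    rw [← hMapply] at h1
    rcases le_max_iff.1 h1 with h2 | h2
    · linarith
    · linarith
  have hTmint := hT.integrable_apply hmint
  have hfre : Integrable (fun x => ((f : X →ₘ[μ] ℂ) x).re) μ := hf.re
  have hTmre : Integrable (fun x => ((T m : X →ₘ[μ] ℂ) x).re) μ := hTmint.re
  have h1 : ∫ x in D, M x ∂μ ≤ ∫ x in D, (((f : X →ₘ[μ] ℂ) x).re + ((T m : X →ₘ[μ] ℂ) x).re) ∂μ :=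
    setIntegral_mono_on_ae hMint.integrableOn (hfre.add hTmre).integrableOn hDm hMD
  rw [integral_add hfre.integrableOn hTmre.integrableOn] at h1
  have h2 : ∫ x in D, M x ∂μ = ∫ x, M x ∂μ := by
    refine setIntegral_eq_integral_of_forall_compl_eq_zero fun x hx => ?_
    rw [hDeq] at hx
    exact le_antisymm (not_lt.1 hx) (hM0 x)
  have h3 : ∫ x in D, ((T m : X →ₘ[μ] ℂ) x).re ∂μ ≤ ∫ x, ((T m : X →ₘ[μ] ℂ) x).re ∂μ :=
    setIntegral_le_integral hTmre hTm0
  have h4 : ∫ x, ((T m : X →ₘ[μ] ℂ) x).re ∂μ ≤ ∫ x, M x ∂μ := by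
    calc ∫ x, ((T m : X →ₘ[μ] ℂ) x).re ∂μ ≤ ∫ x, ‖(T m : X →ₘ[μ] ℂ) x‖ ∂μ :=
          integral_mono hTmre hTmint.norm fun x => Complex.re_le_norm _
      _ ≤ ∫ x, ‖(m : X →ₘ[μ] ℂ) x‖ ∂μ := hT.integral_norm_apply_le hmint
      _ = ∫ x, M x ∂μ := by
          refine integral_congr_ae ?_
          filter_upwards [hm] with x hx
          rw [hx]
          simpa using hM0 x
  linarith

/-- The weak type `(1, 1)` maximal inequality. The indicator of a set `E` of finite measure plays the
role of the constant `1`, which need not be integrable. -/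
theorem measure_reOrbitSum_gt_le [SigmaFinite μ] (hT : IsPositiveDunfordSchwartz T)
    {f : L1AddLinf μ} (hf : Integrable (f : X →ₘ[μ] ℂ) μ) {lam : ℝ} (hlam : 0 < lam) :
    μ {x | ∃ n : ℕ, n * lam < reOrbitSum T f n x}
      ≤ ENNReal.ofReal (lam⁻¹ * ∫ x, ‖(f : X →ₘ[μ] ℂ) x‖ ∂μ) := by
  set B : ℕ → Set X := fun N =>
    {x | ∃ n ≤ N, n * lam < reOrbitSum T f n x} ∩ spanningSets μ N with hB
  have hmono : Monotone B := fun N N' h => Set.inter_subset_inter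
    (fun x ⟨n, hn, hx⟩ => ⟨n, hn.trans h, hx⟩) (monotone_spanningSets μ h)
  have hunion : {x | ∃ n : ℕ, n * lam < reOrbitSum T f n x} = ⋃ N, B N := by
    ext x
    simp only [Set.mem_ofPred_eq, Set.mem_iUnion]
    constructor
    · rintro ⟨n, hn⟩
      obtain ⟨N, hN⟩ : ∃ N, x ∈ spanningSets μ N := by
        have : x ∈ ⋃ N, spanningSets μ N := by rw [iUnion_spanningSets]; trivial
        exact Set.mem_iUnion.1 this
      exact ⟨max n N, ⟨n, le_max_left _ _, hn⟩, monotone_spanningSets μ (le_max_right _ _) hN⟩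
    · rintro ⟨N, ⟨n, -, hn⟩, -⟩
      exact ⟨n, hn⟩
  rw [hunion, hmono.measure_iUnion]
  refine iSup_le fun N => ?_
  set E := B N with hE
  have hEm : MeasurableSet E := by
    refine MeasurableSet.inter ?_ (measurableSet_spanningSets μ N)
    have : {x | ∃ n ≤ N, n * lam < reOrbitSum T f n x}
        = ⋃ n ∈ Finset.range (N + 1), {x | n * lam < reOrbitSum T f n x} := by
      ext x
      simp
    rw [this]
    exact Finset.measurableSet_biUnion _ fun n _ =>
      measurableSet_lt measurable_const (measurable_reOrbitSum T f n)
  have hEfin : μ E < ∞ := (measure_mono Set.inter_subset_right).trans_lt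
    (measure_spanningSets_lt_top μ N)
  have hindint : Integrable (E.indicator fun _ => (1 : ℂ)) μ :=
    (integrable_indicator_iff hEm).2 (integrableOn_const hEfin.ne)
  obtain ⟨e, he⟩ := exists_L1AddLinf_ae_eq_of_integrable hindint
  have hTe : ∀ᵐ x ∂μ, ∀ k, ‖((T ^ k) e : X →ₘ[μ] ℂ) x‖ ≤ 1 := by
    rw [ae_all_iff]
    intro k
    refine (hT.pow k).norm_le_of_norm_le zero_le_one ?_
    filter_upwards [he] with x hx
    rw [hx]
    by_cases hxE : x ∈ E <;> simp [hxE]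
  -- the maximal lemma is applied to `h = f - lam 1_E`
  set h : L1AddLinf μ := f + ((-lam : ℝ) : ℂ) • e with hh
  have hcoe : ∀ᵐ x ∂μ, (h : X →ₘ[μ] ℂ) x
      = (f : X →ₘ[μ] ℂ) x + ((-lam : ℝ) : ℂ) * E.indicator (fun _ => (1 : ℂ)) x := by
    filter_upwards [L1AddLinf.coeFn_add f (((-lam : ℝ) : ℂ) • e),
      L1AddLinf.coeFn_smul ((-lam : ℝ) : ℂ) e, he] with x h1 h2 h3
    rw [h1, h2, h3]
  have hhint : Integrable (h : X →ₘ[μ] ℂ) μ :=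
    (hf.add (hindint.const_mul ((-lam : ℝ) : ℂ))).congr (by
      filter_upwards [hcoe] with x hx
      rw [hx]; rfl)
  have hsum : ∀ᵐ x ∂μ, ∀ n : ℕ, reOrbitSum T f n x - n * lam ≤ reOrbitSum T h n x := by
    have h1 : ∀ᵐ x ∂μ, ∀ k, ((T ^ k) h : X →ₘ[μ] ℂ) x
        = ((T ^ k) f : X →ₘ[μ] ℂ) x + ((-lam : ℝ) : ℂ) * ((T ^ k) e : X →ₘ[μ] ℂ) x := by
      rw [ae_all_iff]
      intro k
      rw [hh, map_add, map_smul]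
      filter_upwards [L1AddLinf.coeFn_add ((T ^ k) f) (((-lam : ℝ) : ℂ) • (T ^ k) e),
        L1AddLinf.coeFn_smul ((-lam : ℝ) : ℂ) ((T ^ k) e)] with x h1 h2
      rw [h1, h2]
    filter_upwards [h1, hTe] with x h1 h2 n
    simp only [reOrbitSum, h1, Complex.re_sum, Complex.add_re, Complex.re_ofReal_mul,
      Finset.sum_add_distrib]
    have h3 : ∑ k ∈ Finset.range n, lam * (((T ^ k) e : X →ₘ[μ] ℂ) x).re ≤ n * lam := by
      refine (Finset.sum_le_sum (g := fun _ => lam) fun k _ => ?_).trans (by simp)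
      exact mul_le_of_le_one_right hlam.le ((Complex.re_le_norm _).trans (h2 k))
    simp only [neg_mul, Finset.sum_neg_distrib]
    linarith
  set D : Set X := {x | ∃ n ≤ N, 0 < reOrbitSum T h n x} with hD
  have hDm : MeasurableSet D := by
    have : D = ⋃ n ∈ Finset.range (N + 1), {x | 0 < reOrbitSum T h n x} := by
      ext x
      simp [hD]
    rw [this]
    exact Finset.measurableSet_biUnion _ fun n _ =>
      measurableSet_lt measurable_const (measurable_reOrbitSum T h n)
  have hED : ∀ᵐ x ∂μ, x ∈ E → x ∈ D := by
    filter_upwards [hsum] with x hx hxE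
    obtain ⟨⟨n, hn, hlt⟩, -⟩ := hxE
    exact ⟨n, hn, by linarith [hx n]⟩
  have hmax := setIntegral_nonneg_of_reOrbitSum_pos hT hhint N
  rw [← hD] at hmax
  have hreh : ∫ x in D, ((h : X →ₘ[μ] ℂ) x).re ∂μ
      = ∫ x in D, (((f : X →ₘ[μ] ℂ) x).re + (-lam) * E.indicator (fun _ => (1 : ℝ)) x) ∂μ := by
    refine integral_congr_ae (ae_restrict_of_ae ?_)
    filter_upwards [hcoe] with x hx
    rw [hx, Complex.add_re, Complex.re_ofReal_mul]
    by_cases hxE : x ∈ E <;> simp [hxE]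
  have hindR : Integrable (E.indicator fun _ => (1 : ℝ)) μ :=
    (integrable_indicator_iff hEm).2 (integrableOn_const hEfin.ne)
  have hfre : Integrable (fun x => ((f : X →ₘ[μ] ℂ) x).re) μ := hf.re
  rw [hreh, integral_add hfre.integrableOn (hindR.const_mul _).integrableOn,
    integral_const_mul] at hmax
  have hEint : ∫ x in D, E.indicator (fun _ => (1 : ℝ)) x ∂μ = μ.real E := by
    rw [setIntegral_indicator hEm, setIntegral_const, smul_eq_mul, mul_one, measureReal_def,
      measureReal_def]
    congr 1
    refine measure_congr ?_
    filter_upwards [hED] with x hx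
    exact propext ⟨fun h => h.2, fun h => ⟨hx h, h⟩⟩
  rw [hEint] at hmax
  have hle : ∫ x in D, ((f : X →ₘ[μ] ℂ) x).re ∂μ ≤ ∫ x, ‖(f : X →ₘ[μ] ℂ) x‖ ∂μ := by
    calc ∫ x in D, ((f : X →ₘ[μ] ℂ) x).re ∂μ ≤ ∫ x in D, ‖(f : X →ₘ[μ] ℂ) x‖ ∂μ :=
          integral_mono hfre.integrableOn hf.norm.integrableOn fun x => Complex.re_le_norm _
      _ ≤ _ := setIntegral_le_integral hf.norm (ae_of_all _ fun x => norm_nonneg _)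
  rw [← ofReal_measureReal hEfin.ne]
  refine ENNReal.ofReal_le_ofReal ?_
  rw [le_inv_mul_iff₀ hlam]
  change 0 ≤ ∫ x in D, ((f : X →ₘ[μ] ℂ) x).re ∂μ + -lam * μ.real E at hmax
  linarith

end Maximal

/-! ### Weak type estimates and interpolation -/

section WeakType

variable {X : Type*} [MeasurableSpace X] {μ : Measure X} {T : Module.End ℂ (L1AddLinf μ)}

/-- The part of a function in `L_P` above the level `t` is integrable. -/
theorem MemLp.integrable_indicator_norm {f : X → ℂ} {P : ℝ} (hP : 1 ≤ P) (hfm : StronglyMeasurable f)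
    (hf : Integrable (fun x => ‖f x‖ ^ P) μ) {t : ℝ} (ht : 0 < t) :
    Integrable ({x | t < ‖f x‖}.indicator fun x => ‖f x‖) μ ∧
      ∫ x, {x | t < ‖f x‖}.indicator (fun x => ‖f x‖) x ∂μ
        ≤ t ^ (1 - P) * ∫ x, ‖f x‖ ^ P ∂μ := by
  have hmeas : MeasurableSet {x | t < ‖f x‖} :=
    measurableSet_lt measurable_const hfm.norm.measurable
  have hle : ∀ x, {x | t < ‖f x‖}.indicator (fun x => ‖f x‖) x ≤ t ^ (1 - P) * ‖f x‖ ^ P := by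
    intro x
    by_cases hx : x ∈ {x | t < ‖f x‖}
    · rw [Set.indicator_of_mem hx]
      have hx' : t < ‖f x‖ := hx
      have hpos : 0 < ‖f x‖ := ht.trans hx'
      have h1 : ‖f x‖ ^ (1 - P) ≤ t ^ (1 - P) :=
        Real.rpow_le_rpow_of_nonpos ht hx'.le (by linarith)
      calc ‖f x‖ = ‖f x‖ ^ (1 - P) * ‖f x‖ ^ P := by
            rw [← Real.rpow_add hpos]; simp
        _ ≤ _ := by gcongr
    · rw [Set.indicator_of_notMem hx]
      positivity
  have hint := hf.const_mul (t ^ (1 - P))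
  have h1 : Integrable ({x | t < ‖f x‖}.indicator fun x => ‖f x‖) μ := by
    refine hint.mono' (hfm.norm.indicator hmeas).aestronglyMeasurable (ae_of_all _ fun x => ?_)
    rw [Real.norm_of_nonneg (Set.indicator_nonneg (fun _ _ => norm_nonneg _) x)]
    exact hle x
  refine ⟨h1, ?_⟩
  rw [← integral_const_mul]
  exact integral_mono h1 hint hle

/-- Weak type maximal inequality in `L_p`, in qualitative form: the averages of the moduli of the
iterates of functions of small norm are uniformly small off a small set. -/
theorem exists_forall_sum_norm_iterate_le [SigmaFinite μ] (hT : IsPositiveDunfordSchwartz T)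
    (p : ℝ≥0∞) [hp1 : Fact (1 ≤ p)] (hp : p < ∞) {ε : ℝ≥0∞} (hε : 0 < ε) {lam : ℝ} (hlam : 0 < lam) :
    ∃ γ : ℝ, 0 < γ ∧ ∀ f : Lp ℂ p μ, ‖f‖ < γ → ∃ Y : Set X, MeasurableSet Y ∧ μ Yᶜ ≤ ε ∧
      ∀ x ∈ Y, ∀ n : ℕ, ∑ k ∈ Finset.range n, ‖lpIterate T k f x‖ ≤ n * lam := by
  set P := p.toReal with hPdef
  have hP : 1 ≤ P := by
    rw [hPdef, ← ENNReal.toReal_one]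
    exact ENNReal.toReal_mono hp.ne hp1.out
  have hP0 : 0 < P := zero_lt_one.trans_le hP
  set t := lam / 2 with ht
  have htpos : 0 < t := half_pos hlam
  set η : ℝ := (min ε 1).toReal with hη
  have hηpos : 0 < η := ENNReal.toReal_pos (lt_min hε one_pos).ne'
    (ne_top_of_le_ne_top ENNReal.one_ne_top (min_le_right _ _))
  set K : ℝ := t⁻¹ * t ^ (1 - P) with hK
  have hKpos : 0 < K := by positivity
  refine ⟨(η / K) ^ P⁻¹, by positivity, fun f hf => ?_⟩
  have hfm : StronglyMeasurable (f : X → ℂ) := Lp.stronglyMeasurable f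
  have hfP : Integrable (fun x => ‖f x‖ ^ P) μ := (Lp.memLp f).integrable_norm_rpow
    (zero_lt_one.trans_le hp1.out).ne' hp.ne
  obtain ⟨ha, haint⟩ := MemLp.integrable_indicator_norm hP hfm hfP htpos
  set a : X → ℝ := {x | t < ‖f x‖}.indicator fun x => ‖f x‖ with haf
  have ha0 : ∀ x, 0 ≤ a x := Set.indicator_nonneg fun _ _ => norm_nonneg _
  have hnormP : ∫ x, ‖f x‖ ^ P ∂μ ≤ η / K := by
    have h0 : 0 ≤ ∫ x, ‖f x‖ ^ P ∂μ := integral_nonneg fun x => by positivity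
    have h1 : ‖f‖ = (∫ x, ‖f x‖ ^ P ∂μ) ^ P⁻¹ := by
      rw [Lp.norm_def, (Lp.memLp f).eLpNorm_eq_integral_rpow_norm
        (zero_lt_one.trans_le hp1.out).ne' hp.ne, ENNReal.toReal_ofReal (by positivity)]
    rw [h1] at hf
    exact ((Real.rpow_lt_rpow_iff h0 (by positivity) (inv_pos.2 hP0)).1 hf).le
  -- `|f| ≤ a + t` with `a` integrable, so that `|T^k f| ≤ T^k a + t`
  obtain ⟨b, hb⟩ := exists_L1AddLinf_ae_eq_of_integrable (ha.ofReal (𝕜 := ℂ))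
  obtain ⟨e, he⟩ := exists_L1AddLinf_ae_eq_of_bound (μ := μ) (u := fun _ => (t : ℂ))
    aestronglyMeasurable_const t htpos.le
    (by intro x; rw [Complex.norm_real, Real.norm_of_nonneg htpos.le])
  have hbint : Integrable (b : X →ₘ[μ] ℂ) μ := (ha.ofReal (𝕜 := ℂ)).congr hb.symm
  have hkey : ∀ᵐ x ∂μ, ∀ k, ‖lpIterate T k f x‖ ≤ (((T ^ k) b : X →ₘ[μ] ℂ) x).re + t := by
    rw [ae_all_iff]
    intro k
    have h1 := (hT.pow k).norm_le_re (f := lpInclusion μ p f) (g := b + e) (by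
      filter_upwards [hb, he, L1AddLinf.coeFn_add b e] with x h1 h2 h3
      rw [h3, h1, h2, Complex.add_re, Complex.ofReal_re]
      change ‖f x‖ ≤ a x + t
      by_cases hx : x ∈ {x | t < ‖f x‖}
      · rw [haf, Set.indicator_of_mem hx]; linarith
      · have : ‖f x‖ ≤ t := not_lt.1 hx
        linarith [ha0 x])
    have h2 := (hT.pow k).norm_le_of_norm_le (f := e) htpos.le (by
      filter_upwards [he] with x hx
      rw [hx, Complex.norm_real, Real.norm_of_nonneg htpos.le])
    rw [map_add] at h1
    filter_upwards [h1, h2, L1AddLinf.coeFn_add ((T ^ k) b) ((T ^ k) e)] with x h1 h2 h3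
    rw [h3, Complex.add_re] at h1
    refine h1.trans ?_
    gcongr
    exact (Complex.re_le_norm _).trans h2
  set B := {x | ∃ n : ℕ, n * t < reOrbitSum T b n x} with hB
  have hBμ : μ B ≤ ε := by
    refine (measure_reOrbitSum_gt_le hT hbint htpos).trans ?_
    have h1 : ∫ x, ‖(b : X →ₘ[μ] ℂ) x‖ ∂μ = ∫ x, a x ∂μ := by
      refine integral_congr_ae ?_
      filter_upwards [hb] with x hx
      rw [hx]
      simpa using ha0 x
    rw [h1]
    have h2 : t⁻¹ * ∫ x, a x ∂μ ≤ η := by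
      calc t⁻¹ * ∫ x, a x ∂μ ≤ t⁻¹ * (t ^ (1 - P) * (η / K)) := by
            gcongr
            exact haint.trans (by gcongr)
        _ = K * (η / K) := by rw [hK]; ring
        _ = η := by field_simp
    refine (ENNReal.ofReal_le_ofReal h2).trans ?_
    rw [hη, ENNReal.ofReal_toReal (ne_top_of_le_ne_top ENNReal.one_ne_top (min_le_right _ _))]
    exact min_le_left _ _
  set N := {x | ¬ ∀ k, ‖lpIterate T k f x‖ ≤ (((T ^ k) b : X →ₘ[μ] ℂ) x).re + t} with hN
  have hN0 : μ N = 0 := hkey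
  refine ⟨(toMeasurable μ (B ∪ N))ᶜ, (measurableSet_toMeasurable _ _).compl, ?_, fun x hx n => ?_⟩
  · rw [compl_compl, measure_toMeasurable]
    exact (measure_union_le _ _).trans (by rw [hN0, add_zero]; exact hBμ)
  · have hx' : x ∉ B ∪ N := fun h => hx (subset_toMeasurable μ _ h)
    have hxB : ¬ ∃ n : ℕ, n * t < reOrbitSum T b n x := fun h => hx' (Or.inl h)
    have hxN : ∀ k, ‖lpIterate T k f x‖ ≤ (((T ^ k) b : X →ₘ[μ] ℂ) x).re + t := by
      by_contra h
      exact hx' (Or.inr h)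
    push Not at hxB
    have h1 := hxB n
    calc ∑ k ∈ Finset.range n, ‖lpIterate T k f x‖
        ≤ ∑ k ∈ Finset.range n, ((((T ^ k) b : X →ₘ[μ] ℂ) x).re + t) :=
          Finset.sum_le_sum fun k _ => hxN k
      _ = reOrbitSum T b n x + n * t := by
          rw [Finset.sum_add_distrib, reOrbitSum, Complex.re_sum]; simp
      _ ≤ n * t + n * t := by gcongr
      _ = n * lam := by rw [ht]; ring

end WeakType

section Interpolation

variable {X : Type*} [MeasurableSpace X] {μ : Measure X}

/-- On sets bounded in `L_1` and in `L_∞`, the norm of `L_q`, `1 < q < ∞`, is controlled by the norm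
of `L_2`. -/
theorem exists_eLpNorm_le_of_eLpNorm_two_le {q : ℝ≥0∞} (hq : 1 < q) (hq' : q < ∞) {C : ℝ≥0∞}
    (hC : C ≠ ∞) {ε : ℝ≥0∞} (hε : 0 < ε) (hε' : ε ≠ ∞) : ∃ δ : ℝ≥0∞, 0 < δ ∧ ∀ u : X →ₘ[μ] ℂ,
      eLpNorm u 1 μ ≤ C → eLpNorm u ∞ μ ≤ C → eLpNorm u 2 μ ≤ δ → eLpNorm u q μ ≤ ε := by
  set Q := q.toReal with hQdef
  have hQ : 1 < Q := by
    rw [hQdef, ← ENNReal.toReal_one]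
    exact (ENNReal.toReal_lt_toReal ENNReal.one_ne_top hq'.ne).2 hq
  have hQ0 : 0 < Q := zero_lt_one.trans hQ
  set A : ℝ≥0∞ := ε ^ Q / 2 with hA
  have hA0 : A ≠ 0 := by
    rw [hA]
    exact (ENNReal.half_pos (ENNReal.rpow_pos hε hε').ne').ne'
  have hAtop : A ≠ ∞ := ENNReal.div_ne_top (ENNReal.rpow_ne_top_of_nonneg hQ0.le hε') (by simp)
  have hdiv : ∀ B : ℝ≥0∞, B ≠ ∞ → A / (B + 1) * B ≤ A := fun B hB => by
    calc A / (B + 1) * B ≤ A / (B + 1) * (B + 1) := by gcongr; exact le_self_add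
      _ = A := ENNReal.div_mul_cancel (by simp) (by simp [hB])
  have hdiv0 : ∀ B : ℝ≥0∞, B ≠ ∞ → A / (B + 1) ≠ 0 := fun B hB =>
    (ENNReal.div_pos hA0 (by simp [hB])).ne'
  have hdivtop : ∀ B : ℝ≥0∞, A / (B + 1) ≠ ∞ := fun B => ENNReal.div_ne_top hAtop (by simp)
  set η : ℝ≥0∞ := (A / (C + 1)) ^ (Q - 1)⁻¹ with hη
  have hη0 : η ≠ 0 := (ENNReal.rpow_pos (pos_iff_ne_zero.2 (hdiv0 C hC)) (hdivtop C)).ne'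
  have hηtop : η ≠ ∞ := ENNReal.rpow_ne_top_of_nonneg (by simp; linarith) (hdivtop C)
  have hηQ : η ^ (Q - 1) = A / (C + 1) := by
    rw [hη, ← ENNReal.rpow_mul, inv_mul_cancel₀ (by linarith), ENNReal.rpow_one]
  set B : ℝ≥0∞ := C ^ Q * (η⁻¹) ^ (2 : ℝ) with hB
  have hBtop : B ≠ ∞ := ENNReal.mul_ne_top (ENNReal.rpow_ne_top_of_nonneg hQ0.le hC)
    (ENNReal.rpow_ne_top_of_nonneg (by norm_num) (ENNReal.inv_ne_top.2 hη0))
  refine ⟨(A / (B + 1)) ^ (1 / 2 : ℝ), ENNReal.rpow_pos (pos_iff_ne_zero.2 (hdiv0 B hBtop))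
    (hdivtop B), fun u h1 hinf h2 => ?_⟩
  -- where `|u|` is small it is compared with its first power, elsewhere with its square
  have hpt : ∀ᵐ x ∂μ, ‖u x‖ₑ ^ Q ≤ η ^ (Q - 1) * ‖u x‖ₑ + B * ‖u x‖ₑ ^ (2 : ℝ) := by
    filter_upwards [ae_le_eLpNormEssSup (f := u) (μ := μ)] with x hx
    rw [eLpNorm_exponent_top] at hinf
    have hxC := hx.trans hinf
    rcases le_or_gt ‖u x‖ₑ η with hle | hlt
    · refine le_trans ?_ le_self_add
      calc ‖u x‖ₑ ^ Q = ‖u x‖ₑ ^ (Q - 1) * ‖u x‖ₑ ^ (1 : ℝ) := by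
            rw [← ENNReal.rpow_add_of_nonneg _ _ (by linarith) zero_le_one]
            congr 1; ring
        _ ≤ _ := by
            rw [ENNReal.rpow_one]
            gcongr
    · refine le_trans ?_ le_add_self
      have h3 : 1 ≤ η⁻¹ * ‖u x‖ₑ := by
        rw [← ENNReal.inv_mul_cancel hη0 hηtop]
        gcongr
      calc ‖u x‖ₑ ^ Q ≤ C ^ Q * 1 := by rw [mul_one]; gcongr
        _ ≤ C ^ Q * (η⁻¹ * ‖u x‖ₑ) ^ (2 : ℝ) := by
            gcongr
            exact ENNReal.one_le_rpow h3 (by norm_num)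
        _ = _ := by rw [ENNReal.mul_rpow_of_nonneg _ _ (by norm_num), hB, mul_assoc]
  have hint : ∫⁻ x, ‖u x‖ₑ ^ Q ∂μ ≤ ε ^ Q := by
    have hm : AEMeasurable (fun x => ‖u x‖ₑ) μ := u.aestronglyMeasurable.enorm
    calc ∫⁻ x, ‖u x‖ₑ ^ Q ∂μ
        ≤ ∫⁻ x, (η ^ (Q - 1) * ‖u x‖ₑ + B * ‖u x‖ₑ ^ (2 : ℝ)) ∂μ := lintegral_mono_ae hpt
      _ = η ^ (Q - 1) * ∫⁻ x, ‖u x‖ₑ ∂μ + B * ∫⁻ x, ‖u x‖ₑ ^ (2 : ℝ) ∂μ := by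
          rw [lintegral_add_left' (hm.const_mul _), lintegral_const_mul'' _ hm,
            lintegral_const_mul'' _ (hm.pow_const _)]
      _ ≤ A / (C + 1) * C + B * (A / (B + 1)) := by
          rw [hηQ]
          gcongr
          · rwa [← eLpNorm_one_eq_lintegral_enorm]
          · rw [eLpNorm_eq_lintegral_rpow_enorm_toReal (by norm_num) (by norm_num)] at h2
            simp only [ENNReal.toReal_ofNat] at h2
            exact (ENNReal.rpow_le_rpow_iff (by norm_num)).1 h2
      _ ≤ A + A := add_le_add (hdiv C hC) (by rw [mul_comm]; exact hdiv B hBtop)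
      _ = ε ^ Q := by rw [hA]; exact ENNReal.add_halves _
  rw [eLpNorm_eq_lintegral_rpow_enorm_toReal (zero_lt_one.trans hq).ne' hq'.ne]
  calc (∫⁻ x, ‖u x‖ₑ ^ Q ∂μ) ^ (1 / Q) ≤ (ε ^ Q) ^ (1 / Q) := by gcongr
    _ = ε := by rw [← ENNReal.rpow_mul, mul_one_div_cancel hQ0.ne', ENNReal.rpow_one]

/-- The class `u` has norm at most `C` in `L_1` and in `L_∞`. -/
def BoundedL1Linf (C : ℝ≥0∞) (u : X →ₘ[μ] ℂ) : Prop := eLpNorm u 1 μ ≤ C ∧ eLpNorm u ∞ μ ≤ C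

namespace BoundedL1Linf

variable {C D : ℝ≥0∞} {u v : X →ₘ[μ] ℂ}

theorem add (hu : BoundedL1Linf C u) (hv : BoundedL1Linf D v) : BoundedL1Linf (C + D) (u + v) := by
  have h : ∀ p : ℝ≥0∞, 1 ≤ p →
      eLpNorm (u + v : X →ₘ[μ] ℂ) p μ ≤ eLpNorm u p μ + eLpNorm v p μ := fun p hp => by
    rw [eLpNorm_congr_ae (AEEqFun.coeFn_add u v)]
    exact eLpNorm_add_le u.aestronglyMeasurable v.aestronglyMeasurable hp
  exact ⟨(h 1 le_rfl).trans (add_le_add hu.1 hv.1), (h ∞ le_top).trans (add_le_add hu.2 hv.2)⟩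

theorem smul (c : ℂ) (hu : BoundedL1Linf C u) : BoundedL1Linf (‖c‖ₑ * C) (c • u) := by
  have h : ∀ p : ℝ≥0∞, eLpNorm (c • u : X →ₘ[μ] ℂ) p μ ≤ ‖c‖ₑ * eLpNorm u p μ := fun p => by
    rw [eLpNorm_congr_ae (AEEqFun.coeFn_smul c u)]
    exact eLpNorm_const_smul_le
  exact ⟨(h 1).trans (mul_le_mul_right hu.1 _), (h ∞).trans (mul_le_mul_right hu.2 _)⟩

theorem zero : BoundedL1Linf 0 (0 : X →ₘ[μ] ℂ) := by
  have h : ∀ p : ℝ≥0∞, eLpNorm (0 : X →ₘ[μ] ℂ) p μ ≤ 0 := fun p => by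
    rw [eLpNorm_congr_ae AEEqFun.coeFn_zero]
    simp
  exact ⟨h 1, h ∞⟩

theorem mono (hu : BoundedL1Linf C u) (h : C ≤ D) : BoundedL1Linf D u :=
  ⟨hu.1.trans h, hu.2.trans h⟩

theorem memLp (hu : BoundedL1Linf C u) (hC : C ≠ ∞) {p : ℝ≥0∞} (hp : 1 ≤ p) : MemLp u p μ := by
  rcases eq_or_ne p ∞ with rfl | hp'
  · exact ⟨u.aestronglyMeasurable, hu.2.trans_lt hC.lt_top⟩
  have hP : 1 ≤ p.toReal := by
    rw [← ENNReal.toReal_one]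
    exact ENNReal.toReal_mono hp' hp
  refine ⟨u.aestronglyMeasurable, ?_⟩
  rw [eLpNorm_lt_top_iff_lintegral_rpow_enorm_lt_top (zero_lt_one.trans_le hp).ne' hp']
  calc ∫⁻ x, ‖u x‖ₑ ^ p.toReal ∂μ ≤ ∫⁻ x, C ^ (p.toReal - 1) * ‖u x‖ₑ ∂μ := by
        refine lintegral_mono_ae ?_
        filter_upwards [ae_le_eLpNormEssSup (f := u) (μ := μ)] with x hx
        have hxC : ‖u x‖ₑ ≤ C := hx.trans (by simpa only [eLpNorm_exponent_top] using hu.2)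
        calc ‖u x‖ₑ ^ p.toReal = ‖u x‖ₑ ^ (p.toReal - 1) * ‖u x‖ₑ ^ (1 : ℝ) := by
              rw [← ENNReal.rpow_add_of_nonneg _ _ (by linarith) zero_le_one]
              congr 1; ring
          _ ≤ _ := by
              rw [ENNReal.rpow_one]
              gcongr
    _ = C ^ (p.toReal - 1) * ∫⁻ x, ‖u x‖ₑ ∂μ := lintegral_const_mul'' _ u.aestronglyMeasurable.enorm
    _ < ∞ := by
        refine ENNReal.mul_lt_top (ENNReal.rpow_lt_top_of_nonneg (by linarith) hC) ?_
        rw [← eLpNorm_one_eq_lintegral_enorm]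
        exact hu.1.trans_lt hC.lt_top

theorem sum {ι : Type*} (s : Finset ι) {B : ι → ℝ≥0∞} {w : ι → X →ₘ[μ] ℂ}
    (hw : ∀ i ∈ s, BoundedL1Linf (B i) (w i)) : BoundedL1Linf (∑ i ∈ s, B i) (∑ i ∈ s, w i) := by
  classical
  induction s using Finset.induction_on with
  | empty => simpa using zero
  | insert a s ha ih =>
    rw [Finset.sum_insert ha, Finset.sum_insert ha]
    exact (hw a (Finset.mem_insert_self a s)).add
      (ih fun i hi => hw i (Finset.mem_insert_of_mem hi))

/-- Bounds in `L_1` and `L_∞` pass to limits in `L_2`, by Fatou's lemma. -/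
theorem of_tendsto {F : ℕ → Lp ℂ 2 μ} {f : Lp ℂ 2 μ} (hF : Tendsto F atTop (𝓝 f)) {B : ℕ → ℝ≥0∞}
    (hB : Tendsto B atTop (𝓝 C)) (h : ∀ n, BoundedL1Linf (B n) (F n : X →ₘ[μ] ℂ)) :
    BoundedL1Linf C (f : X →ₘ[μ] ℂ) := by
  obtain ⟨ns, hns, hae⟩ := (tendstoInMeasure_of_tendsto_Lp hF).exists_seq_tendsto_ae
  have key : ∀ p : ℝ≥0∞, (∀ n, eLpNorm (F n) p μ ≤ B n) → eLpNorm f p μ ≤ C := by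
    intro p hp
    calc eLpNorm f p μ ≤ liminf (fun i => eLpNorm (F (ns i)) p μ) atTop :=
          Lp.eLpNorm_lim_le_liminf_eLpNorm (fun i => Lp.aestronglyMeasurable _) _ hae
      _ ≤ liminf (fun i => B (ns i)) atTop := liminf_le_liminf (Eventually.of_forall fun i => hp _)
      _ = C := (hB.comp hns.tendsto_atTop).liminf_eq
  exact ⟨key 1 fun n => (h n).1, key ∞ fun n => (h n).2⟩

theorem apply {T : Module.End ℂ (L1AddLinf μ)} (hT : IsPositiveDunfordSchwartz T) {f : L1AddLinf μ}
    (hf : BoundedL1Linf C (f : X →ₘ[μ] ℂ)) : BoundedL1Linf C (T f : X →ₘ[μ] ℂ) :=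
  ⟨(hT.norm_one_le f).trans hf.1, (hT.norm_top_le f).trans hf.2⟩

end BoundedL1Linf

end Interpolation

/-! ### Decomposition into flight vectors and eigenvectors -/

section Decomposition

variable {X : Type*} [MeasurableSpace X] {μ : Measure X} {T : Module.End ℂ (L1AddLinf μ)}

/-- The element of `L_p` given by a class in `L_1 ∩ L_∞`. -/
def BoundedL1Linf.toLp {C : ℝ≥0∞} {u : X →ₘ[μ] ℂ} (hu : BoundedL1Linf C u) (hC : C ≠ ∞) (p : ℝ≥0∞)
    [hp : Fact (1 ≤ p)] : Lp ℂ p μ :=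
  ⟨u, Lp.mem_Lp_iff_memLp.2 (hu.memLp hC hp.out)⟩

theorem BoundedL1Linf.apply_toL2_pow {C : ℝ≥0∞} (hT : IsPositiveDunfordSchwartz T) {s : Lp ℂ 2 μ}
    (hs : BoundedL1Linf C (s : X →ₘ[μ] ℂ)) (n : ℕ) :
    BoundedL1Linf C ((hT.toL2 ^ n) s : X →ₘ[μ] ℂ) := by
  have h1 : BoundedL1Linf C (((T ^ n) (lpInclusion μ 2 s) : L1AddLinf μ) : X →ₘ[μ] ℂ) :=
    BoundedL1Linf.apply (hT.pow n) (f := lpInclusion μ 2 s) hs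
  rw [← hT.lpInclusion_toL2_pow] at h1
  exact h1

/-- The inclusion of `L_p` into the space of classes of functions, as a linear map. -/
noncomputable def lpCoe (μ : Measure X) (p : ℝ≥0∞) [Fact (1 ≤ p)] : Lp ℂ p μ →ₗ[ℂ] X →ₘ[μ] ℂ :=
  (L1AddLinf μ).subtype ∘ₗ lpInclusion μ p

theorem lpCoe_apply (p : ℝ≥0∞) [Fact (1 ≤ p)] (f : Lp ℂ p μ) : lpCoe μ p f = (f : X →ₘ[μ] ℂ) := rfl

theorem eLpNorm_le_of_norm_sq_le {y : Lp ℂ 2 μ} {δ : ℝ} (hδ : 0 ≤ δ) (h : ‖y‖ ^ 2 ≤ δ ^ 2) :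
    eLpNorm y 2 μ ≤ ENNReal.ofReal δ := by
  rw [← ENNReal.ofReal_toReal (Lp.eLpNorm_ne_top y), ← Lp.norm_def]
  exact ENNReal.ofReal_le_ofReal (le_of_sq_le_sq h hδ)

/-- A vector of `L_1 ∩ L_∞` that is orthogonal in `L_2` to all unimodular eigenvectors is a flight
vector in every `L_q`, `1 < q < ∞`. Along suitable times its orbit is nearly orthogonal in `L_2`, so
averages of `m` members of it tend to `0` in `L_2`, hence in `L_q`, uniformly in the choice of the
members; so a continuous functional on `L_q` is bounded away from `0` on finitely many only. -/
theorem mem_flightVectors_of_orthogonal (hT : IsPositiveDunfordSchwartz T) (q : ℝ≥0∞)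
    [Fact (1 ≤ q)] (hq : 1 < q) (hq' : q < ∞) {C : ℝ≥0∞} (hC : C ≠ ∞) {s : Lp ℂ 2 μ}
    (hs : BoundedL1Linf C (s : X →ₘ[μ] ℂ))
    (hort : ∀ (z : ℂ) (u : Lp ℂ 2 μ), ‖z‖ = 1 → hT.toL2 u = z • u → inner ℂ u s = 0) :
    hs.toLp hC q ∈ flightVectors T q := by
  classical
  obtain ⟨n, hn, hnear⟩ := exists_strictMono_inner_iterate_le hT.norm_toL2_le hort
  set x : ℕ → Lp ℂ 2 μ := fun j => (hT.toL2 ^ n j) s with hx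
  have hxb : ∀ j, BoundedL1Linf C (x j : X →ₘ[μ] ℂ) := fun j => hs.apply_toL2_pow hT (n j)
  have hxn : ∀ j, ‖x j‖ ≤ ‖s‖ := fun j => norm_pow_apply_le hT.norm_toL2_le _ _
  set g : ℕ → Lp ℂ q μ := fun j => (hxb j).toLp hC q with hg
  have hgx : ∀ j, lpInclusion μ q (g j) = lpInclusion μ 2 (x j) := fun j => rfl
  refine ⟨n, hn, g, fun j => ?_, fun φ => ?_⟩
  · have h1 := congrArg (fun u : L1AddLinf μ => (u : X →ₘ[μ] ℂ)) (hT.lpInclusion_toL2_pow (n j) s)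
    exact h1
  rw [← Nat.cofinite_eq_atTop, Metric.tendsto_nhds]
  intro δ hδ
  rw [eventually_cofinite]
  by_contra hinf
  have hinf' : {j | ¬ dist (φ (g j)) 0 < δ}.Infinite := hinf
  set ε : ℝ≥0∞ := ENNReal.ofReal (δ / (2 * (‖φ‖ + 1))) with hε
  have hεpos : 0 < ε := ENNReal.ofReal_pos.2 (by positivity)
  obtain ⟨δ', hδ'pos, hδ'⟩ := exists_eLpNorm_le_of_eLpNorm_two_le (μ := μ) hq hq' hC hεpos
    ENNReal.ofReal_ne_top
  set d : ℝ := (min δ' 1).toReal with hd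
  have hdpos : 0 < d := ENNReal.toReal_pos (lt_min hδ'pos one_pos).ne'
    (ne_top_of_le_ne_top ENNReal.one_ne_top (min_le_right _ _))
  have hdle : ENNReal.ofReal d ≤ δ' := by
    rw [hd, ENNReal.ofReal_toReal (ne_top_of_le_ne_top ENNReal.one_ne_top (min_le_right _ _))]
    exact min_le_left _ _
  obtain ⟨m, hm⟩ := exists_nat_gt ((‖s‖ ^ 2 + 2) / d ^ 2)
  have hmpos : (0 : ℝ) < m := lt_of_le_of_lt (by positivity) hm
  obtain ⟨J, hJ, hJm⟩ := hinf'.exists_subset_card_eq m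
  -- unimodular factors that make all terms `c j * φ (g j)` positive
  set c : ℕ → ℂ := fun j => (starRingEnd ℂ) (φ (g j)) / ‖φ (g j)‖ with hc
  have hc1 : ∀ j, ‖c j‖ ≤ 1 := fun j => by
    rw [hc]
    simp only [norm_div, RCLike.norm_conj, Complex.norm_real, norm_norm]
    exact div_self_le_one _
  have hcφ : ∀ j ∈ J, c j * φ (g j) = ‖φ (g j)‖ := fun j hj => by
    have h1 : ¬ dist (φ (g j)) 0 < δ := hJ hj
    rw [dist_zero_right, not_lt] at h1
    have h2 : (‖φ (g j)‖ : ℂ) ≠ 0 := by exact_mod_cast (hδ.trans_le h1).ne'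
    rw [hc]
    simp only
    rw [div_mul_eq_mul_div, ← Complex.normSq_eq_conj_mul_self, Complex.normSq_eq_norm_sq]
    push_cast
    field_simp
  set y : Lp ℂ 2 μ := (m : ℂ)⁻¹ • ∑ j ∈ J, c j • x j with hy
  set y' : Lp ℂ q μ := (m : ℂ)⁻¹ • ∑ j ∈ J, c j • g j with hy'
  have hyy : lpInclusion μ q y' = lpInclusion μ 2 y := by
    rw [hy, hy', map_smul, map_smul, map_sum, map_sum]
    simp only [map_smul, hgx]
  have hyy' : (y' : X →ₘ[μ] ℂ) = (y : X →ₘ[μ] ℂ) :=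
    congrArg (fun u : L1AddLinf μ => (u : X →ₘ[μ] ℂ)) hyy
  have hyb : BoundedL1Linf C (y : X →ₘ[μ] ℂ) := by
    have h1 : (y : X →ₘ[μ] ℂ) = (m : ℂ)⁻¹ • ∑ j ∈ J, c j • (x j : X →ₘ[μ] ℂ) := by
      rw [← lpCoe_apply, hy, map_smul, map_sum]
      simp only [map_smul, lpCoe_apply]
    rw [h1]
    refine ((BoundedL1Linf.sum J fun j _ => (hxb j).smul (c j)).smul _).mono ?_
    calc ‖(m : ℂ)⁻¹‖ₑ * ∑ j ∈ J, ‖c j‖ₑ * C ≤ ‖(m : ℂ)⁻¹‖ₑ * ∑ j ∈ J, 1 * C := by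
          gcongr with j _
          rw [← ofReal_norm, ← ENNReal.ofReal_one]
          exact ENNReal.ofReal_le_ofReal (hc1 j)
      _ = ‖(m : ℂ)⁻¹‖ₑ * (m * C) := by simp [hJm]
      _ = C := by
          have hm0 : (m : ℂ) ≠ 0 := by exact_mod_cast hmpos.ne'
          have hm0' : (m : ℝ≥0∞) ≠ 0 := by exact_mod_cast hmpos.ne'
          rw [enorm_inv hm0, ← mul_assoc]
          have : ‖(m : ℂ)‖ₑ = m := by
            rw [← ofReal_norm, RCLike.norm_natCast, ENNReal.ofReal_natCast]
          rw [this, ENNReal.inv_mul_cancel hm0' (ENNReal.natCast_ne_top m), one_mul]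
  have hy2 : ‖y‖ ^ 2 ≤ d ^ 2 := by
    rw [hy, norm_smul, mul_pow, norm_inv, RCLike.norm_natCast]
    have h1 := norm_sum_smul_sq_le hxn hnear c hc1 J
    rw [hJm] at h1
    have h2 : ‖s‖ ^ 2 + 2 ≤ m * d ^ 2 := ((div_lt_iff₀ (by positivity)).1 hm).le
    calc ((m : ℝ)⁻¹) ^ 2 * ‖∑ j ∈ J, c j • x j‖ ^ 2
        ≤ ((m : ℝ)⁻¹) ^ 2 * ((m * d ^ 2) * m) := by
          gcongr
          exact h1.trans (by gcongr)
      _ = d ^ 2 := by field_simp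
  have hyq : eLpNorm y q μ ≤ ε :=
    hδ' y hyb.1 hyb.2 ((eLpNorm_le_of_norm_sq_le hdpos.le hy2).trans hdle)
  have hy'n : ‖y'‖ ≤ δ / (2 * (‖φ‖ + 1)) := by
    rw [Lp.norm_def, hyy']
    exact ENNReal.toReal_le_of_le_ofReal (by positivity) hyq
  have hφy : φ y' = ((m : ℝ)⁻¹ * ∑ j ∈ J, ‖φ (g j)‖ : ℝ) := by
    rw [hy', map_smul, map_sum]
    simp only [map_smul, smul_eq_mul]
    rw [Finset.sum_congr rfl hcφ]
    push_cast
    rfl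
  have hge : δ ≤ ‖φ y'‖ := by
    rw [hφy, Complex.norm_real, Real.norm_of_nonneg (by positivity), le_inv_mul_iff₀ hmpos]
    calc (m : ℝ) * δ = ∑ j ∈ J, δ := by simp [hJm]
      _ ≤ _ := Finset.sum_le_sum fun j hj => by
          have h1 : ¬ dist (φ (g j)) 0 < δ := hJ hj
          rwa [dist_zero_right, not_lt] at h1
  have hle : ‖φ y'‖ ≤ δ / 2 := by
    calc ‖φ y'‖ ≤ ‖φ‖ * ‖y'‖ := φ.le_opNorm _
      _ ≤ (‖φ‖ + 1) * (δ / (2 * (‖φ‖ + 1))) := by gcongr; linarith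
      _ = δ / 2 := by field_simp
  linarith

/-- The span of the eigenvectors of `T` in `L_1 + L_∞` with unimodular eigenvalue. -/
noncomputable def unimodularSpan (T : Module.End ℂ (L1AddLinf μ)) : Submodule ℂ (L1AddLinf μ) :=
  Submodule.span ℂ {u | ∃ z : ℂ, ‖z‖ = 1 ∧ T u = z • u}

theorem lpInclusion_mem_unimodularSpan (hT : IsPositiveDunfordSchwartz T) {w : Lp ℂ 2 μ}
    (hw : w ∈ eigenSpan hT.toL2) : lpInclusion μ 2 w ∈ unimodularSpan T := by
  have h1 : eigenSpan hT.toL2 ≤ (unimodularSpan T).comap (lpInclusion μ 2) := by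
    refine Submodule.span_le.2 ?_
    rintro u ⟨z, hz, hzu⟩
    refine Submodule.subset_span ⟨z, hz, ?_⟩
    rw [← hT.lpInclusion_toL2, hzu, map_smul]
  exact h1 hw

theorem boundedL1Linf_kernelAverage {C : ℝ≥0∞} (hT : IsPositiveDunfordSchwartz T) {s : Lp ℂ 2 μ}
    (hs : BoundedL1Linf C (s : X →ₘ[μ] ℂ)) {Φ : ℕ → ℝ} (hΦ : ∀ n, 0 ≤ Φ n) (N : ℕ) :
    BoundedL1Linf (ENNReal.ofReal ((N : ℝ)⁻¹ * ∑ n ∈ Finset.range N, Φ n) * C)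
      ((kernelAverage hT.toL2 Φ N s : Lp ℂ 2 μ) : X →ₘ[μ] ℂ) := by
  have h1 : ((kernelAverage hT.toL2 Φ N s : Lp ℂ 2 μ) : X →ₘ[μ] ℂ)
      = (N : ℂ)⁻¹ • ∑ n ∈ Finset.range N, (Φ n : ℂ) • ((hT.toL2 ^ n) s : X →ₘ[μ] ℂ) := by
    rw [← lpCoe_apply, kernelAverage, map_smul, map_sum]
    simp only [map_smul, lpCoe_apply]
  rw [h1]
  refine ((BoundedL1Linf.sum _ fun n _ => (hs.apply_toL2_pow hT n).smul (Φ n : ℂ)).smul _).mono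
    (le_of_eq ?_)
  rw [← Finset.sum_mul, ← mul_assoc]
  congr 1
  rw [ENNReal.ofReal_mul (by positivity), ENNReal.ofReal_sum_of_nonneg fun n _ => hΦ n]
  congr 1
  · rw [← ofReal_norm, norm_inv, RCLike.norm_natCast]
  · refine Finset.sum_congr rfl fun n _ => ?_
    rw [← ofReal_norm, Complex.norm_real, Real.norm_of_nonneg (hΦ n)]

/-- The Jacobs–de Leeuw–Glicksberg decomposition, in approximate form: up to a small error in `L_q`,
a vector of `L_1 ∩ L_∞` is the sum of a flight vector and of finitely many eigenvectors with unimodular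
eigenvalues. -/
theorem exists_flight_add_eigen_add_small (hT : IsPositiveDunfordSchwartz T) (q : ℝ≥0∞)
    [Fact (1 ≤ q)] (hq : 1 < q) (hq' : q < ∞) {C : ℝ≥0∞} (hC : C ≠ ∞) {g : L1AddLinf μ}
    (hg : BoundedL1Linf C (g : X →ₘ[μ] ℂ)) {ε : ℝ} (hε : 0 < ε) :
    ∃ s ∈ flightVectors T q, ∃ e ∈ unimodularSpan T, ∃ h : Lp ℂ q μ, ‖h‖ ≤ ε ∧
      g = lpInclusion μ q s + e + lpInclusion μ q h := by
  set f : Lp ℂ 2 μ := hg.toLp hC 2 with hf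
  have hfb : BoundedL1Linf C (f : X →ₘ[μ] ℂ) := hg
  set Q := eigenProjection hT.toL2 f with hQ
  -- Bochner–Fejér means of the orbit of `f` inherit the bounds of `f` in `L_1` and `L_∞`
  have hnear : ∀ δ : ℝ, 0 < δ → ∃ w : Lp ℂ 2 μ, w ∈ eigenSpan hT.toL2 ∧
      BoundedL1Linf C (w : X →ₘ[μ] ℂ) ∧ ‖w - Q‖ < δ := by
    intro δ hδ
    obtain ⟨Φ, w, hΦ0, hΦ1, hw, hlim, hwQ⟩ :=
      exists_kernelAverage_near_eigenProjection hT.norm_toL2_le f hδ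
    refine ⟨w, hw, ?_, hwQ⟩
    have h1 : Tendsto (fun N : ℕ => ENNReal.ofReal ((N : ℝ)⁻¹ * ∑ n ∈ Finset.range N, Φ n) * C)
        atTop (𝓝 (ENNReal.ofReal 1 * C)) :=
      ENNReal.Tendsto.mul_const (ENNReal.tendsto_ofReal hΦ1) (Or.inr hC)
    rw [ENNReal.ofReal_one, one_mul] at h1
    exact BoundedL1Linf.of_tendsto hlim h1 fun N => boundedL1Linf_kernelAverage hT hfb hΦ0 N
  have hQb : BoundedL1Linf C (Q : X →ₘ[μ] ℂ) := by
    choose w _ hwb hwQ using fun n : ℕ => hnear (1 / (n + 1)) (by positivity)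
    refine BoundedL1Linf.of_tendsto (F := w) (B := fun _ => C) ?_ tendsto_const_nhds hwb
    rw [tendsto_iff_norm_sub_tendsto_zero]
    exact squeeze_zero (fun _ => norm_nonneg _) (fun n => (hwQ n).le)
      tendsto_one_div_add_atTop_nhds_zero_nat
  have hneg : ∀ {u v : Lp ℂ 2 μ}, BoundedL1Linf C (u : X →ₘ[μ] ℂ) →
      BoundedL1Linf C (v : X →ₘ[μ] ℂ) → BoundedL1Linf (C + C) ((u - v : Lp ℂ 2 μ) : X →ₘ[μ] ℂ) := by
    intro u v hu hv
    have h1 : ((u - v : Lp ℂ 2 μ) : X →ₘ[μ] ℂ) = (u : X →ₘ[μ] ℂ) + (-1 : ℂ) • (v : X →ₘ[μ] ℂ) := by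
      rw [← lpCoe_apply, sub_eq_add_neg, ← neg_one_smul ℂ v, map_add, map_smul]
      rfl
    rw [h1]
    exact hu.add ((hv.smul (-1)).mono (by simp))
  have hCC : C + C ≠ ∞ := ENNReal.add_ne_top.2 ⟨hC, hC⟩
  have hsb : BoundedL1Linf (C + C) ((f - Q : Lp ℂ 2 μ) : X →ₘ[μ] ℂ) := hneg hfb hQb
  have hflight := mem_flightVectors_of_orthogonal hT q hq hq' hCC hsb
    fun z u hz hzu => inner_sub_eigenProjection hT.toL2 f hz hzu
  obtain ⟨δ', hδ'pos, hδ'⟩ := exists_eLpNorm_le_of_eLpNorm_two_le (μ := μ) hq hq' hCC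
    (ENNReal.ofReal_pos.2 hε) ENNReal.ofReal_ne_top
  set d : ℝ := (min δ' 1).toReal with hd
  have hdpos : 0 < d := ENNReal.toReal_pos (lt_min hδ'pos one_pos).ne'
    (ne_top_of_le_ne_top ENNReal.one_ne_top (min_le_right _ _))
  have hdle : ENNReal.ofReal d ≤ δ' := by
    rw [hd, ENNReal.ofReal_toReal (ne_top_of_le_ne_top ENNReal.one_ne_top (min_le_right _ _))]
    exact min_le_left _ _
  obtain ⟨w, hw, hwb, hwQ⟩ := hnear d hdpos
  have hhb : BoundedL1Linf (C + C) ((Q - w : Lp ℂ 2 μ) : X →ₘ[μ] ℂ) := hneg hQb hwb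
  refine ⟨hsb.toLp hCC q, hflight, lpInclusion μ 2 w, lpInclusion_mem_unimodularSpan hT hw,
    hhb.toLp hCC q, ?_, ?_⟩
  · have h4 : eLpNorm ((Q - w : Lp ℂ 2 μ) : X →ₘ[μ] ℂ) q μ ≤ ENNReal.ofReal ε := by
      refine hδ' _ hhb.1 hhb.2 ?_
      refine (eLpNorm_le_of_norm_sq_le hdpos.le ?_).trans hdle
      rw [norm_sub_rev]
      gcongr
    exact ENNReal.toReal_le_of_le_ofReal hε.le h4
  · have h1 : g = lpInclusion μ 2 f := rfl
    have h2 : lpInclusion μ q (hsb.toLp hCC q) = lpInclusion μ 2 (f - Q) := rfl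
    have h3 : lpInclusion μ q (hhb.toLp hCC q) = lpInclusion μ 2 (Q - w) := rfl
    rw [h1, h2, h3, ← map_add, ← map_add]
    congr 1
    abel

end Decomposition

/-! ### Weighted averages off small sets -/

section OffSmallSets

variable {X : Type*} [MeasurableSpace X]

/-- The property `P` of sets holds for the complements of suitable sets of arbitrarily small
measure. -/
def OffSmallSets (μ : Measure X) (P : Set X → Prop) : Prop :=
  ∀ ε : ℝ≥0∞, 0 < ε → ∃ Y : Set X, MeasurableSet Y ∧ μ Yᶜ ≤ ε ∧ P Y

variable {μ : Measure X}

theorem OffSmallSets.mono {P Q : Set X → Prop} (h : OffSmallSets μ P) (hPQ : ∀ Y, P Y → Q Y) :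
    OffSmallSets μ Q := fun ε hε =>
  let ⟨Y, hY, hμ, hP⟩ := h ε hε
  ⟨Y, hY, hμ, hPQ Y hP⟩

theorem OffSmallSets.forall_nat {P : ℕ → Set X → Prop} (hP : ∀ i, Antitone (P i))
    (h : ∀ i, OffSmallSets μ (P i)) : OffSmallSets μ fun Y => ∀ i, P i Y := by
  intro ε hε
  obtain ⟨ε', hε', hsum⟩ := ENNReal.exists_pos_sum_of_countable' hε.ne' ℕ
  choose Y hY hμ hPY using fun i => h i (ε' i) (hε' i)
  refine ⟨⋂ i, Y i, MeasurableSet.iInter hY, ?_, fun i => hP i (Set.iInter_subset Y i) (hPY i)⟩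
  rw [Set.compl_iInter]
  exact (measure_iUnion_le _).trans ((ENNReal.tsum_le_tsum hμ).trans hsum.le)

theorem OffSmallSets.and {P Q : Set X → Prop} (hP : Antitone P) (hQ : Antitone Q)
    (h : OffSmallSets μ P) (h' : OffSmallSets μ Q) : OffSmallSets μ fun Y => P Y ∧ Q Y := by
  intro ε hε
  obtain ⟨Y, hY, hμ, hPY⟩ := h (ε / 2) (ENNReal.half_pos hε.ne')
  obtain ⟨Z, hZ, hμ', hQZ⟩ := h' (ε / 2) (ENNReal.half_pos hε.ne')
  refine ⟨Y ∩ Z, hY.inter hZ, ?_, hP Set.inter_subset_left hPY, hQ Set.inter_subset_right hQZ⟩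
  rw [Set.compl_inter, ← ENNReal.add_halves ε]
  exact (measure_union_le _ _).trans (add_le_add hμ hμ')

theorem OffSmallSets.of_ae {p : X → Prop} (h : ∀ᵐ x ∂μ, p x) :
    OffSmallSets μ fun Y => ∀ x ∈ Y, p x := by
  intro ε _
  refine ⟨(toMeasurable μ {x | ¬ p x})ᶜ, (measurableSet_toMeasurable _ _).compl, ?_, fun x hx => ?_⟩
  · rw [compl_compl, measure_toMeasurable]
    have : μ {x | ¬ p x} = 0 := h
    rw [this]
    exact zero_le
  · by_contra hp
    exact hx (subset_toMeasurable μ _ hp)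

theorem antitone_forall_mem {X : Type*} {p : X → Prop} : Antitone fun Y : Set X => ∀ x ∈ Y, p x :=
  fun _ _ hYZ h x hx => h x (hYZ hx)

/-- A function in `L_1 + L_∞` is bounded off sets of small measure. -/
theorem offSmallSets_bounded (u : L1AddLinf μ) :
    OffSmallSets μ fun Y => ∃ C : ℝ, ∀ x ∈ Y, ‖(u : X →ₘ[μ] ℂ) x‖ ≤ C := by
  intro ε hε
  obtain ⟨a, M, ha, ha0, hM, hua⟩ := exists_norm_le_of_mem_L1AddLinf u.2
  set η : ℝ := (min ε 1).toReal with hη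
  have hηpos : 0 < η := ENNReal.toReal_pos (lt_min hε one_pos).ne'
    (ne_top_of_le_ne_top ENNReal.one_ne_top (min_le_right _ _))
  set I := ∫ x, a x ∂μ with hI
  have hI0 : 0 ≤ I := integral_nonneg ha0
  set R : ℝ := (I + 1) / η with hR
  have hRpos : 0 < R := by positivity
  have hmeas : MeasurableSet {x | ‖(u : X →ₘ[μ] ℂ) x‖ ≤ R + M} :=
    measurableSet_le (u : X →ₘ[μ] ℂ).stronglyMeasurable.norm.measurable measurable_const
  refine ⟨_, hmeas, ?_, R + M, fun x hx => hx⟩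
  have h1 : μ {x | ‖(u : X →ₘ[μ] ℂ) x‖ ≤ R + M}ᶜ ≤ μ {x | R ≤ a x} := by
    refine measure_mono_ae ?_
    filter_upwards [hua] with x hx hxc
    have h2 : R + M < ‖(u : X →ₘ[μ] ℂ) x‖ := not_le.1 hxc
    have h3 : R ≤ a x := by linarith
    exact h3
  refine h1.trans ?_
  have h2 := mul_meas_ge_le_integral_of_nonneg (ae_of_all μ ha0) ha R
  have hfin : μ {x | R ≤ a x} ≠ ∞ := (ha.measure_ge_lt_top hRpos).ne
  have h3 : μ.real {x | R ≤ a x} ≤ η := by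
    have h4 : R * μ.real {x | R ≤ a x} ≤ R * η := by
      refine h2.trans ?_
      rw [hR, div_mul_cancel₀ _ hηpos.ne']
      linarith
    exact le_of_mul_le_mul_left h4 hRpos
  rw [← ofReal_measureReal hfin]
  refine (ENNReal.ofReal_le_ofReal h3).trans ?_
  rw [hη, ENNReal.ofReal_toReal (ne_top_of_le_ne_top ENNReal.one_ne_top (min_le_right _ _))]
  exact min_le_left _ _

theorem offSmallSets_forall_bounded (u : ℕ → L1AddLinf μ) :
    OffSmallSets μ fun Y => ∀ k, ∃ C : ℝ, ∀ x ∈ Y, ‖(u k : X →ₘ[μ] ℂ) x‖ ≤ C :=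
  OffSmallSets.forall_nat (fun _ _ _ hYZ ⟨C, hC⟩ => ⟨C, fun x hx => hC x (hYZ hx)⟩)
    fun k => offSmallSets_bounded (u k)

end OffSmallSets

section Weights

/-- The bound on the upper limit is turned into one for all `n`; the finitely many initial averages
increase the constant. -/
theorem exists_sum_norm_le_of_mem_weightClass_one {α : ℕ → ℂ} (hα : α ∈ weightClass 1) :
    ∃ K : ℝ, ∀ n : ℕ, ∑ k ∈ Finset.range n, ‖α k‖ ≤ K * n := by
  have h1 : limsup (fun n : ℕ => (n : ℝ≥0∞)⁻¹ * ∑ k ∈ Finset.range n, ‖α k‖ₑ) atTop < ∞ := by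
    have h2 : weightSeminorm 1 α < ∞ := hα
    simpa [weightSeminorm] using h2
  obtain ⟨c, hc1, hc2⟩ := exists_between h1
  obtain ⟨N, hN⟩ := eventually_atTop.1 (eventually_lt_of_limsup_lt hc1)
  refine ⟨c.toReal + ∑ k ∈ Finset.range N, ‖α k‖, fun n => ?_⟩
  rcases Nat.eq_zero_or_pos n with rfl | hn
  · simp
  have hn1 : (1 : ℝ) ≤ n := by exact_mod_cast hn
  have hS : 0 ≤ ∑ k ∈ Finset.range N, ‖α k‖ := by positivity
  rcases le_or_gt N n with hNn | hnN
  · have h3 := (hN n hNn).le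
    have hn0 : (n : ℝ≥0∞) ≠ 0 := by exact_mod_cast hn.ne'
    have h4 : ∑ k ∈ Finset.range n, ‖α k‖ₑ ≤ n * c := by
      calc ∑ k ∈ Finset.range n, ‖α k‖ₑ
          = n * ((n : ℝ≥0∞)⁻¹ * ∑ k ∈ Finset.range n, ‖α k‖ₑ) := by
            rw [← mul_assoc, ENNReal.mul_inv_cancel hn0 (ENNReal.natCast_ne_top n), one_mul]
        _ ≤ _ := by gcongr
    have h5 := ENNReal.toReal_mono (ENNReal.mul_ne_top (ENNReal.natCast_ne_top n) hc2.ne) h4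
    rw [ENNReal.toReal_sum (fun k _ => enorm_ne_top), ENNReal.toReal_mul,
      ENNReal.toReal_natCast] at h5
    simp only [toReal_enorm] at h5
    nlinarith
  · calc ∑ k ∈ Finset.range n, ‖α k‖ ≤ ∑ k ∈ Finset.range N, ‖α k‖ :=
          Finset.sum_le_sum_of_subset_of_nonneg (Finset.range_mono hnN.le)
            fun _ _ _ => norm_nonneg _
      _ ≤ (c.toReal + ∑ k ∈ Finset.range N, ‖α k‖) * 1 := by
          rw [mul_one]; linarith [ENNReal.toReal_nonneg (a := c)]
      _ ≤ _ := by gcongr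

theorem exists_norm_le_of_mem_weightClass_top {α : ℕ → ℂ} (hα : α ∈ weightClass ∞) :
    ∃ K : ℝ, ∀ k, ‖α k‖ ≤ K := by
  have h : ⨆ k, ‖α k‖ₑ < ∞ := by
    have h2 : weightSeminorm ∞ α < ∞ := hα
    simpa [weightSeminorm] using h2
  refine ⟨(⨆ k, ‖α k‖ₑ).toReal, fun k => ?_⟩
  rw [← toReal_enorm]
  exact ENNReal.toReal_mono h.ne (le_iSup (fun k => ‖α k‖ₑ) k)

/-- The weighted average `(1/n) ∑_{k<n} α_k F_k` of a sequence of functions. -/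
noncomputable def weightedMean {X : Type*} (α : ℕ → ℂ) (F : ℕ → X → ℂ) (n : ℕ) (x : X) : ℂ :=
  (n : ℂ)⁻¹ * ∑ k ∈ Finset.range n, α k * F k x

theorem weightedMean_add {X : Type*} (α : ℕ → ℂ) (F G : ℕ → X → ℂ) (n : ℕ) (x : X) :
    weightedMean α (fun k x => F k x + G k x) n x = weightedMean α F n x + weightedMean α G n x := by
  simp only [weightedMean, mul_add, Finset.sum_add_distrib]

theorem weightedMean_const_mul {X : Type*} (α : ℕ → ℂ) (c : ℂ) (F : ℕ → X → ℂ) (n : ℕ) (x : X) :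
    weightedMean α (fun k x => c * F k x) n x = c * weightedMean α F n x := by
  simp only [weightedMean, Finset.mul_sum]
  exact Finset.sum_congr rfl fun k _ => by ring

theorem weightedMean_congr {X : Type*} (α : ℕ → ℂ) {F G : ℕ → X → ℂ} {x : X}
    (h : ∀ k, F k x = G k x) (n : ℕ) : weightedMean α F n x = weightedMean α G n x := by
  simp only [weightedMean, h]

theorem norm_weightedMean_le {X : Type*} (α : ℕ → ℂ) (F : ℕ → X → ℂ) (n : ℕ) (x : X) :
    ‖weightedMean α F n x‖ ≤ (n : ℝ)⁻¹ * ∑ k ∈ Finset.range n, ‖α k‖ * ‖F k x‖ := by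
  rw [weightedMean, norm_mul, norm_inv, RCLike.norm_natCast]
  gcongr
  exact norm_sum_le_of_le _ fun k _ => (norm_mul _ _).le

end Weights

section Convergence

variable {X : Type*} [MeasurableSpace X] {μ : Measure X} {T : Module.End ℂ (L1AddLinf μ)}

/-- The iterates `T^k f` as functions. -/
noncomputable def orbit (T : Module.End ℂ (L1AddLinf μ)) (f : L1AddLinf μ) (k : ℕ) (x : X) : ℂ :=
  (((T ^ k) f : L1AddLinf μ) : X →ₘ[μ] ℂ) x

/-- Off sets of small measure, the weighted averages of the orbit of `f` are uniformly Cauchy for all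
weights in the class `W`; the exceptional sets do not depend on the weight. -/
def WienerWintner (T : Module.End ℂ (L1AddLinf μ)) (W : Set (ℕ → ℂ)) (f : L1AddLinf μ) : Prop :=
  OffSmallSets μ fun Y => ∀ α ∈ W, UniformCauchySeqOn (weightedMean α (orbit T f)) atTop Y

theorem antitone_uniformCauchySeqOn {X : Type*} (W : Set (ℕ → ℂ)) (F : ℕ → X → ℂ) :
    Antitone fun Y : Set X => ∀ α ∈ W, UniformCauchySeqOn (weightedMean α F) atTop Y :=
  fun _ _ hYZ h α hα => (h α hα).mono hYZ

theorem ae_orbit_add (T : Module.End ℂ (L1AddLinf μ)) (f g : L1AddLinf μ) :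
    ∀ᵐ x ∂μ, ∀ k, orbit T (f + g) k x = orbit T f k x + orbit T g k x := by
  rw [ae_all_iff]
  intro k
  simp only [orbit, map_add]
  exact L1AddLinf.coeFn_add _ _

theorem UniformCauchySeqOn.congr_on {X : Type*} {F G : ℕ → X → ℂ} {Y : Set X}
    (hF : UniformCauchySeqOn F atTop Y) (h : ∀ n, ∀ x ∈ Y, F n x = G n x) :
    UniformCauchySeqOn G atTop Y := by
  rw [Metric.uniformCauchySeqOn_iff] at hF ⊢
  intro ε hε
  obtain ⟨N, hN⟩ := hF ε hε
  exact ⟨N, fun m hm n hn x hx => by rw [← h m x hx, ← h n x hx]; exact hN m hm n hn x hx⟩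

namespace WienerWintner

variable {W : Set (ℕ → ℂ)} {f g : L1AddLinf μ}

theorem add (hf : WienerWintner T W f) (hg : WienerWintner T W g) : WienerWintner T W (f + g) := by
  refine ((OffSmallSets.and (antitone_uniformCauchySeqOn W _) (antitone_uniformCauchySeqOn W _)
    hf hg).and (fun _ _ hYZ h => ⟨antitone_uniformCauchySeqOn W _ hYZ h.1,
      antitone_uniformCauchySeqOn W _ hYZ h.2⟩) antitone_forall_mem
    (OffSmallSets.of_ae (ae_orbit_add T f g))).mono ?_
  rintro Y ⟨⟨h1, h2⟩, h3⟩ α hα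
  refine ((h1 α hα).add (h2 α hα)).congr_on fun n x hx => ?_
  rw [weightedMean_congr (G := fun k x => orbit T f k x + orbit T g k x) α (h3 x hx),
    weightedMean_add]
  rfl

theorem smul (c : ℂ) (hf : WienerWintner T W f) : WienerWintner T W (c • f) := by
  have hae : ∀ᵐ x ∂μ, ∀ k, orbit T (c • f) k x = c * orbit T f k x := by
    rw [ae_all_iff]
    intro k
    simp only [orbit, map_smul]
    exact L1AddLinf.coeFn_smul _ _
  refine (OffSmallSets.and (antitone_uniformCauchySeqOn W _) antitone_forall_mem hf
    (OffSmallSets.of_ae hae)).mono ?_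
  rintro Y ⟨h1, h2⟩ α hα
  have h3 := h1 α hα
  rw [Metric.uniformCauchySeqOn_iff] at h3 ⊢
  intro ε hε
  obtain ⟨N, hN⟩ := h3 (ε / (‖c‖ + 1)) (by positivity)
  refine ⟨N, fun m hm n hn x hx => ?_⟩
  have h : ∀ n, weightedMean α (orbit T (c • f)) n x = c * weightedMean α (orbit T f) n x :=
    fun n => (weightedMean_congr α (G := fun k x => c * orbit T f k x) (h2 x hx) n).trans
      (weightedMean_const_mul α c _ n x)
  rw [h, h, dist_eq_norm, ← mul_sub, norm_mul, ← dist_eq_norm]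
  have h4 := hN m hm n hn x hx
  rw [lt_div_iff₀ (by positivity)] at h4
  nlinarith [dist_nonneg (x := weightedMean α (orbit T f) m x) (y := weightedMean α (orbit T f) n x)]

theorem zero : WienerWintner T W (0 : L1AddLinf μ) := by
  have hae : ∀ᵐ x ∂μ, ∀ k, orbit T (0 : L1AddLinf μ) k x = 0 := by
    rw [ae_all_iff]
    intro k
    simp only [orbit, map_zero]
    exact AEEqFun.coeFn_zero
  refine (OffSmallSets.of_ae hae).mono fun Y h α _ => ?_
  rw [Metric.uniformCauchySeqOn_iff]
  intro ε hε
  refine ⟨0, fun m _ n _ x hx => ?_⟩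
  simpa [weightedMean, h x hx] using hε

/-- For an eigenvector, the averages with a Hartman weight are scalar multiples of the
eigenvector. -/
theorem of_eigenvector (hW : W ⊆ hartmanSequences) {z : ℂ} (hz : ‖z‖ = 1) (hf : T f = z • f) :
    WienerWintner T W f := by
  have hpow : ∀ k, (T ^ k) f = z ^ k • f := fun k => by
    induction k with
    | zero => simp
    | succ k ih => rw [pow_succ', Module.End.mul_apply, ih, map_smul, hf, smul_smul, pow_succ]
  have hae : ∀ᵐ x ∂μ, ∀ k, orbit T f k x = (f : X →ₘ[μ] ℂ) x * z ^ k := by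
    rw [ae_all_iff]
    intro k
    simp only [orbit, hpow]
    filter_upwards [L1AddLinf.coeFn_smul (z ^ k) f] with x hx
    rw [hx, mul_comm]
  refine (OffSmallSets.and (fun _ _ hYZ ⟨C, hC⟩ => ⟨C, fun x hx => hC x (hYZ hx)⟩)
    antitone_forall_mem (offSmallSets_bounded f) (OffSmallSets.of_ae hae)).mono ?_
  rintro Y ⟨⟨C, hC⟩, h2⟩ α hα
  obtain ⟨c, hc⟩ := (hW hα).2 z hz
  rw [Metric.uniformCauchySeqOn_iff]
  intro ε hε
  obtain ⟨N, hN⟩ := Metric.cauchySeq_iff.1 hc.cauchySeq (ε / (|C| + 1)) (by positivity)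
  refine ⟨N, fun m hm n hn x hx => ?_⟩
  have h3 : ∀ n, weightedMean α (orbit T f) n x
      = (f : X →ₘ[μ] ℂ) x * ((n : ℂ)⁻¹ * ∑ k ∈ Finset.range n, α k * z ^ k) := fun n => by
    simp only [weightedMean, h2 x hx, Finset.mul_sum]
    exact Finset.sum_congr rfl fun k _ => by ring
  rw [h3, h3, dist_eq_norm, ← mul_sub, norm_mul, ← dist_eq_norm]
  have h4 := hN m hm n hn
  rw [lt_div_iff₀ (by positivity)] at h4
  have h5 := (hC x hx).trans (le_abs_self C)
  calc _ ≤ |C| * dist ((m : ℂ)⁻¹ * ∑ k ∈ Finset.range m, α k * z ^ k)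
        ((n : ℂ)⁻¹ * ∑ k ∈ Finset.range n, α k * z ^ k) := by gcongr
    _ ≤ dist ((m : ℂ)⁻¹ * ∑ k ∈ Finset.range m, α k * z ^ k)
        ((n : ℂ)⁻¹ * ∑ k ∈ Finset.range n, α k * z ^ k) * (|C| + 1) := by
        rw [mul_comm]; gcongr; linarith
    _ < ε := h4

theorem of_mem_unimodularSpan (hW : W ⊆ hartmanSequences) {e : L1AddLinf μ}
    (he : e ∈ unimodularSpan T) : WienerWintner T W e := by
  induction he using Submodule.span_induction with
  | mem u hu =>
    obtain ⟨z, hz, hzu⟩ := hu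
    exact of_eigenvector hW hz hzu
  | zero => exact zero
  | add x y _ _ hx hy => exact hx.add hy
  | smul c x _ hx => exact hx.smul c

/-- If the iterates converge to `0` almost uniformly, so do their averages with weights in `W_1`. -/
theorem of_tendstoAlmostUniformly (hW : W ⊆ weightClass 1)
    (hf : TendstoAlmostUniformly μ (fun n => (((T ^ n) f : L1AddLinf μ) : X →ₘ[μ] ℂ)) 0) :
    WienerWintner T W f := by
  have hunif : OffSmallSets μ fun Y => ∀ η : ℝ, 0 < η →
      ∃ N, ∀ k, N ≤ k → ∀ x ∈ Y, ‖orbit T f k x‖ ≤ η := by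
    intro ε hε
    obtain ⟨Y, hY, hμY, hlim⟩ := hf (ε / 2) (ENNReal.half_pos hε.ne')
    have hae : ∀ᵐ x ∂μ, ∀ n, ‖Y.indicator
        ((((T ^ n) f : L1AddLinf μ) : X →ₘ[μ] ℂ) - 0 : X →ₘ[μ] ℂ) x‖ₑ
        ≤ eLpNorm (Y.indicator ((((T ^ n) f : L1AddLinf μ) : X →ₘ[μ] ℂ) - 0 : X →ₘ[μ] ℂ)) ∞ μ := by
      rw [ae_all_iff]
      intro n
      rw [eLpNorm_exponent_top]
      exact ae_le_eLpNormEssSup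
    obtain ⟨Z, hZ, hμZ, hZae⟩ := OffSmallSets.of_ae hae (ε / 2) (ENNReal.half_pos hε.ne')
    refine ⟨Y ∩ Z, hY.inter hZ, ?_, fun η hη => ?_⟩
    · rw [Set.compl_inter, ← ENNReal.add_halves ε]
      exact (measure_union_le _ _).trans (add_le_add hμY hμZ)
    · obtain ⟨N, hN⟩ := eventually_atTop.1
        ((tendsto_order.1 hlim).2 (ENNReal.ofReal η) (ENNReal.ofReal_pos.2 hη))
      refine ⟨N, fun k hk x hx => ?_⟩
      have h1 := (hZae x hx.2 k).trans (hN k hk).le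
      rw [Set.indicator_of_mem hx.1, sub_zero, ← ofReal_norm,
        ENNReal.ofReal_le_ofReal_iff hη.le] at h1
      exact h1
  refine (OffSmallSets.and
    (fun _ _ hYZ h η hη => (h η hη).imp fun N hN k hk x hx => hN k hk x (hYZ hx))
    (fun _ _ hYZ h k => (h k).imp fun C hC x hx => hC x (hYZ hx)) hunif
    (offSmallSets_forall_bounded fun k => (T ^ k) f)).mono ?_
  rintro Y ⟨h1, h2⟩ α hα
  choose C hC using h2
  obtain ⟨K, hK⟩ := exists_sum_norm_le_of_mem_weightClass_one (hW hα)
  have hK0 : 0 ≤ K := by simpa using (norm_nonneg (α 0)).trans (by simpa using hK 1)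
  have hlim : TendstoUniformlyOn (weightedMean α (orbit T f)) 0 atTop Y := by
    rw [Metric.tendstoUniformlyOn_iff]
    intro ε hε
    obtain ⟨N, hN⟩ := h1 (ε / (2 * (K + 1))) (by positivity)
    set S : ℝ := ∑ k ∈ Finset.range N, ‖α k‖ * |C k| with hS
    have hS0 : 0 ≤ S := by positivity
    have htend : Tendsto (fun n : ℕ => (n : ℝ)⁻¹ * S) atTop (𝓝 0) := by
      have := (tendsto_inv_atTop_nhds_zero_nat (𝕜 := ℝ)).mul_const S
      rwa [zero_mul] at this
    filter_upwards [(tendsto_order.1 htend).2 (ε / 2) (by positivity), eventually_ge_atTop N,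
      eventually_gt_atTop 0] with n hn hnN hn0 x hx
    have hn0' : (0 : ℝ) < n := by exact_mod_cast hn0
    rw [Pi.zero_apply, dist_zero_left]
    refine (norm_weightedMean_le α _ n x).trans_lt ?_
    have hsplit : ∑ k ∈ Finset.range n, ‖α k‖ * ‖orbit T f k x‖
        ≤ S + ε / (2 * (K + 1)) * (K * n) := by
      rw [← Finset.sum_range_add_sum_Ico _ hnN]
      refine add_le_add (Finset.sum_le_sum fun k _ => ?_) ?_
      · gcongr
        exact (hC k x hx).trans (le_abs_self _)
      · calc ∑ k ∈ Finset.Ico N n, ‖α k‖ * ‖orbit T f k x‖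
            ≤ ∑ k ∈ Finset.Ico N n, ‖α k‖ * (ε / (2 * (K + 1))) :=
              Finset.sum_le_sum fun k hk => by
                gcongr
                exact hN k (Finset.mem_Ico.1 hk).1 x hx
          _ ≤ ∑ k ∈ Finset.range n, ‖α k‖ * (ε / (2 * (K + 1))) :=
              Finset.sum_le_sum_of_subset_of_nonneg
                (fun k hk => Finset.mem_range.2 (Finset.mem_Ico.1 hk).2) fun _ _ _ => by positivity
          _ ≤ _ := by
              rw [← Finset.sum_mul, mul_comm]
              gcongr
              exact hK n
    calc (n : ℝ)⁻¹ * ∑ k ∈ Finset.range n, ‖α k‖ * ‖orbit T f k x‖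
        ≤ (n : ℝ)⁻¹ * (S + ε / (2 * (K + 1)) * (K * n)) := by gcongr
      _ = (n : ℝ)⁻¹ * S + ε / 2 * (K / (K + 1)) := by field_simp
      _ ≤ (n : ℝ)⁻¹ * S + ε / 2 * 1 := by
          gcongr
          rw [div_le_one (by positivity)]
          linarith
      _ < ε := by linarith
  exact hlim.uniformCauchySeqOn

/-- The Banach principle: `f` has the convergence property if it can be approximated by such vectors,
with errors whose averages are uniformly small off small sets. The size of a weight `α ∈ W` is measured
by any constant `C` with `adm α C`. -/
theorem of_approx {adm : (ℕ → ℂ) → ℝ → Prop} (hadm : ∀ α ∈ W, ∃ C, adm α C)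
    (h : ∀ η : ℝ, 0 < η → ∀ ε : ℝ≥0∞, 0 < ε → ∃ g r : L1AddLinf μ, f = g + r ∧
      WienerWintner T W g ∧ ∃ Y : Set X, MeasurableSet Y ∧ μ Yᶜ ≤ ε ∧
        ∀ α C, adm α C → ∀ n, ∀ x ∈ Y, ‖weightedMean α (orbit T r) n x‖ ≤ C * η) :
    WienerWintner T W f := by
  set P : ℝ → Set X → Prop := fun η Y => ∃ g r : L1AddLinf μ,
    (∀ α ∈ W, UniformCauchySeqOn (weightedMean α (orbit T g)) atTop Y) ∧
    (∀ α C, adm α C → ∀ n, ∀ x ∈ Y, ‖weightedMean α (orbit T r) n x‖ ≤ C * η) ∧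
    ∀ x ∈ Y, ∀ k, orbit T f k x = orbit T g k x + orbit T r k x with hP
  have hPanti : ∀ η, Antitone (P η) := by
    rintro η Y Z hYZ ⟨g, r, h1, h2, h3⟩
    exact ⟨g, r, fun α hα => (h1 α hα).mono hYZ, fun α C hC n x hx => h2 α C hC n x (hYZ hx),
      fun x hx => h3 x (hYZ hx)⟩
  have hPoff : ∀ η, 0 < η → OffSmallSets μ (P η) := by
    intro η hη ε hε
    have hε3 : 0 < ε / 2 := ENNReal.half_pos hε.ne'
    obtain ⟨g, r, rfl, hg, Y, hY, hμY, hYr⟩ := h η hη (ε / 2) hε3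
    obtain ⟨Z, hZ, hμZ, hZ1, hZ2⟩ := OffSmallSets.and (antitone_uniformCauchySeqOn W _)
      antitone_forall_mem hg (OffSmallSets.of_ae (ae_orbit_add T g r)) (ε / 2) hε3
    refine ⟨Y ∩ Z, hY.inter hZ, ?_, g, r, fun α hα => (hZ1 α hα).mono Set.inter_subset_right,
      fun α C hC n x hx => hYr α C hC n x hx.1, fun x hx => hZ2 x hx.2⟩
    rw [Set.compl_inter, ← ENNReal.add_halves ε]
    exact (measure_union_le _ _).trans (add_le_add hμY hμZ)
  refine (OffSmallSets.forall_nat (P := fun m : ℕ => P (1 / (m + 1))) (fun m => hPanti _)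
    fun m => hPoff _ (by positivity)).mono fun Y hY α hα => ?_
  obtain ⟨C, hC⟩ := hadm α hα
  rw [Metric.uniformCauchySeqOn_iff]
  intro ε hε
  obtain ⟨m, hm⟩ : ∃ m : ℕ, C * (1 / ((m : ℝ) + 1)) < ε / 3 := by
    have ht := (tendsto_one_div_add_atTop_nhds_zero_nat (𝕜 := ℝ)).const_mul C
    rw [mul_zero] at ht
    exact ((tendsto_order.1 ht).2 (ε / 3) (by positivity)).exists
  obtain ⟨g, r, h1, h2, h3⟩ := hY m
  obtain ⟨N, hN⟩ := Metric.uniformCauchySeqOn_iff.1 (h1 α hα) (ε / 3) (by positivity)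
  refine ⟨N, fun i hi j hj x hx => ?_⟩
  have h4 : ∀ i, weightedMean α (orbit T f) i x
      = weightedMean α (orbit T g) i x + weightedMean α (orbit T r) i x := fun i => by
    rw [weightedMean_congr (G := fun k x => orbit T g k x + orbit T r k x) α (h3 x hx),
      weightedMean_add]
  rw [h4, h4]
  have h5 := h2 α C hC i x hx
  have h6 := h2 α C hC j x hx
  have h7 := hN i hi j hj x hx
  rw [dist_eq_norm] at h7 ⊢
  have h8 : weightedMean α (orbit T g) i x + weightedMean α (orbit T r) i x
      - (weightedMean α (orbit T g) j x + weightedMean α (orbit T r) j x)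
      = (weightedMean α (orbit T g) i x - weightedMean α (orbit T g) j x)
        + weightedMean α (orbit T r) i x - weightedMean α (orbit T r) j x := by ring
  rw [h8]
  have h9 := norm_sub_le ((weightedMean α (orbit T g) i x - weightedMean α (orbit T g) j x)
        + weightedMean α (orbit T r) i x) (weightedMean α (orbit T r) j x)
  have h10 := norm_add_le (weightedMean α (orbit T g) i x - weightedMean α (orbit T g) j x)
        (weightedMean α (orbit T r) i x)
  linarith

/-- Every single `T^k f` is bounded off a small set, so the averages are bounded there as well. -/
theorem exists_convergesUniformlyOn {p : ℝ≥0∞} [Fact (1 ≤ p)] {f : Lp ℂ p μ}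
    (hf : WienerWintner T W (lpInclusion μ p f)) {ε : ℝ≥0∞} (hε : 0 < ε) :
    ∃ Y : Set X, MeasurableSet Y ∧ μ Yᶜ < ε ∧
      ∀ α ∈ W, ConvergesUniformlyOn (fun n => weightedAverage T α n f) Y := by
  obtain ⟨ε', hε'0, hε'⟩ := exists_between hε
  obtain ⟨Y, hY, hμY, h1, h2⟩ := OffSmallSets.and
    (fun _ _ hYZ h k => (h k).imp fun C hC x hx => hC x (hYZ hx)) (antitone_uniformCauchySeqOn W _)
    (offSmallSets_forall_bounded fun k => (T ^ k) (lpInclusion μ p f)) hf ε' hε'0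
  refine ⟨Y, hY, hμY.trans_lt hε', fun α hα => ⟨fun n => ?_, ?_⟩⟩
  · choose C hC using h1
    refine ⟨(n : ℝ)⁻¹ * ∑ k ∈ Finset.range n, ‖α k‖ * C k, fun x hx => ?_⟩
    refine (norm_weightedMean_le α (orbit T (lpInclusion μ p f)) n x).trans ?_
    gcongr with k _
    exact hC k x hx
  · have h3 : UniformCauchySeqOn (fun n => weightedAverage T α n f) atTop Y := h2 α hα
    have h4 : ∀ x, ∃ c, x ∈ Y → Tendsto (fun n => weightedAverage T α n f x) atTop (𝓝 c) := by
      intro x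
      by_cases hx : x ∈ Y
      · obtain ⟨c, hc⟩ := cauchySeq_tendsto_of_complete (h3.cauchySeq hx)
        exact ⟨c, fun _ => hc⟩
      · exact ⟨0, fun h => absurd h hx⟩
    choose g hg using h4
    exact ⟨g, h3.tendstoUniformlyOn_of_tendsto fun x hx => hg x hx⟩

end WienerWintner

theorem norm_weightedMean_le_of_norm_le {X : Type*} {α : ℕ → ℂ} {C : ℝ} (hα : ∀ k, ‖α k‖ ≤ C)
    {F : ℕ → X → ℂ} {x : X} {η : ℝ} (hη : 0 ≤ η)
    (hF : ∀ n : ℕ, ∑ k ∈ Finset.range n, ‖F k x‖ ≤ n * η) (n : ℕ) :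
    ‖weightedMean α F n x‖ ≤ C * η := by
  have hC : 0 ≤ C := (norm_nonneg _).trans (hα 0)
  refine (norm_weightedMean_le α F n x).trans ?_
  rcases Nat.eq_zero_or_pos n with rfl | hn
  · simp; positivity
  have hn' : (0 : ℝ) < n := by exact_mod_cast hn
  rw [inv_mul_le_iff₀ hn']
  calc ∑ k ∈ Finset.range n, ‖α k‖ * ‖F k x‖ ≤ ∑ k ∈ Finset.range n, C * ‖F k x‖ := by
        gcongr with k _; exact hα k
    _ = C * ∑ k ∈ Finset.range n, ‖F k x‖ := by rw [Finset.mul_sum]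
    _ ≤ C * (n * η) := by gcongr; exact hF n
    _ = n * (C * η) := by ring

theorem norm_weightedMean_le_of_sum_norm_le {X : Type*} {α : ℕ → ℂ} {C : ℝ}
    (hα : ∀ n : ℕ, ∑ k ∈ Finset.range n, ‖α k‖ ≤ C * n) {F : ℕ → X → ℂ}
    {x : X} {η : ℝ} (hF : ∀ k, ‖F k x‖ ≤ η) (n : ℕ) :
    ‖weightedMean α F n x‖ ≤ C * η := by
  have hη : 0 ≤ η := (norm_nonneg _).trans (hF 0)
  have hC : 0 ≤ C := (norm_nonneg (α 0)).trans (by simpa using hα 1)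
  refine (norm_weightedMean_le α F n x).trans ?_
  rcases Nat.eq_zero_or_pos n with rfl | hn
  · simp; positivity
  have hn' : (0 : ℝ) < n := by exact_mod_cast hn
  rw [inv_mul_le_iff₀ hn']
  calc ∑ k ∈ Finset.range n, ‖α k‖ * ‖F k x‖ ≤ ∑ k ∈ Finset.range n, ‖α k‖ * η := by
        gcongr with k _; exact hF k
    _ = (∑ k ∈ Finset.range n, ‖α k‖) * η := by rw [Finset.sum_mul]
    _ ≤ (C * n) * η := by gcongr; exact hα n
    _ = n * (C * η) := by ring

/-- Functions in `L_1 ∩ L_∞` are dense in `L_p`, `p < ∞`. -/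
theorem exists_boundedL1Linf_add_small {p : ℝ≥0∞} [hp1 : Fact (1 ≤ p)] (hp : p < ∞) (f : Lp ℂ p μ)
    {γ : ℝ} (hγ : 0 < γ) : ∃ (g : L1AddLinf μ) (C : ℝ≥0∞) (r : Lp ℂ p μ), C ≠ ∞ ∧
      BoundedL1Linf C (g : X →ₘ[μ] ℂ) ∧ ‖r‖ < γ ∧ lpInclusion μ p f = g + lpInclusion μ p r := by
  have hp0 : p ≠ 0 := (zero_lt_one.trans_le hp1.out).ne'
  obtain ⟨φ, hφ, hφp⟩ := (Lp.memLp f).exists_simpleFunc_eLpNorm_sub_lt hp.ne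
    (ENNReal.ofReal_pos.2 (half_pos hγ)).ne'
  have hφ1 : MemLp φ 1 μ := (SimpleFunc.memLp_iff_finMeasSupp one_ne_zero ENNReal.one_ne_top).2
    ((SimpleFunc.memLp_iff_finMeasSupp hp0 hp.ne).1 hφp)
  have hφinf : MemLp φ ∞ μ := SimpleFunc.memLp_top φ μ
  set g : Lp ℂ p μ := hφp.toLp φ with hg
  have hgφ : (g : X →ₘ[μ] ℂ) =ᵐ[μ] φ := hφp.coeFn_toLp
  refine ⟨lpInclusion μ p g, max (eLpNorm φ 1 μ) (eLpNorm φ ∞ μ), f - g,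
    (max_lt hφ1.2 hφinf.2).ne, ⟨?_, ?_⟩, ?_, ?_⟩
  · exact (eLpNorm_congr_ae hgφ).le.trans (le_max_left _ _)
  · exact (eLpNorm_congr_ae hgφ).le.trans (le_max_right _ _)
  · have h1 : eLpNorm ((f - g : Lp ℂ p μ) : X →ₘ[μ] ℂ) p μ < ENNReal.ofReal (γ / 2) := by
      refine lt_of_eq_of_lt (eLpNorm_congr_ae ?_) hφ
      filter_upwards [Lp.coeFn_sub f g, hgφ] with x h1 h2
      rw [h1, Pi.sub_apply, Pi.sub_apply, h2]
    rw [Lp.norm_def]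
    exact (ENNReal.toReal_le_of_le_ofReal (half_pos hγ).le h1.le).trans_lt (half_lt_self hγ)
  · rw [← map_add]
    congr 1
    abel

section Main

variable {q : ℝ≥0∞} [Fact (1 ≤ q)]

theorem WienerWintner.of_mem_flightVectors
    (hflight : ∀ f ∈ flightVectors T q, TendstoAlmostUniformly μ (fun n => lpIterate T n f) 0)
    {s : Lp ℂ q μ} (hs : s ∈ flightVectors T q) {W : Set (ℕ → ℂ)} (hW : W ⊆ hartmanSequences) :
    WienerWintner T W (lpInclusion μ q s) :=
  of_tendstoAlmostUniformly (fun _ hα => (hW hα).1) (hflight s hs)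

/-- Approximation in `L_p` transfers the convergence property for bounded weights, by the maximal
inequality. -/
theorem WienerWintner.of_approx_Lp [SigmaFinite μ] (hT : IsPositiveDunfordSchwartz T)
    {W : Set (ℕ → ℂ)} (hW : W ⊆ weightClass ∞) (p : ℝ≥0∞) [Fact (1 ≤ p)] (hp : p < ∞) {f : L1AddLinf μ}
    (h : ∀ γ : ℝ, 0 < γ → ∃ (g : L1AddLinf μ) (r : Lp ℂ p μ), ‖r‖ < γ ∧ f = g + lpInclusion μ p r ∧
      WienerWintner T W g) : WienerWintner T W f := by
  refine of_approx (adm := fun α C => ∀ k, ‖α k‖ ≤ C)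
    (fun α hα => exists_norm_le_of_mem_weightClass_top (hW hα)) fun η hη ε hε => ?_
  obtain ⟨γ, hγ, hmax⟩ := exists_forall_sum_norm_iterate_le hT p hp hε hη
  obtain ⟨g, r, hr, hf, hg⟩ := h γ hγ
  obtain ⟨Y, hY, hμY, hYr⟩ := hmax r hr
  exact ⟨g, lpInclusion μ p r, hf, hg, Y, hY, hμY, fun α C hC n x hx =>
    norm_weightedMean_le_of_norm_le hC hη.le (hYr x hx) n⟩

/-- Approximation in `L_q` transfers the convergence property for weights in `W_1` if the iterates
are uniformly equicontinuous in measure. -/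
theorem WienerWintner.of_approx_iteratesUEM (huem : IteratesUEM T q) {W : Set (ℕ → ℂ)}
    (hW : W ⊆ weightClass 1) {f : L1AddLinf μ}
    (h : ∀ γ : ℝ, 0 < γ → ∃ (g : L1AddLinf μ) (r : Lp ℂ q μ), ‖r‖ < γ ∧ f = g + lpInclusion μ q r ∧
      WienerWintner T W g) : WienerWintner T W f := by
  refine of_approx (adm := fun α C => ∀ n : ℕ, ∑ k ∈ Finset.range n, ‖α k‖ ≤ C * n)
    (fun α hα => exists_sum_norm_le_of_mem_weightClass_one (hW hα)) fun η hη ε hε => ?_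
  obtain ⟨γ, hγ, hmax⟩ := huem (ε / 2) (ENNReal.ofReal η) (ENNReal.half_pos hε.ne')
    (ENNReal.ofReal_pos.2 hη)
  obtain ⟨g, r, hr, hf, hg⟩ := h γ hγ
  obtain ⟨Y, hY, hμY, hYr⟩ := hmax r hr
  have hae : ∀ᵐ x ∂μ, ∀ n, ‖Y.indicator (lpIterate T n r) x‖ₑ ≤ ENNReal.ofReal η := by
    rw [ae_all_iff]
    intro n
    have h1 := hYr n
    rw [eLpNorm_exponent_top] at h1
    filter_upwards [ae_le_eLpNormEssSup (f := Y.indicator (lpIterate T n r)) (μ := μ)] with x hx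
    exact hx.trans h1
  obtain ⟨Z, hZ, hμZ, hZae⟩ := OffSmallSets.of_ae hae (ε / 2) (ENNReal.half_pos hε.ne')
  refine ⟨g, lpInclusion μ q r, hf, hg, Y ∩ Z, hY.inter hZ, ?_, fun α C hC n x hx =>
    norm_weightedMean_le_of_sum_norm_le hC (fun k => ?_) n⟩
  · rw [Set.compl_inter, ← ENNReal.add_halves ε]
    exact (measure_union_le _ _).trans (add_le_add hμY hμZ)
  · have h1 := hZae x hx.2 k
    rw [Set.indicator_of_mem hx.1, ← ofReal_norm, ENNReal.ofReal_le_ofReal_iff hη.le] at h1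
    exact h1

end Main

end Convergence

/-! ### Convergence of weighted averages -/

theorem corollary4p3 {X : Type*} [MeasurableSpace X] (μ : Measure X) [SigmaFinite μ]
    (q : ℝ≥0∞) [Fact (1 ≤ q)] (hq : 1 < q) (hq' : q < ∞)
    (T : Module.End ℂ (L1AddLinf μ)) (hT : IsPositiveDunfordSchwartz T)
    (hflight : ∀ f ∈ flightVectors T q,
      TendstoAlmostUniformly μ (fun n => lpIterate T n f) 0) :
    (∀ (p : ℝ≥0∞) [Fact (1 ≤ p)], p < ∞ → ∀ (f : Lp ℂ p μ) (ε : ℝ≥0∞), 0 < ε →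
      ∃ Y : Set X, MeasurableSet Y ∧ μ Yᶜ < ε ∧
        ∀ α ∈ weightClass ∞ ∩ hartmanSequences,
          ConvergesUniformlyOn (fun n => weightedAverage T α n f) Y) ∧
    (IteratesUEM T q → ∀ (f : Lp ℂ q μ) (ε : ℝ≥0∞), 0 < ε →
      ∃ Y : Set X, MeasurableSet Y ∧ μ Yᶜ < ε ∧
        ∀ α ∈ weightClassOnePlus ∩ hartmanSequences,
          ConvergesUniformlyOn (fun n => weightedAverage T α n f) Y) := by
  -- approximation of vectors in `L_1 ∩ L_∞` by sums of a flight vector and of eigenvectors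
  have key : ∀ (W : Set (ℕ → ℂ)), W ⊆ hartmanSequences → ∀ (g : L1AddLinf μ) (C : ℝ≥0∞), C ≠ ∞ →
      BoundedL1Linf C (g : X →ₘ[μ] ℂ) → ∀ γ : ℝ, 0 < γ → ∃ (g' : L1AddLinf μ) (r : Lp ℂ q μ),
        ‖r‖ < γ ∧ g = g' + lpInclusion μ q r ∧ WienerWintner T W g' := by
    intro W hW g C hC hg γ hγ
    obtain ⟨s, hs, e, he, r, hr, hgr⟩ :=
      exists_flight_add_eigen_add_small hT q hq hq' hC hg (half_pos hγ)
    exact ⟨_, r, hr.trans_lt (half_lt_self hγ), hgr,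
      (WienerWintner.of_mem_flightVectors hflight hs hW).add
        (WienerWintner.of_mem_unimodularSpan hW he)⟩
  refine ⟨fun p _ hp f ε hε => ?_, fun huem f ε hε => ?_⟩
  · refine WienerWintner.exists_convergesUniformlyOn ?_ hε
    refine WienerWintner.of_approx_Lp hT Set.inter_subset_left p hp fun γ hγ => ?_
    obtain ⟨g, C, r, hC, hg, hr, hfg⟩ := exists_boundedL1Linf_add_small hp f hγ
    exact ⟨g, r, hr, hfg, WienerWintner.of_approx_Lp hT Set.inter_subset_left q hq'
      (key _ Set.inter_subset_right g C hC hg)⟩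
  · refine WienerWintner.exists_convergesUniformlyOn ?_ hε
    have hW : weightClassOnePlus ∩ hartmanSequences ⊆ weightClass 1 := fun α hα => hα.2.1
    refine WienerWintner.of_approx_iteratesUEM huem hW fun γ hγ => ?_
    obtain ⟨g, C, r, hC, hg, hr, hfg⟩ := exists_boundedL1Linf_add_small hq' f (half_pos hγ)
    obtain ⟨g', r', hr', hg', hgood⟩ := key _ Set.inter_subset_right g C hC hg (γ / 2) (half_pos hγ)
    refine ⟨g', r' + r, ?_, ?_, hgood⟩
    · exact (norm_add_le _ _).trans_lt (by linarith)
    · rw [hfg, hg', map_add, add_assoc]
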